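/- Setting. Let $N\ge 1$, $p\ge 2$ be integers, $b\in\mathbb R$, and let $v=(v_n)_{n\in\mathbb Z}$ be a real $2p$-periodic sequence with $v_1,\dots,v_{2p}$ pairwise distinct. On $\ell^2(\mathbb Z\times\{0,1\}\times\mathbb Z/N)$ let $H^b(t)=H_0^b+tV$ be the Hamiltonian of the zigzag nanotube, $$(H_0^bf)_{n,0,k}=e^{-ib}f_{n-1,1,k}+e^{ib}f_{n-1,1,k-1}+f_{n,1,k},\qquad (H_0^bf)_{n,1,k}=e^{-ib}f_{n+1,0,k+1}+e^{ib}f_{n+1,0,k}+f_{n,0,k},$$ $$(Vf)_{n,0,k}=v_{2n+1}f_{n,0,k},\qquad (Vf)_{n,1,k}=v_{2n+2}f_{n,1,k}.$$ For $k\in\{1,\dots,N\}$ put $c_k=\cos(b+\pi k/N)$, $a_{k,2n}=2|c_k|$, $a_{k,2n+1}=1$, and let $J_k^b(t)$ be the Jacobi operator $(J_k^b(t)y)_n=a_{k,n-1}y_{n-1}+a_{k,n}y_{n+1}+tv_ny_n$ on $\ell^2(\mathbb Z)$. Let $z_{k,0}^+(t)\le z_{k,1}^-(t)\le z_{k,1}^+(t)\le\dots\le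 z_{k,2p}^-(t)$ be its $2p$-periodic and $2p$-antiperiodic eigenvalues, counted with multiplicity, and let $\sigma_{k,m}(t)=[z_{k,m-1}^+(t),z_{k,m}^-(t)]$, $1\le m\le 2p$, be its bands. Let $\alpha$ be the permutation of $\{1,\dots,2p\}$ with $v_{\alpha(1)}<\dots<v_{\alpha(2p)}$, and $\tilde n=\alpha^{-1}(n)$. Put $h_m=v_{\alpha(m)}$, $h_m^0=(h_m+h_{m+1})/2$ for $1\le m<2p$, $h_0^0=-\infty$, $h_{2p}^0=+\infty$, and $\mathcal C_m(t)=[th_{m-1}^0,th_m^0)$ (intersected with $\mathbb R$). Put $$C_{k,n}=\frac{a_{k,n-1}^2}{v_{n-1}-v_n}+\frac{a_{k,n}^2}{v_{n+1}-v_n},\qquad E_{k,n}=\frac1{4|2c_k|^p}\prod_{1\le j\le 2p,\ j\ne n}|v_n-v_j| .$$ Theorem. (1) If $c_k\neq0$, then for every $n\in\{1,\dots,2p\}$, as $t\to\infty$, $$z_{k,\tilde n-1}^{+}(t)=tv_n-\frac{C_{k,n}+O(t^{-1})}{t},\qquad z_{k,\tilde n}^{-}(t)-z_{k,\tilde n-1}^{+}(t)=\frac{1+O(t^{-1})}{E_{k,n}\,t^{2p-1}}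 .$$ (2) For all sufficiently large $t$ and all $n\in\{1,\dots,2p\}$, $$\sigma(H^b(t))\cap\mathcal C_{\tilde n}(t)=\bigcup_{k=1}^N\sigma_{k,\tilde n}(t).$$ Moreover, if $\delta>\max_{k,n}|C_{k,n}|$, or if $\delta>\max_n\frac{5}{|v_n-v_{n+1}|}$, then for all sufficiently large $t$ and all $n$ this set is contained in $\left(v_nt-\frac\delta t,\ v_nt+\frac\delta t\right)$. (3) For all sufficiently large $t$, all $n\in\{1,\dots,2p\}$ and all $k,k'\in\{1,\dots,N\}$: $\sigma_{k,\tilde n}(t)\cap\sigma_{k',\tilde n}(t)=\emptyset$ whenever $|c_k|\ne|c_{k'}|$, and also whenever $k\ne k'$ and $b\notin\frac{\pi}{2N}\mathbb Z$. (4) For all sufficiently large $t$, all $n\in\{1,\dots,2p\}$ and all $k\in\{1,\dots,N\}$: if $c_k\ne0$, the spectrum of $H^b(t)$ on $\sigma_{k,\tilde n}(t)$ has uniform multiplicity $2\cdot\#\{k'\in\{1,\dots,N\}:|c_{k'}|=|c_k|\}$, which is $2$ when $b\notin\frac\pi{2N}\mathbb Z$. If $c_k=0$, then $\sigma_{k,\tilde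 n}(t)$ is a flat band: it is a single point, and this point is an eigenvalue of infinite multiplicity of $J_k^b(t)$ and of $H^b(t)$. -/

import Mathlib

open MeasureTheory Filter Asymptotics Set

namespace Nanotube

noncomputable section

/-- The Hilbert space `ℓ²(ι)` of square-summable complex functions. -/
abbrev Ell2 (ι : Type) : Type := lp (fun _ : ι => ℂ) 2

/-- Real bounded two-sided sequences `ℓ^∞(ℤ)`. -/
abbrev EllInfty : Type := lp (fun _ : ℤ => ℝ) ⊤

/-! ### Weighted composition operators on `ℓ²` -/

theorem summable_weighted {ι : Type} (w : ι → ℂ) (C : ℝ) (hw : ∀ i, ‖w i‖ ≤ C) (s : ι ≃ ι)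
    (f : Ell2 ι) :
    Summable (fun i => ‖w i * f (s i)‖ ^ 2) ∧
      ∑' i, ‖w i * f (s i)‖ ^ 2 ≤ C ^ 2 * ‖f‖ ^ 2 := by
  have hf : HasSum (fun i => ‖f i‖ ^ 2) (‖f‖ ^ 2) := by
    have h := lp.hasSum_norm (p := 2) (by norm_num) f
    simpa using h
  have hfs : HasSum (fun i => ‖f (s i)‖ ^ 2) (‖f‖ ^ 2) := (Equiv.hasSum_iff s).2 hf
  have hC := hfs.mul_left (C ^ 2)
  have hle : ∀ i, ‖w i * f (s i)‖ ^ 2 ≤ C ^ 2 * ‖f (s i)‖ ^ 2 := by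
    intro i
    rw [norm_mul, mul_pow]
    have := hw i
    gcongr
  have hs : Summable (fun i => ‖w i * f (s i)‖ ^ 2) :=
    Summable.of_nonneg_of_le (fun i => by positivity) hle hC.summable
  exact ⟨hs, hC.tsum_eq ▸ hs.tsum_le_tsum hle hC.summable⟩

/-- The bounded operator `(T f)_i = w_i f_{s(i)}` on `ℓ²(ι)`, for a bounded weight `w` and a
permutation `s` of the index set. -/
def weighted {ι : Type} (w : ι → ℂ) (s : ι ≃ ι) (hw : ∃ C : ℝ, ∀ i, ‖w i‖ ≤ C) :
    Ell2 ι →L[ℂ] Ell2 ι :=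
  LinearMap.mkContinuousOfExistsBound
    { toFun := fun f => ⟨fun i => w i * f (s i), by
        obtain ⟨C, hC⟩ := hw
        exact memℓp_gen (by simpa using (summable_weighted w C hC s f).1)⟩
      map_add' := fun f g => by
        ext i
        exact mul_add _ _ _
      map_smul' := fun c f => by
        ext i
        exact mul_left_comm _ _ _ }
    (by
      obtain ⟨C, hC⟩ := hw
      refine ⟨|C|, fun f => ?_⟩
      refine lp.norm_le_of_tsum_le (p := 2) (by norm_num) (by positivity) ?_
      have h := (summable_weighted w C hC s f).2
      have : (|C| * ‖f‖) ^ 2 = C ^ 2 * ‖f‖ ^ 2 := by rw [mul_pow, sq_abs]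
      simpa [this] using h)

theorem weighted_apply {ι : Type} (w : ι → ℂ) (s : ι ≃ ι) (hw : ∃ C : ℝ, ∀ i, ‖w i‖ ≤ C)
    (f : Ell2 ι) (i : ι) : weighted w s hw f i = w i * f (s i) := rfl

/-! ### The Hamiltonian of the zigzag nanotube -/

/-- The vertices `(n, j, k) ∈ ℤ × {0,1} × ℤ/N` of the zigzag nanotube. -/
abbrev Vertex (N : ℕ) : Type := ℤ × Fin 2 × ZMod N

/-- The involution exchanging the end points of the edges
`(n, 0, k) ~ (n - d, 1, k - e)` of one of the three families of edges. -/
def edgeFlip (N : ℕ) (d : ℤ) (e : ZMod N) : Vertex N ≃ Vertex N where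
  toFun := fun ω => match ω with
    | (n, 0, k) => (n - d, 1, k - e)
    | (n, 1, k) => (n + d, 0, k + e)
  invFun := fun ω => match ω with
    | (n, 0, k) => (n - d, 1, k - e)
    | (n, 1, k) => (n + d, 0, k + e)
  left_inv := by
    rintro ⟨n, j, k⟩
    fin_cases j <;> simp
  right_inv := by
    rintro ⟨n, j, k⟩
    fin_cases j <;> simp

/-- The Peierls factor: `e^{iβ}` at the vertices with `j = 0`, `e^{-iβ}` at those with `j = 1`. -/
def phase (N : ℕ) (β : ℝ) (ω : Vertex N) : ℂ :=
  if ω.2.1 = 0 then Complex.exp (Complex.I * β) else Complex.exp (-(Complex.I * β))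

theorem phase_bdd (N : ℕ) (β : ℝ) : ∃ C : ℝ, ∀ ω, ‖phase N β ω‖ ≤ C := by
  refine ⟨1, fun ω => ?_⟩
  unfold phase
  split_ifs
  · rw [mul_comm, Complex.norm_exp_ofReal_mul_I]
  · rw [← mul_neg, mul_comm, ← Complex.ofReal_neg, Complex.norm_exp_ofReal_mul_I]

/-- The axial electric potential `V_{n,0,k} = v_{2n+1}`, `V_{n,1,k} = v_{2n+2}`. -/
def potential (N : ℕ) (v : ℤ → ℝ) (ω : Vertex N) : ℝ :=
  if ω.2.1 = 0 then v (2 * ω.1 + 1) else v (2 * ω.1 + 2)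

theorem potential_bdd (N : ℕ) (v : EllInfty) (t : ℝ) :
    ∃ C : ℝ, ∀ ω, ‖((t * potential N v ω : ℝ) : ℂ)‖ ≤ C := by
  refine ⟨|t| * ‖v‖, fun ω => ?_⟩
  rw [Complex.norm_real, norm_mul, Real.norm_eq_abs t]
  gcongr
  unfold potential
  split_ifs
  · exact lp.norm_apply_le_norm ENNReal.top_ne_zero v _
  · exact lp.norm_apply_le_norm ENNReal.top_ne_zero v _

/-- The tight-binding Hamiltonian `H^b(t) = H_0^b + t V` on `ℓ²(ℤ × {0,1} × ℤ/N)`.  Its pointwise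
form is spelled out in the two theorems that follow. -/
def hamiltonian (N : ℕ) (b : ℝ) (v : EllInfty) (t : ℝ) : Ell2 (Vertex N) →L[ℂ] Ell2 (Vertex N) :=
  weighted (phase N (-b)) (edgeFlip N 1 0) (phase_bdd N (-b)) +
    weighted (phase N b) (edgeFlip N 1 1) (phase_bdd N b) +
    weighted (phase N 0) (edgeFlip N 0 0) (phase_bdd N 0) +
    weighted (fun ω => ((t * potential N v ω : ℝ) : ℂ)) (Equiv.refl _) (potential_bdd N v t)

theorem hamiltonian_apply_zero (N : ℕ) (b : ℝ) (v : EllInfty) (t : ℝ) (f : Ell2 (Vertex N))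
    (n : ℤ) (k : ZMod N) :
    hamiltonian N b v t f (n, 0, k) =
      Complex.exp (-(Complex.I * b)) * f (n - 1, 1, k) +
        Complex.exp (Complex.I * b) * f (n - 1, 1, k - 1) + f (n, 1, k) +
        ((t * v (2 * n + 1) : ℝ) : ℂ) * f (n, 0, k) := by
  have h : hamiltonian N b v t f (n, 0, k) =
      phase N (-b) (n, 0, k) * f (n - 1, 1, k - 0) + phase N b (n, 0, k) * f (n - 1, 1, k - 1) +
        phase N 0 (n, 0, k) * f (n - 0, 1, k - 0) +
        ((t * potential N v (n, 0, k) : ℝ) : ℂ) * f (n, 0, k) := rfl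
  rw [h]
  simp [phase, potential]

theorem hamiltonian_apply_one (N : ℕ) (b : ℝ) (v : EllInfty) (t : ℝ) (f : Ell2 (Vertex N))
    (n : ℤ) (k : ZMod N) :
    hamiltonian N b v t f (n, 1, k) =
      Complex.exp (-(Complex.I * b)) * f (n + 1, 0, k + 1) +
        Complex.exp (Complex.I * b) * f (n + 1, 0, k) + f (n, 0, k) +
        ((t * v (2 * n + 2) : ℝ) : ℂ) * f (n, 1, k) := by
  have h : hamiltonian N b v t f (n, 1, k) =
      phase N (-b) (n, 1, k) * f (n + 1, 0, k + 0) + phase N b (n, 1, k) * f (n + 1, 0, k + 1) +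
        phase N 0 (n, 1, k) * f (n + 0, 0, k + 0) +
        ((t * potential N v (n, 1, k) : ℝ) : ℂ) * f (n, 1, k) := rfl
  rw [h]
  simp [phase, potential]
  ring

/-! ### The Jacobi operators and their spectral bands -/

/-- `c_k = cos (b + π k / N)`. -/
def cCoef (N : ℕ) (b : ℝ) (k : ℕ) : ℝ := Real.cos (b + Real.pi * k / N)

/-- The off-diagonal coefficients `a_{k,2n} = 2 |c_k|`, `a_{k,2n+1} = 1`. -/
def aCoef (N : ℕ) (b : ℝ) (k : ℕ) (n : ℤ) : ℝ := if Even n then 2 * |cCoef N b k| else 1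

theorem aCoef_bdd (N : ℕ) (b : ℝ) (k : ℕ) (d : ℤ) :
    ∃ C : ℝ, ∀ n : ℤ, ‖((aCoef N b k (n - d) : ℝ) : ℂ)‖ ≤ C := by
  refine ⟨2, fun n => ?_⟩
  rw [Complex.norm_real, Real.norm_eq_abs]
  unfold aCoef
  split_ifs
  · rw [abs_mul, abs_abs, abs_two]
    have := Real.abs_cos_le_one (b + Real.pi * k / N)
    unfold cCoef
    linarith
  · norm_num

theorem mulPot_bdd (v : EllInfty) (t : ℝ) : ∃ C : ℝ, ∀ n : ℤ, ‖((t * v n : ℝ) : ℂ)‖ ≤ C := by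
  refine ⟨|t| * ‖v‖, fun n => ?_⟩
  rw [Complex.norm_real, norm_mul, Real.norm_eq_abs t]
  gcongr
  exact lp.norm_apply_le_norm ENNReal.top_ne_zero v _

/-- The Jacobi operator `J_k^b(t)` on `ℓ²(ℤ)`,
`(J y)_n = a_{n-1} y_{n-1} + a_n y_{n+1} + t v_n y_n`. -/
def jacobi (N : ℕ) (b : ℝ) (v : EllInfty) (t : ℝ) (k : ℕ) : Ell2 ℤ →L[ℂ] Ell2 ℤ :=
  weighted (fun n => ((aCoef N b k (n - 1) : ℝ) : ℂ)) (Equiv.subRight 1) (aCoef_bdd N b k 1) +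
    weighted (fun n => ((aCoef N b k (n - 0) : ℝ) : ℂ)) (Equiv.addRight 1) (aCoef_bdd N b k 0) +
    weighted (fun n => ((t * v n : ℝ) : ℂ)) (Equiv.refl _) (mulPot_bdd v t)

theorem jacobi_apply (N : ℕ) (b : ℝ) (v : EllInfty) (t : ℝ) (k : ℕ) (y : Ell2 ℤ) (n : ℤ) :
    jacobi N b v t k y n =
      (aCoef N b k (n - 1) : ℂ) * y (n - 1) + (aCoef N b k n : ℂ) * y (n + 1) +
        ((t * v n : ℝ) : ℂ) * y n := by
  have h : jacobi N b v t k y n =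
      (aCoef N b k (n - 1) : ℂ) * y (n - 1) + (aCoef N b k (n - 0) : ℂ) * y (n + 1) +
        ((t * v n : ℝ) : ℂ) * y n := rfl
  rw [h, sub_zero]

/-- The `m × m` matrix of `a_{n-1} y_{n-1} + a_n y_{n+1} + u_n y_n`, `n = 1, …, m`, acting on
sequences with `y_{n+m} = τ y_n` (the row and column `i : Fin m` stand for the site `i + 1`). -/
def floquetMatrix (m : ℕ) (a u : ℤ → ℝ) (τ : ℝ) : Matrix (Fin m) (Fin m) ℝ := fun i j =>
  (if i = j then u ((i : ℕ) + 1) else 0) +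
    (if (j : ℕ) = i + 1 then a ((i : ℕ) + 1) else 0) +
    (if (i : ℕ) = j + 1 then a (i : ℕ) else 0) +
    (if (i : ℕ) = 0 ∧ (j : ℕ) + 1 = m then τ⁻¹ * a 0 else 0) +
    (if (i : ℕ) + 1 = m ∧ (j : ℕ) = 0 then τ * a m else 0)

/-- The `2p`-periodic and `2p`-antiperiodic (together: `4p`-periodic) eigenvalues of
`a_{n-1} y_{n-1} + a_n y_{n+1} + t v_n y_n = z y_n`, with multiplicities, in increasing order:
`z_0^+ ≤ z_1^- ≤ z_1^+ ≤ z_2^- ≤ … ≤ z_{2p}^-`. -/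
def bandEdges (N p : ℕ) (b : ℝ) (v : ℤ → ℝ) (t : ℝ) (k : ℕ) : List ℝ :=
  ((floquetMatrix (2 * p) (aCoef N b k) (fun n => t * v n) 1).charpoly.roots +
    (floquetMatrix (2 * p) (aCoef N b k) (fun n => t * v n) (-1)).charpoly.roots).sort (· ≤ ·)

/-- The left end point `z_{m}^+` of the band number `m + 1`, `m = 0, …, 2p - 1`. -/
def bandLeft (N p : ℕ) (b : ℝ) (v : ℤ → ℝ) (t : ℝ) (k m : ℕ) : ℝ :=
  (bandEdges N p b v t k).getD (2 * m) 0

/-- The right end point `z_{m+1}^-` of the band number `m + 1`, `m = 0, …, 2p - 1`. -/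
def bandRight (N p : ℕ) (b : ℝ) (v : ℤ → ℝ) (t : ℝ) (k m : ℕ) : ℝ :=
  (bandEdges N p b v t k).getD (2 * m + 1) 0

/-- The band number `m + 1` of `J_k^b(t)`, `m = 0, …, 2p - 1`. -/
def band (N p : ℕ) (b : ℝ) (v : ℤ → ℝ) (t : ℝ) (k m : ℕ) : Set ℝ :=
  Icc (bandLeft N p b v t k m) (bandRight N p b v t k m)

/-! ### The constants and the clusters -/

/-- `C_{k,n} = a_{k,n-1}² / (v_{n-1} - v_n) + a_{k,n}² / (v_{n+1} - v_n)`. -/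
def shiftC (N : ℕ) (b : ℝ) (v : ℤ → ℝ) (k : ℕ) (n : ℤ) : ℝ :=
  aCoef N b k (n - 1) ^ 2 / (v (n - 1) - v n) + aCoef N b k n ^ 2 / (v (n + 1) - v n)

/-- `E_{k,n} = (4 |2 c_k|^p)⁻¹ ∏_{j ≠ n} |v_n - v_j|`, where `n, j` run over the sites
`1, …, 2p` (`i : Fin (2 * p)` stands for the site `i + 1`). -/
def widthE (N p : ℕ) (b : ℝ) (v : ℤ → ℝ) (k : ℕ) (n : Fin (2 * p)) : ℝ :=
  (1 / (4 * |2 * cCoef N b k| ^ p)) *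
    ∏ j ∈ Finset.univ.erase n, |v ((n : ℕ) + 1) - v ((j : ℕ) + 1)|

/-- The interval `[t h⁰_m, t h⁰_{m+1})`, where `h_1 < … < h_{2p}` are the values `v_1, …, v_{2p}`
in increasing order (`h_{i+1} = v_{α(i)+1}`), `h⁰_j = (h_j + h_{j+1}) / 2` for `0 < j < 2p`,
`h⁰_0 = -∞` and `h⁰_{2p} = ∞`. -/
def clusterInterval (p : ℕ) (v : ℤ → ℝ) (α : Equiv.Perm (Fin (2 * p))) (t : ℝ)
    (m : Fin (2 * p)) : Set ℝ :=
  {x | (∀ i : Fin (2 * p), (i : ℕ) + 1 = m →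
          t * ((v ((α i : ℕ) + 1) + v ((α m : ℕ) + 1)) / 2) ≤ x) ∧
       (∀ i : Fin (2 * p), (i : ℕ) = m + 1 →
          x < t * ((v ((α m : ℕ) + 1) + v ((α i : ℕ) + 1)) / 2))}

/-! ### Spectrum, spectral multiplicity, flat bands -/

section Spectral

variable {E : Type} [NormedAddCommGroup E] [InnerProductSpace ℂ E]

/-- The real points of the spectrum (all of the spectrum, when `T` is self-adjoint). -/
def realSpectrum (T : E →L[ℂ] E) : Set ℝ := {x | (x : ℂ) ∈ spectrum ℂ T}

/-- `μ` is the spectral measure of the vector `u` for the bounded self-adjoint operator `T`: the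
compactly supported finite measure with moments `⟨u, Tⁿ u⟩`. -/
def IsSpectralMeasure (T : E →L[ℂ] E) (u : E) (μ : Measure ℝ) : Prop :=
  IsFiniteMeasure μ ∧ (∃ R : ℝ, μ (Icc (-R) R)ᶜ = 0) ∧
    ∀ n : ℕ, inner ℂ u ((T ^ n) u) = ((∫ x, x ^ n ∂μ : ℝ) : ℂ)

/-- The range of the spectral projection of the bounded self-adjoint operator `T` on the Borel
set `S`: the vectors whose spectral measure is carried by `S`. -/
def spectralSubspace (T : E →L[ℂ] E) (S : Set ℝ) : Set E :=
  {u | ∃ μ : Measure ℝ, IsSpectralMeasure T u μ ∧ μ Sᶜ = 0}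

/-- The spectrum of the bounded self-adjoint operator `T` on the Borel set `S` has (uniform)
multiplicity `m`: the part of `T` in the spectral subspace of `S` is unitarily equivalent to
multiplication by `x` in `L²(μ; ℂ^m)` for a nonzero finite measure `μ` carried by `S`. -/
def HasSpectralMultiplicity (T : E →L[ℂ] E) (S : Set ℝ) (m : ℕ) : Prop :=
  ∃ μ : Measure ℝ, IsFiniteMeasure μ ∧ μ ≠ 0 ∧ μ Sᶜ = 0 ∧
    ∃ U : Lp (EuclideanSpace ℂ (Fin m)) 2 μ →ₗᵢ[ℂ] E,
      range U = spectralSubspace T S ∧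
      ∀ f g : Lp (EuclideanSpace ℂ (Fin m)) 2 μ,
        (∀ᵐ x ∂μ, g x = (x : ℂ) • f x) → T (U f) = U g

/-- `S` is a flat band of `T`: a single point that is an eigenvalue of infinite multiplicity. -/
def IsFlatBand (T : E →L[ℂ] E) (S : Set ℝ) : Prop :=
  ∃ x : ℝ, S = {x} ∧
    ¬ FiniteDimensional ℂ (Module.End.eigenspace (T : E →ₗ[ℂ] E) (x : ℂ))

end Spectral

end

end Nanotube

/-!
The Fourier transform in the angular variable splits `H` into the Jacobi operators `J_k`, and the
Floquet–Bloch transform reduces `J_k` to `2p × 2p` matrices indexed by a quasi-momentum `θ`. Their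
characteristic polynomial depends on `θ` only through `cos θ`, and affinely:
`χ_θ(z) = χ_0(z) + 2 P (1 - cos θ)`, where `P = ∏ a_{k,n} = |2 c_k| ^ p`. For large `t` Gershgorin's
theorem puts exactly one eigenvalue `λ_n` into a window around each `t v_n`, so the bands are the
ranges of the `λ_n` as functions of `cos θ`, with their edges at `cos θ = ±1`.

Factoring `χ_0` at a root of `χ_π` gives `|λ_n(π) - λ_n(0)| ∏_{j ≠ n} |λ_n(π) - λ_j(0)| = 4 P`,
hence the band width. The shift `-C_{k,n} / t` is read off an eigenvector dominated by its `n`-th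
entry, and bands of channels with `|c_k| ≠ |c_k'|` are disjoint because these shifts differ.

If `P ≠ 0` then `cos θ` is a function of `λ_n(θ)`. Thus the even functions of `θ` are the functions
of `λ_n`, and the odd ones are these times the sign of `sin θ`: every channel contributes
multiplicity two. If `P = 0` then `λ_n` is constant and the band is flat.
-/

namespace Nanotube

noncomputable section

/-! ### Orthogonal sums of multiplication operators -/

section Complexify

variable {X : Type*} [TopologicalSpace X]

/-- A real continuous function, regarded as a complex one. -/
def complexify : C(X, ℝ) →+* C(X, ℂ) :=
  (Complex.ofRealAm.compLeftContinuous ℝ Complex.continuous_ofReal).toRingHom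

@[simp] theorem complexify_apply (l : C(X, ℝ)) (x : X) : complexify l x = (l x : ℂ) := rfl

end Complexify

section Multiplication

variable {X : Type*} [TopologicalSpace X] [CompactSpace X] [MeasurableSpace X] [BorelSpace X]
  {μ : Measure X} [IsFiniteMeasure μ]

theorem coeFn_holderL_toLp (w : C(X, ℂ)) (f : Lp ℂ 2 μ) :
    (ContinuousLinearMap.mul ℂ ℂ).holderL μ ⊤ 2 2 (ContinuousMap.toLp ⊤ μ ℂ w) f
      =ᵐ[μ] fun x => w x * f x := by
  filter_upwards
    [(ContinuousLinearMap.mul ℂ ℂ).coeFn_holder (r := 2) (ContinuousMap.toLp ⊤ μ ℂ w) f,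
    ContinuousMap.coeFn_toLp (p := ⊤) (𝕜 := ℂ) μ w] with x hx hw
  rw [← hw]
  exact hx

/-- The representation of `C(X, ℂ)` on `L²(μ)` by multiplication operators. -/
def mulLp (μ : Measure X) [IsFiniteMeasure μ] : C(X, ℂ) →ₐ[ℂ] Lp ℂ 2 μ →L[ℂ] Lp ℂ 2 μ :=
  AlgHom.ofLinearMap
    (((ContinuousLinearMap.mul ℂ ℂ).holderL μ ⊤ 2 2).toLinearMap ∘ₗ
      (ContinuousMap.toLp ⊤ μ ℂ).toLinearMap)
    (by
      ext1 f
      refine Lp.ext ?_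
      filter_upwards [coeFn_holderL_toLp 1 f] with x hx
      exact hx.trans (one_mul _))
    (fun w z => by
      ext1 f
      refine Lp.ext ?_
      filter_upwards [coeFn_holderL_toLp (w * z) f, coeFn_holderL_toLp z f,
        coeFn_holderL_toLp w ((ContinuousLinearMap.mul ℂ ℂ).holderL μ ⊤ 2 2
          (ContinuousMap.toLp ⊤ μ ℂ z) f)] with x hwz hz hw
      exact hwz.trans (((mul_assoc _ _ _).trans (congrArg (w x * ·) hz.symm)).trans hw.symm))

theorem coeFn_mulLp (w : C(X, ℂ)) (f : Lp ℂ 2 μ) : mulLp μ w f =ᵐ[μ] fun x => w x * f x :=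
  coeFn_holderL_toLp w f

theorem inner_mulLp (w : C(X, ℂ)) (f g : Lp ℂ 2 μ) :
    inner ℂ f (mulLp μ w g) = ∫ x, w x * inner ℂ (f x) (g x) ∂μ := by
  rw [L2.inner_def]
  refine integral_congr_ae ?_
  filter_upwards [coeFn_mulLp w g] with x hx
  rw [hx, ← smul_eq_mul, inner_smul_right]

end Multiplication

section L2

variable {X : Type*} [MeasurableSpace X] {μ : Measure X}

theorem integrable_norm_sq (f : Lp ℂ 2 μ) : Integrable (fun x => ‖f x‖ ^ 2) μ :=
  (memLp_two_iff_integrable_sq_norm (Lp.aestronglyMeasurable f)).1 (Lp.memLp f)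

end L2

section Model

variable {X : Type*} [TopologicalSpace X] [CompactSpace X] [MeasurableSpace X] [BorelSpace X]
  {E : Type} [NormedAddCommGroup E] [InnerProductSpace ℂ E]

theorem not_isUnit_of_forall_exists_norm_le {T : E →L[ℂ] E}
    (h : ∀ ε : ℝ, 0 < ε → ∃ u : E, u ≠ 0 ∧ ‖T u‖ ≤ ε * ‖u‖) : ¬ IsUnit T := by
  rintro ⟨R, rfl⟩
  set S : E →L[ℂ] E := ↑R⁻¹
  obtain ⟨u, hu, hle⟩ := h (1 / (‖S‖ + 1)) (by positivity)
  have hSu : S ((R : E →L[ℂ] E) u) = u := congrArg (fun A : E →L[ℂ] E => A u) R.inv_mul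
  have hlt : ‖S‖ * (1 / (‖S‖ + 1)) < 1 := by
    rw [mul_one_div, div_lt_one (by positivity)]
    exact lt_add_one _
  refine lt_irrefl ‖u‖ ?_
  calc ‖u‖ = ‖S ((R : E →L[ℂ] E) u)‖ := by rw [hSu]
    _ ≤ ‖S‖ * ‖(R : E →L[ℂ] E) u‖ := S.le_opNorm _
    _ ≤ ‖S‖ * (1 / (‖S‖ + 1) * ‖u‖) := by gcongr
    _ = ‖S‖ * (1 / (‖S‖ + 1)) * ‖u‖ := (mul_assoc _ _ _).symm
    _ < ‖u‖ := mul_lt_of_lt_one_left (norm_pos_iff.2 hu) hlt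

theorem mem_realSpectrum_iff {T : E →L[ℂ] E} {x : ℝ} :
    x ∈ realSpectrum T ↔ ¬ IsUnit (T - algebraMap ℂ (E →L[ℂ] E) x) := by
  rw [← neg_sub, IsUnit.neg_iff]
  rfl

theorem exists_norm_mulLp_le {μ : Measure X} [IsFiniteMeasure μ] [μ.IsOpenPosMeasure]
    (w : C(X, ℂ)) {x₀ : X} (hw : w x₀ = 0) {ε : ℝ} (hε : 0 < ε) :
    ∃ f : Lp ℂ 2 μ, f ≠ 0 ∧ ‖mulLp μ w f‖ ≤ ε * ‖f‖ := by
  set O : Set X := {x | ‖w x‖ < ε}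
  have hO : IsOpen O := isOpen_lt (by fun_prop) continuous_const
  have hpos : 0 < μ.real O :=
    ENNReal.toReal_pos (hO.measure_pos μ ⟨x₀, by simpa [O, hw] using hε⟩).ne' (measure_ne_top _ _)
  refine ⟨indicatorConstLp 2 hO.measurableSet (measure_ne_top _ _) 1, ?_, ?_⟩
  · rw [← norm_pos_iff, norm_indicatorConstLp (by norm_num) (by norm_num)]
    exact mul_pos (by norm_num) (Real.rpow_pos_of_pos hpos _)
  · refine Lp.norm_le_mul_norm_of_ae_le_mul ?_
    filter_upwards [coeFn_mulLp w (indicatorConstLp 2 hO.measurableSet (measure_ne_top μ O) 1),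
      indicatorConstLp_coeFn (p := 2) (hs := hO.measurableSet) (hμs := measure_ne_top μ O)
        (c := (1 : ℂ))] with x h1 h2
    rw [h1, h2, norm_mul]
    by_cases hx : x ∈ O
    · have : ‖w x‖ < ε := hx
      gcongr
    · simp [hx]

/-- A diagonalization of `T`: the whole space is an orthogonal sum of copies of `L²(μ)`, on each
of which `T` acts as multiplication by a real continuous function. It is the common target of the
Floquet transform of the Jacobi operators and of the angular Fourier transform of the tube. -/
structure DiagModel (T : E →L[ℂ] E) (μ : Measure X) [IsFiniteMeasure μ] (I : Type*)
    [Fintype I] where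
  /-- The function by which `T` acts on each summand. -/
  symbol : I → C(X, ℝ)
  /-- The embedding of each summand. -/
  embed : I → Lp ℂ 2 μ →ₗᵢ[ℂ] E
  orthogonal : OrthogonalFamily ℂ (fun _ => Lp ℂ 2 μ) embed
  intertwine : ∀ i f, T (embed i f) = embed i (mulLp μ (complexify (symbol i)) f)
  complete : ∀ u, ∃ f : I → Lp ℂ 2 μ, u = ∑ i, embed i (f i)

namespace DiagModel

variable {T : E →L[ℂ] E} {μ : Measure X} [IsFiniteMeasure μ] {I : Type*}
  [Fintype I] (D : DiagModel T μ I)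
include D

theorem sum_eq_zero_iff (f : I → Lp ℂ 2 μ) : ∑ i, D.embed i (f i) = 0 ↔ ∀ i, f i = 0 := by
  rw [← sq_eq_zero_iff.trans norm_eq_zero, D.orthogonal.norm_sum,
    Finset.sum_eq_zero_iff_of_nonneg fun _ _ => by positivity]
  simp

theorem pow_apply (n : ℕ) (i : I) (f : Lp ℂ 2 μ) :
    (T ^ n) (D.embed i f) = D.embed i (mulLp μ (complexify (D.symbol i ^ n)) f) := by
  induction n with
  | zero => rw [pow_zero, pow_zero, map_one, map_one, one_apply_eq_self, one_apply_eq_self]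
  | succ n ih =>
    rw [pow_succ', mul_apply_eq_comp, ih, D.intertwine, pow_succ', map_mul, map_mul,
      mul_apply_eq_comp]

theorem sub_algebraMap_apply (x : ℝ) (i : I) (f : Lp ℂ 2 μ) :
    (T - algebraMap ℂ (E →L[ℂ] E) x) (D.embed i f) =
      D.embed i (mulLp μ (complexify (D.symbol i - .const X x)) f) := by
  have hconst : complexify (.const X x) = algebraMap ℂ C(X, ℂ) x := rfl
  rw [sub_apply, D.intertwine, map_sub, map_sub, hconst, AlgHomClass.commutes, sub_apply, map_sub]
  simp only [Algebra.algebraMap_eq_smul_one, smul_apply, one_apply_eq_self, map_smul]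

theorem sub_algebraMap_sum (x : ℝ) (f : I → Lp ℂ 2 μ) :
    (T - algebraMap ℂ (E →L[ℂ] E) x) (∑ i, D.embed i (f i)) =
      ∑ i, D.embed i (mulLp μ (complexify (D.symbol i - .const X x)) (f i)) := by
  rw [map_sum]
  exact Finset.sum_congr rfl fun i _ => D.sub_algebraMap_apply x i (f i)

theorem symbol_mem_realSpectrum [μ.IsOpenPosMeasure] (i : I) (x₀ : X) :
    D.symbol i x₀ ∈ realSpectrum T := by
  rw [mem_realSpectrum_iff]
  refine not_isUnit_of_forall_exists_norm_le fun ε hε => ?_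
  obtain ⟨f, hf, hle⟩ := exists_norm_mulLp_le (μ := μ)
    (complexify (D.symbol i - .const X (D.symbol i x₀))) (x₀ := x₀) (by simp) hε
  refine ⟨D.embed i f, (map_ne_zero_iff _ (D.embed i).injective).2 hf, ?_⟩
  rwa [D.sub_algebraMap_apply, LinearIsometry.norm_map, LinearIsometry.norm_map]

theorem exists_symbol_eq_of_mem_realSpectrum [CompleteSpace E] {x : ℝ} (hx : x ∈ realSpectrum T) :
    ∃ i x₀, D.symbol i x₀ = x := by
  by_contra! hne
  have hunit : ∀ i, IsUnit (mulLp μ (complexify (D.symbol i - .const X x))) := fun i =>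
    (ContinuousMap.isUnit_iff_forall_ne_zero _ |>.2 fun y => by
      simpa [sub_eq_zero] using fun h => hne i y (Complex.ofReal_injective h)).map _
  have hbij := fun i => ContinuousLinearMap.isUnit_iff_bijective.1 (hunit i)
  refine mem_realSpectrum_iff.1 hx (ContinuousLinearMap.isUnit_iff_bijective.2 ⟨?_, fun u => ?_⟩)
  · rw [injective_iff_map_eq_zero]
    intro u hu
    obtain ⟨f, rfl⟩ := D.complete u
    rw [D.sub_algebraMap_sum, D.sum_eq_zero_iff] at hu
    exact (D.sum_eq_zero_iff f).2 fun i => (map_eq_zero_iff _ (hbij i).1).1 (hu i)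
  · obtain ⟨f, rfl⟩ := D.complete u
    choose g hg using fun i => (hbij i).2 (f i)
    exact ⟨∑ i, D.embed i (g i), by simp only [D.sub_algebraMap_sum, hg]⟩

theorem realSpectrum_eq [CompleteSpace E] [μ.IsOpenPosMeasure] :
    realSpectrum T = ⋃ i, range (D.symbol i) := by
  ext x
  rw [mem_iUnion]
  refine ⟨D.exists_symbol_eq_of_mem_realSpectrum, ?_⟩
  rintro ⟨i, y, rfl⟩
  exact D.symbol_mem_realSpectrum i y

theorem not_finiteDimensional_eigenspace (hμ : ¬ FiniteDimensional ℂ (Lp ℂ 2 μ)) {i : I} {x : ℝ}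
    (h : ∀ y, D.symbol i y = x) :
    ¬ FiniteDimensional ℂ (Module.End.eigenspace (T : E →ₗ[ℂ] E) (x : ℂ)) := by
  intro hfin
  have hmem : ∀ f, D.embed i f ∈ Module.End.eigenspace (T : E →ₗ[ℂ] E) (x : ℂ) := by
    intro f
    have hzero : D.symbol i - .const X x = 0 := ContinuousMap.ext fun y => sub_eq_zero.2 (h y)
    have hf := D.sub_algebraMap_apply x i f
    rw [hzero, map_zero, map_zero, zero_apply, map_zero, sub_apply, sub_eq_zero] at hf
    rw [Module.End.mem_eigenspace_iff]
    exact hf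
  exact hμ (FiniteDimensional.of_injective ((D.embed i).toLinearMap.codRestrict _ hmem)
    fun f g hfg => (D.embed i).injective (congrArg Subtype.val hfg))

end DiagModel

end Model

/-! ### Spectral measures and multiplicity -/

section Moments

theorem integrable_continuous_of_measure_compl_Icc_eq_zero {μ : Measure ℝ} [IsFiniteMeasure μ]
    {a b : ℝ} (hμ : μ (Icc a b)ᶜ = 0) {f : ℝ → ℝ} (hf : Continuous f) : Integrable f μ := by
  have hint : IntegrableOn f (Icc a b) μ := hf.continuousOn.integrableOn_compact isCompact_Icc
  have hae : ∀ᵐ x ∂μ, x ∈ Icc a b := hμ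
  rwa [IntegrableOn, Measure.restrict_eq_self_of_ae_mem hae] at hint

theorem abs_integral_sub_integral_le {μ : Measure ℝ} [IsFiniteMeasure μ] {a b : ℝ}
    (hμ : μ (Icc a b)ᶜ = 0) {f g : ℝ → ℝ} (hf : Continuous f) (hg : Continuous g) {ε : ℝ}
    (h : ∀ x ∈ Icc a b, |f x - g x| ≤ ε) :
    |∫ x, f x ∂μ - ∫ x, g x ∂μ| ≤ ε * μ.real univ := by
  rw [← integral_sub (integrable_continuous_of_measure_compl_Icc_eq_zero hμ hf)
    (integrable_continuous_of_measure_compl_Icc_eq_zero hμ hg), ← Real.norm_eq_abs]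
  refine norm_integral_le_of_norm_le_const (μ := μ) ?_
  filter_upwards [(hμ : ∀ᵐ x ∂μ, x ∈ Icc a b)] with x hx using h x hx

variable {μ ν : Measure ℝ} [IsFiniteMeasure μ] [IsFiniteMeasure ν] {a b : ℝ}

theorem integral_polynomial_eq_of_forall_integral_pow_eq (hμ : μ (Icc a b)ᶜ = 0)
    (hν : ν (Icc a b)ᶜ = 0) (h : ∀ n : ℕ, ∫ x, x ^ n ∂μ = ∫ x, x ^ n ∂ν) (q : Polynomial ℝ) :
    ∫ x, q.eval x ∂μ = ∫ x, q.eval x ∂ν := by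
  induction q using Polynomial.induction_on' with
  | add q r hq hr =>
    simp only [Polynomial.eval_add]
    rw [integral_add, integral_add, hq, hr]
    · exact integrable_continuous_of_measure_compl_Icc_eq_zero hν q.continuous
    · exact integrable_continuous_of_measure_compl_Icc_eq_zero hν r.continuous
    · exact integrable_continuous_of_measure_compl_Icc_eq_zero hμ q.continuous
    · exact integrable_continuous_of_measure_compl_Icc_eq_zero hμ r.continuous
  | monomial n c =>
    simp only [Polynomial.eval_monomial, integral_const_mul, h n]

theorem measure_eq_of_forall_integral_pow_eq (hμ : μ (Icc a b)ᶜ = 0) (hν : ν (Icc a b)ᶜ = 0)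
    (h : ∀ n : ℕ, ∫ x, x ^ n ∂μ = ∫ x, x ^ n ∂ν) : μ = ν := by
  refine ext_of_forall_integral_eq_of_IsFiniteMeasure fun f => ?_
  refine eq_of_forall_dist_le fun ε hε => ?_
  set M := μ.real univ + ν.real univ
  have : 0 ≤ M := by positivity
  obtain ⟨q, hq⟩ := exists_polynomial_near_of_continuousOn a b f f.continuous.continuousOn
    (ε / (M + 1)) (by positivity)
  have hfq : ∀ x ∈ Icc a b, |f x - q.eval x| ≤ ε / (M + 1) := fun x hx => by
    rw [abs_sub_comm]
    exact (hq x hx).le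
  calc |∫ x, f x ∂μ - ∫ x, f x ∂ν|
      ≤ |∫ x, f x ∂μ - ∫ x, q.eval x ∂μ| + |∫ x, q.eval x ∂μ - ∫ x, f x ∂ν| :=
        abs_sub_le _ _ _
    _ ≤ ε / (M + 1) * μ.real univ + ε / (M + 1) * ν.real univ := by
        refine add_le_add (abs_integral_sub_integral_le hμ f.continuous q.continuous hfq) ?_
        rw [integral_polynomial_eq_of_forall_integral_pow_eq hμ hν h, abs_sub_comm]
        exact abs_integral_sub_integral_le hν f.continuous q.continuous hfq
    _ = ε * (M / (M + 1)) := by ring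
    _ ≤ ε := mul_le_of_le_one_right hε.le ((div_le_one (by positivity)).2 (by linarith))

theorem IsSpectralMeasure.unique {E : Type} [NormedAddCommGroup E] [InnerProductSpace ℂ E]
    {T : E →L[ℂ] E} {u : E} {μ ν : Measure ℝ} (hμ : IsSpectralMeasure T u μ)
    (hν : IsSpectralMeasure T u ν) : μ = ν := by
  obtain ⟨_, ⟨R, hR⟩, hμ⟩ := hμ
  obtain ⟨_, ⟨R', hR'⟩, hν⟩ := hν
  have hle := le_max_left R R'
  have hle' := le_max_right R R'
  refine measure_eq_of_forall_integral_pow_eq (a := -max R R') (b := max R R')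
    (measure_mono_null (compl_subset_compl.2 (Icc_subset_Icc (neg_le_neg hle) hle)) hR)
    (measure_mono_null (compl_subset_compl.2 (Icc_subset_Icc (neg_le_neg hle') hle')) hR')
    fun n => ?_
  exact_mod_cast (hμ n).symm.trans (hν n)

end Moments

section PushDensity

variable {X : Type*} [MeasurableSpace X] {μ : Measure X}

/-- The image under `l` of the measure with density `|f|²`: the spectral measure of `f` for the
operator of multiplication by `l`. -/
def pushDensity (l : X → ℝ) (f : Lp ℂ 2 μ) : Measure ℝ :=
  (μ.withDensity fun x => ‖f x‖ₑ ^ 2).map l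

theorem aemeasurable_enorm_sq (f : Lp ℂ 2 μ) : AEMeasurable (fun x => ‖f x‖ₑ ^ 2) μ :=
  (Lp.aestronglyMeasurable f).enorm.pow_const 2

instance isFiniteMeasure_pushDensity (l : X → ℝ) (f : Lp ℂ 2 μ) :
    IsFiniteMeasure (pushDensity l f) := by
  have : IsFiniteMeasure (μ.withDensity fun x => ‖f x‖ₑ ^ 2) := by
    refine isFiniteMeasure_withDensity ?_
    have hf := (integrable_norm_sq f).lintegral_lt_top.ne
    simpa only [ENNReal.ofReal_pow (norm_nonneg _), ofReal_norm] using hf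
  exact inferInstanceAs (IsFiniteMeasure (Measure.map _ _))

theorem pushDensity_compl_eq_zero_iff {l : X → ℝ} (hl : Measurable l) (f : Lp ℂ 2 μ)
    {S : Set ℝ} (hS : MeasurableSet S) :
    pushDensity l f Sᶜ = 0 ↔ ∀ᵐ x ∂μ, l x ∉ S → f x = 0 := by
  rw [pushDensity, Measure.map_apply hl hS.compl, preimage_compl, ← mem_ae_iff]
  refine (ae_withDensity_iff' (p := fun x => l x ∈ S) (aemeasurable_enorm_sq f)).trans
    (eventually_congr (Eventually.of_forall fun x => ?_))
  rw [not_imp_comm, sq_eq_zero_iff, enorm_eq_zero]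

theorem integral_pushDensity {l : X → ℝ} (hl : Measurable l) (f : Lp ℂ 2 μ) {g : ℝ → ℝ}
    (hg : Continuous g) : ∫ y, g y ∂pushDensity l f = ∫ x, g (l x) * ‖f x‖ ^ 2 ∂μ := by
  rw [pushDensity, integral_map hl.aemeasurable hg.aestronglyMeasurable,
    integral_withDensity_eq_integral_toReal_smul₀ (aemeasurable_enorm_sq f)
      (Eventually.of_forall fun x => by simp)]
  simp [mul_comm]

end PushDensity

namespace DiagModel

variable {X : Type*} [TopologicalSpace X] [CompactSpace X] [MeasurableSpace X] [BorelSpace X]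
  {E : Type} [NormedAddCommGroup E] [InnerProductSpace ℂ E] {T : E →L[ℂ] E} {μ : Measure X}
  [IsFiniteMeasure μ] {I : Type*} [Fintype I] (D : DiagModel T μ I)
include D

/-- The spectral measure of `∑ i, D.embed i (f i)`. -/
def specMeasure (f : I → Lp ℂ 2 μ) : Measure ℝ := ∑ i, pushDensity (D.symbol i) (f i)

theorem specMeasure_compl_eq_zero_iff (f : I → Lp ℂ 2 μ) {S : Set ℝ} (hS : MeasurableSet S) :
    D.specMeasure f Sᶜ = 0 ↔ ∀ i, ∀ᵐ x ∂μ, D.symbol i x ∉ S → f i x = 0 := by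
  rw [specMeasure, Measure.coe_finsetSum, Finset.sum_apply, Finset.sum_eq_zero_iff]
  simp only [Finset.mem_univ, true_imp_iff,
    pushDensity_compl_eq_zero_iff (D.symbol _).continuous.measurable _ hS]

theorem inner_pow (f : I → Lp ℂ 2 μ) (n : ℕ) :
    inner ℂ (∑ i, D.embed i (f i)) ((T ^ n) (∑ i, D.embed i (f i))) =
      ((∑ i, ∫ x, D.symbol i x ^ n * ‖f i x‖ ^ 2 ∂μ : ℝ) : ℂ) := by
  rw [map_sum]
  simp_rw [D.pow_apply]
  rw [D.orthogonal.inner_sum, Complex.ofReal_sum]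
  refine Finset.sum_congr rfl fun i _ => ?_
  rw [inner_mulLp, ← integral_complex_ofReal]
  refine integral_congr_ae (Eventually.of_forall fun x => ?_)
  simp [inner_self_eq_norm_sq_to_K]

theorem specMeasure_Icc_compl_eq_zero (f : I → Lp ℂ 2 μ) :
    D.specMeasure f (Icc (-∑ i, ‖D.symbol i‖) (∑ i, ‖D.symbol i‖))ᶜ = 0 := by
  refine (D.specMeasure_compl_eq_zero_iff f measurableSet_Icc).2 fun i =>
    Eventually.of_forall fun x hx => (hx (abs_le.1 ?_)).elim
  exact ((D.symbol i).norm_coe_le_norm x).trans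
    (Finset.single_le_sum (f := fun i => ‖D.symbol i‖) (fun _ _ => norm_nonneg _)
      (Finset.mem_univ i))

theorem isSpectralMeasure_specMeasure (f : I → Lp ℂ 2 μ) :
    IsSpectralMeasure T (∑ i, D.embed i (f i)) (D.specMeasure f) := by
  have hfin : IsFiniteMeasure (D.specMeasure f) :=
    inferInstanceAs (IsFiniteMeasure (∑ i, pushDensity (D.symbol i) (f i)))
  refine ⟨hfin, ⟨_, D.specMeasure_Icc_compl_eq_zero f⟩, fun n => ?_⟩
  have hint : Integrable (fun x => x ^ n) (D.specMeasure f) :=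
    integrable_continuous_of_measure_compl_Icc_eq_zero (D.specMeasure_Icc_compl_eq_zero f)
      (continuous_pow n)
  rw [specMeasure, integrable_finsetSum_measure] at hint
  rw [D.inner_pow, specMeasure, integral_finsetSum_measure hint]
  simp only [integral_pushDensity (D.symbol _).continuous.measurable _ (continuous_pow n)]

theorem mem_spectralSubspace_iff (f : I → Lp ℂ 2 μ) {S : Set ℝ} (hS : MeasurableSet S) :
    ∑ i, D.embed i (f i) ∈ spectralSubspace T S ↔
      ∀ i, ∀ᵐ x ∂μ, D.symbol i x ∉ S → f i x = 0 := by
  rw [← D.specMeasure_compl_eq_zero_iff f hS]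
  refine ⟨?_, fun h => ⟨_, D.isSpectralMeasure_specMeasure f, h⟩⟩
  rintro ⟨ν, hν, h⟩
  rwa [(D.isSpectralMeasure_specMeasure f).unique hν]

theorem mem_spectralSubspace_iff_of_range (f : I → Lp ℂ 2 μ) {S : Set ℝ} (hS : MeasurableSet S)
    (J : Finset I) (hin : ∀ i ∈ J, ∀ x, D.symbol i x ∈ S)
    (hout : ∀ i ∉ J, ∀ x, D.symbol i x ∉ S) :
    ∑ i, D.embed i (f i) ∈ spectralSubspace T S ↔ ∀ i ∉ J, f i = 0 := by
  rw [D.mem_spectralSubspace_iff f hS]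
  refine forall_congr' fun i => ?_
  by_cases hi : i ∈ J
  · simp [hi, hin i hi]
  · simp only [hout i hi, not_false_eq_true, true_imp_iff, hi]
    exact Lp.eq_zero_iff_ae_eq_zero.symm

end DiagModel

section Components

variable {X κ : Type*} [MeasurableSpace X] {μ : Measure X} [Fintype κ]

/-- The `j`-th component of a vector-valued `L²` function. -/
def component (j : κ) : Lp (EuclideanSpace ℂ κ) 2 μ →L[ℂ] Lp ℂ 2 μ :=
  (EuclideanSpace.proj j : EuclideanSpace ℂ κ →L[ℂ] ℂ).compLpL 2 μ

theorem coeFn_component (j : κ) (F : Lp (EuclideanSpace ℂ κ) 2 μ) :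
    component j F =ᵐ[μ] fun x => F x j :=
  (EuclideanSpace.proj j : EuclideanSpace ℂ κ →L[ℂ] ℂ).coeFn_compLpL F

theorem norm_sq_eq_sum_component (F : Lp (EuclideanSpace ℂ κ) 2 μ) :
    ‖F‖ ^ 2 = ∑ j, ‖component j F‖ ^ 2 := by
  have hinner : (inner ℂ F F : ℂ) = ∑ j, inner ℂ (component j F) (component j F) := by
    simp_rw [L2.inner_def]
    rw [← integral_finsetSum _ fun j _ => L2.integrable_inner (component j F) (component j F)]
    refine integral_congr_ae ?_
    filter_upwards [ae_all_iff.2 fun j => coeFn_component j F] with x hx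
    simp only [PiLp.inner_apply, hx]
  simp only [inner_self_eq_norm_sq_to_K] at hinner
  exact_mod_cast hinner

theorem exists_component_eq (f : κ → Lp ℂ 2 μ) :
    ∃ F : Lp (EuclideanSpace ℂ κ) 2 μ, ∀ j, component j F = f j := by
  classical
  have hmem : MemLp (fun x => (WithLp.toLp 2 fun j => f j x : EuclideanSpace ℂ κ)) 2 μ := by
    have hsum : (fun x => (WithLp.toLp 2 fun j => f j x : EuclideanSpace ℂ κ)) =
        ∑ j, fun x => f j x • EuclideanSpace.single j (1 : ℂ) := by
      funext x
      ext i
      simp [Finset.sum_apply, Pi.single_apply]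
    rw [hsum]
    refine memLp_finsetSum' _ fun j _ => ?_
    exact (ContinuousLinearMap.toSpanSingleton ℂ (EuclideanSpace.single j (1 : ℂ))).comp_memLp'
      (Lp.memLp (f j))
  refine ⟨hmem.toLp _, fun j => Lp.ext ?_⟩
  filter_upwards [coeFn_component j (hmem.toLp _), hmem.coeFn_toLp] with x hF hf
  rw [hF, hf]

variable {E : Type*} [NormedAddCommGroup E] [InnerProductSpace ℂ E]

/-- The isometry of `L²(μ; ℂ^κ)` assembled from isometries of the components with orthogonal
ranges. -/
def sumComponents (W : κ → Lp ℂ 2 μ →ₗᵢ[ℂ] E) (hW : OrthogonalFamily ℂ (fun _ => Lp ℂ 2 μ) W) :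
    Lp (EuclideanSpace ℂ κ) 2 μ →ₗᵢ[ℂ] E where
  toLinearMap := ∑ j, (W j).toLinearMap ∘ₗ (component j).toLinearMap
  norm_map' F := by
    rw [← sq_eq_sq₀ (norm_nonneg _) (norm_nonneg _), norm_sq_eq_sum_component,
      ← hW.norm_sum fun j => component j F]
    simp

theorem sumComponents_apply (W : κ → Lp ℂ 2 μ →ₗᵢ[ℂ] E)
    (hW : OrthogonalFamily ℂ (fun _ => Lp ℂ 2 μ) W) (F : Lp (EuclideanSpace ℂ κ) 2 μ) :
    sumComponents W hW F = ∑ j, W j (component j F) := by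
  change (∑ j, (W j).toLinearMap ∘ₗ (component j).toLinearMap) F = _
  simp

theorem range_sumComponents (W : κ → Lp ℂ 2 μ →ₗᵢ[ℂ] E)
    (hW : OrthogonalFamily ℂ (fun _ => Lp ℂ 2 μ) W) :
    range (sumComponents W hW) = {u | ∃ f : κ → Lp ℂ 2 μ, u = ∑ j, W j (f j)} := by
  ext u
  constructor
  · rintro ⟨F, rfl⟩
    exact ⟨fun j => component j F, sumComponents_apply W hW F⟩
  · rintro ⟨f, rfl⟩
    obtain ⟨F, hF⟩ := exists_component_eq f
    exact ⟨F, by simp only [sumComponents_apply, hF]⟩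

end Components

theorem hasSpectralMultiplicity_of_orthogonalFamily {E : Type} [NormedAddCommGroup E]
    [InnerProductSpace ℂ E] {T : E →L[ℂ] E} {S : Set ℝ} {m : ℕ} {ν : Measure ℝ}
    [IsFiniteMeasure ν] (hν : ν ≠ 0) (hνS : ν Sᶜ = 0) (W : Fin m → Lp ℂ 2 ν →ₗᵢ[ℂ] E)
    (hW : OrthogonalFamily ℂ (fun _ => Lp ℂ 2 ν) W)
    (hT : ∀ j (f g : Lp ℂ 2 ν), (∀ᵐ x ∂ν, g x = (x : ℂ) * f x) → T (W j f) = W j g)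
    (hS : spectralSubspace T S = {u | ∃ f : Fin m → Lp ℂ 2 ν, u = ∑ j, W j (f j)}) :
    HasSpectralMultiplicity T S m := by
  refine ⟨ν, inferInstance, hν, hνS, sumComponents W hW, ?_, fun F G hFG => ?_⟩
  · rw [range_sumComponents, hS]
  · rw [sumComponents_apply, sumComponents_apply, map_sum]
    refine Finset.sum_congr rfl fun j _ => hT j _ _ ?_
    filter_upwards [coeFn_component j F, coeFn_component j G, hFG] with x hF hG h
    rw [hF, hG, h, PiLp.smul_apply, smul_eq_mul]

section CyclicDecomposition

variable {X : Type*} [TopologicalSpace X] [CompactSpace X] [MeasurableSpace X] [BorelSpace X]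
  (μ : Measure X) [IsFiniteMeasure μ]

/-- A decomposition of `L²(μ)` into `κ` copies of `L²` of the law of `l`, on each of which
multiplication by `l` becomes multiplication by the independent variable: multiplication by `l`
has uniform multiplicity `#κ`. -/
structure CyclicDecomposition (l : C(X, ℝ)) (κ : Type*) [Fintype κ] where
  /-- The embedding of each copy. -/
  embed : κ → Lp ℂ 2 (μ.map l) →ₗᵢ[ℂ] Lp ℂ 2 μ
  orthogonal : OrthogonalFamily ℂ (fun _ => Lp ℂ 2 (μ.map l)) embed
  intertwine : ∀ c (f g : Lp ℂ 2 (μ.map l)), (∀ᵐ x ∂μ.map l, g x = (x : ℂ) * f x) →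
    mulLp μ (complexify l) (embed c f) = embed c g
  complete : ∀ u, ∃ f : κ → Lp ℂ 2 (μ.map l), u = ∑ c, embed c (f c)

end CyclicDecomposition

namespace DiagModel

variable {X : Type*} [TopologicalSpace X] [CompactSpace X] [MeasurableSpace X] [BorelSpace X]
  {E : Type} [NormedAddCommGroup E] [InnerProductSpace ℂ E] {T : E →L[ℂ] E} {μ : Measure X}
  [IsFiniteMeasure μ] {I : Type*} [Fintype I] (D : DiagModel T μ I)
  {l : C(X, ℝ)} {κ : Type*} [Fintype κ] (K : CyclicDecomposition μ l κ) {J : Finset I}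

theorem orthogonalFamily_comp :
    OrthogonalFamily ℂ (fun _ : J × κ => Lp ℂ 2 (μ.map l))
      fun j => (D.embed j.1).comp (K.embed j.2) := by
  rintro ⟨i, c⟩ ⟨i', c'⟩ hne f g
  by_cases hi : i = i'
  · subst hi
    exact ((D.embed i).inner_map_map _ _).trans
      (K.orthogonal (fun hc => hne (Prod.ext rfl hc)) f g)
  · exact D.orthogonal (fun h => hi (Subtype.ext h)) _ _

theorem spectralSubspace_eq_sums {S : Set ℝ} (hS : MeasurableSet S)
    (hJ : ∀ i ∈ J, D.symbol i = l) (hin : ∀ x, l x ∈ S) (hout : ∀ i ∉ J, ∀ x, D.symbol i x ∉ S) :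
    spectralSubspace T S =
      {u | ∃ f : J × κ → Lp ℂ 2 (μ.map l), u = ∑ j, D.embed j.1 (K.embed j.2 (f j))} := by
  classical
  have hmem := fun f => D.mem_spectralSubspace_iff_of_range f hS J
    (fun i hi x => by rw [hJ i hi]; exact hin x) hout
  ext u
  constructor
  · intro hu
    obtain ⟨f, rfl⟩ := D.complete u
    rw [hmem] at hu
    choose F hF using fun i => K.complete (f i)
    refine ⟨fun j => F j.1 j.2, ?_⟩
    rw [Fintype.sum_prod_type]
    simp only [← map_sum, ← hF]
    rw [Finset.sum_coe_sort J fun i => D.embed i (f i)]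
    exact (Finset.sum_subset (Finset.subset_univ J) fun i _ hi => by
      rw [hu i hi, map_zero]).symm
  · rintro ⟨f, rfl⟩
    set g : I → Lp ℂ 2 μ := fun i => if h : i ∈ J then ∑ c, K.embed c (f (⟨i, h⟩, c)) else 0
    have hg : ∑ j : J × κ, D.embed j.1 (K.embed j.2 (f j)) = ∑ i, D.embed i (g i) := by
      rw [Fintype.sum_prod_type, ← Finset.sum_subset (Finset.subset_univ J) fun i _ hi => by
        simp only [g, hi, dite_false, map_zero], ← Finset.sum_coe_sort J]
      exact Finset.sum_congr rfl fun i _ => by simp only [g, dif_pos i.2, map_sum]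
    rw [hg, hmem]
    exact fun i hi => dif_neg hi

include K in
theorem hasSpectralMultiplicity [NeZero μ] {S : Set ℝ} (hS : MeasurableSet S)
    (hJ : ∀ i ∈ J, D.symbol i = l) (hin : ∀ x, l x ∈ S) (hout : ∀ i ∉ J, ∀ x, D.symbol i x ∉ S) :
    HasSpectralMultiplicity T S (Fintype.card κ * J.card) := by
  let e : Fin (Fintype.card κ * J.card) ≃ J × κ :=
    (Fintype.equivFinOfCardEq (by simp [mul_comm])).symm
  have hmap : μ.map l ≠ 0 := by
    rw [Ne, Measure.map_eq_zero_iff l.continuous.aemeasurable]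
    exact NeZero.ne μ
  refine hasSpectralMultiplicity_of_orthogonalFamily hmap ?_
    (fun j => (D.embed (e j).1).comp (K.embed (e j).2))
    ((D.orthogonalFamily_comp K).comp e.injective) (fun j f g hfg => ?_) ?_
  · rw [Measure.map_apply l.continuous.measurable hS.compl, preimage_compl,
      preimage_eq_univ_iff.2 (range_subset_iff.2 hin), compl_univ, measure_empty]
  · change T (D.embed _ (K.embed _ f)) = D.embed _ (K.embed _ g)
    rw [D.intertwine, hJ _ (e j).1.2, K.intertwine _ f g hfg]
  · rw [D.spectralSubspace_eq_sums K hS hJ hin hout]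
    ext u
    refine (e.arrowCongr (Equiv.refl _)).symm.exists_congr fun f => ?_
    rw [← e.sum_comp]
    rfl

end DiagModel

/-! ### Even and odd functions on the circle -/

section Circle
open AddCircle

/-- `cos (2πθ)` on the circle `ℝ/ℤ`. -/
def circCos : C(UnitAddCircle, ℝ) :=
  ⟨fun θ => (fourier 1 θ : ℂ).re, Complex.continuous_re.comp (fourier 1).continuous⟩

/-- `sin (2πθ)` on the circle `ℝ/ℤ`. -/
def circSin : C(UnitAddCircle, ℝ) :=
  ⟨fun θ => (fourier 1 θ : ℂ).im, Complex.continuous_im.comp (fourier 1).continuous⟩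

theorem fourier_one_eq (θ : UnitAddCircle) :
    (fourier 1 θ : ℂ) = circCos θ + circSin θ * Complex.I :=
  (Complex.re_add_im _).symm

theorem circCos_sq_add_circSin_sq (θ : UnitAddCircle) : circCos θ ^ 2 + circSin θ ^ 2 = 1 := by
  have h : Complex.normSq (fourier 1 θ) = 1 := by
    rw [fourier_one]
    exact Circle.normSq_coe _
  rw [Complex.normSq_apply] at h
  rw [sq, sq]
  exact h

theorem eq_of_circCos_eq_of_circSin_eq {θ η : UnitAddCircle} (hcos : circCos θ = circCos η)
    (hsin : circSin θ = circSin η) : θ = η := by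
  refine injective_toCircle one_ne_zero (Circle.ext ?_)
  rw [← fourier_one, ← fourier_one, fourier_one_eq, fourier_one_eq, hcos, hsin]

theorem fourier_one_neg (θ : UnitAddCircle) :
    (fourier 1 (-θ) : ℂ) = (starRingEnd ℂ) (fourier 1 θ : ℂ) := by
  rw [← fourier_neg, fourier_apply, fourier_apply, smul_neg, neg_smul]

theorem circCos_neg (θ : UnitAddCircle) : circCos (-θ) = circCos θ :=
  (congrArg Complex.re (fourier_one_neg θ)).trans (Complex.conj_re _)

theorem circSin_neg (θ : UnitAddCircle) : circSin (-θ) = -circSin θ :=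
  (congrArg Complex.im (fourier_one_neg θ)).trans (Complex.conj_im _)

theorem circCos_mem (θ : UnitAddCircle) : circCos θ ∈ Icc (-1 : ℝ) 1 :=
  abs_le.1 ((sq_le_one_iff_abs_le_one _).1
    (by linarith [circCos_sq_add_circSin_sq θ, sq_nonneg (circSin θ)]))

theorem eq_or_eq_neg_of_circCos_eq {θ η : UnitAddCircle} (h : circCos θ = circCos η) :
    θ = η ∨ θ = -η := by
  have hsq : circSin θ ^ 2 = circSin η ^ 2 := by
    have hθ := circCos_sq_add_circSin_sq θ
    rw [h] at hθ
    exact add_left_cancel (hθ.trans (circCos_sq_add_circSin_sq η).symm)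
  refine (sq_eq_sq_iff_eq_or_eq_neg.1 hsq).imp (eq_of_circCos_eq_of_circSin_eq h) fun hs => ?_
  exact eq_of_circCos_eq_of_circSin_eq (h.trans (circCos_neg η).symm)
    (hs.trans (circSin_neg η).symm)

/-- The point of the upper half circle with a given cosine. -/
def circArccos (x : ℝ) : UnitAddCircle := ((Real.arccos x / (2 * Real.pi) : ℝ) : UnitAddCircle)

theorem measurable_circArccos : Measurable circArccos :=
  (AddCircle.continuous_mk' (1 : ℝ)).measurable.comp
    (Real.continuous_arccos.measurable.div_const _)

theorem circCos_coe (x : ℝ) : circCos (x : UnitAddCircle) = Real.cos (2 * Real.pi * x) := by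
  change (fourier 1 (x : UnitAddCircle) : ℂ).re = _
  rw [fourier_coe_apply, ← Complex.exp_ofReal_mul_I_re]
  congr 2
  push_cast
  ring

theorem circCos_circArccos {x : ℝ} (hx : x ∈ Icc (-1 : ℝ) 1) : circCos (circArccos x) = x := by
  rw [circArccos, circCos_coe, mul_div_cancel₀ _ (by positivity), Real.cos_arccos hx.1 hx.2]

theorem circArccos_circCos (θ : UnitAddCircle) :
    circArccos (circCos θ) = θ ∨ circArccos (circCos θ) = -θ :=
  eq_or_eq_neg_of_circCos_eq (circCos_circArccos (circCos_mem θ))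

theorem ae_circSin_ne_zero : ∀ᵐ θ ∂haarAddCircle, circSin θ ≠ 0 := by
  have hsub : {θ : UnitAddCircle | circSin θ = 0} ⊆ {θ | 2 • θ = 0} := fun θ hθ => by
    have hneg : -θ = θ := eq_of_circCos_eq_of_circSin_eq (circCos_neg θ) <| by
      rw [circSin_neg, show circSin θ = 0 from hθ, neg_zero]
    rw [mem_ofPred_eq, two_nsmul, ← neg_eq_iff_add_eq_zero, hneg]
  have hfin : {θ : UnitAddCircle | circSin θ = 0}.Finite :=
    (AddCircle.finite_torsion 1 two_pos).subset hsub
  have : Nontrivial UnitAddCircle := ⟨circArccos 1, circArccos (-1), fun h => by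
    have hcos := congrArg circCos h
    rw [circCos_circArccos (by simp), circCos_circArccos (by simp)] at hcos
    norm_num at hcos⟩
  exact measure_eq_zero_iff_ae_notMem.1 (hfin.measure_zero haarAddCircle)

/-- The fibre space of the Floquet transform. -/
abbrev CircL2 : Type := Lp ℂ 2 (haarAddCircle : Measure UnitAddCircle)

theorem not_finiteDimensional_circL2 :
    ¬ FiniteDimensional ℂ CircL2 := fun _ =>
  (inferInstance : Infinite ℤ).not_finite
    (orthonormal_fourier (T := (1 : ℝ))).linearIndependent.finite

end Circle

section Isometries

variable {X : Type*} [MeasurableSpace X] {μ : Measure X}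

theorem memLp_mul_of_norm_eq_one {s : X → ℂ} (hs : Measurable s) (hs1 : ∀ x, ‖s x‖ = 1)
    (f : Lp ℂ 2 μ) : MemLp (fun x => s x * f x) 2 μ :=
  (memLp_congr_norm (hs.aestronglyMeasurable.mul (Lp.aestronglyMeasurable f))
    (Lp.aestronglyMeasurable f) (.of_forall fun x => by
      rw [Pi.mul_apply, norm_mul, hs1, one_mul])).2 (Lp.memLp f)

/-- Multiplication by a measurable unimodular function, as an isometry of `L²(μ)`. -/
def unimodularMul (μ : Measure X) {s : X → ℂ} (hs : Measurable s) (hs1 : ∀ x, ‖s x‖ = 1) :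
    Lp ℂ 2 μ →ₗᵢ[ℂ] Lp ℂ 2 μ where
  toFun f := (memLp_mul_of_norm_eq_one hs hs1 f).toLp _
  map_add' f g := by
    rw [← MemLp.toLp_add]
    refine MemLp.toLp_congr _ _ ?_
    filter_upwards [Lp.coeFn_add f g] with x hx
    rw [hx, Pi.add_apply, mul_add]
    rfl
  map_smul' c f := by
    rw [← MemLp.toLp_const_smul]
    refine MemLp.toLp_congr _ _ ?_
    filter_upwards [Lp.coeFn_smul c f] with x hx
    rw [hx, Pi.smul_apply, mul_smul_comm]
    rfl
  norm_map' f := by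
    refine (Lp.norm_toLp _ (memLp_mul_of_norm_eq_one hs hs1 f)).trans (congrArg _ ?_)
    exact eLpNorm_congr_norm_ae (.of_forall fun x => by rw [norm_mul, hs1, one_mul])

theorem coeFn_unimodularMul {s : X → ℂ} (hs : Measurable s) (hs1 : ∀ x, ‖s x‖ = 1)
    (f : Lp ℂ 2 μ) : unimodularMul μ hs hs1 f =ᵐ[μ] fun x => s x * f x :=
  (memLp_mul_of_norm_eq_one hs hs1 f).coeFn_toLp

/-- Composition with `l`, as an isometric embedding of `L²` of the law of `l` into `L²(μ)`. -/
def pullback (μ : Measure X) {l : X → ℝ} (hl : Measurable l) :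
    Lp ℂ 2 (μ.map l) →ₗᵢ[ℂ] Lp ℂ 2 μ :=
  Lp.compMeasurePreservingₗᵢ ℂ l ⟨hl, rfl⟩

theorem coeFn_pullback {l : X → ℝ} (hl : Measurable l) (f : Lp ℂ 2 (μ.map l)) :
    pullback μ hl f =ᵐ[μ] fun x => f (l x) :=
  Lp.coeFn_compMeasurePreserving f ⟨hl, rfl⟩

theorem mulLp_pullback [TopologicalSpace X] [CompactSpace X] [BorelSpace X] [IsFiniteMeasure μ]
    (l : C(X, ℝ)) {f g : Lp ℂ 2 (μ.map l)} (hfg : ∀ᵐ x ∂μ.map l, g x = (x : ℂ) * f x) :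
    mulLp μ (complexify l) (pullback μ l.measurable f) = pullback μ l.measurable g := by
  refine Lp.ext ?_
  filter_upwards [coeFn_mulLp (complexify l) (pullback μ l.measurable f),
    coeFn_pullback l.measurable f, coeFn_pullback l.measurable g,
    ae_of_ae_map l.measurable.aemeasurable hfg] with x h1 h2 h3 h4
  rw [h1, h2, h3, h4, complexify_apply]

theorem mulLp_unimodularMul [TopologicalSpace X] [CompactSpace X] [BorelSpace X]
    [IsFiniteMeasure μ] (w : C(X, ℂ)) {s : X → ℂ} (hs : Measurable s) (hs1 : ∀ x, ‖s x‖ = 1)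
    (f : Lp ℂ 2 μ) :
    mulLp μ w (unimodularMul μ hs hs1 f) = unimodularMul μ hs hs1 (mulLp μ w f) := by
  refine Lp.ext ?_
  filter_upwards [coeFn_mulLp w (unimodularMul μ hs hs1 f), coeFn_unimodularMul hs hs1 f,
    coeFn_unimodularMul hs hs1 (mulLp μ w f), coeFn_mulLp w f] with x h1 h2 h3 h4
  rw [h1, h2, h3, h4, mul_left_comm]

end Isometries

section EvenOdd
open AddCircle

/-- The reflection `f(θ) ↦ f(-θ)` of `L²` of the circle. -/
def reflect : CircL2 →ₗᵢ[ℂ] CircL2 :=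
  Lp.compMeasurePreservingₗᵢ ℂ Neg.neg (Measure.measurePreserving_neg haarAddCircle)

theorem coeFn_reflect (f : CircL2) :
    reflect f =ᵐ[haarAddCircle] fun θ => f (-θ) :=
  Lp.coeFn_compMeasurePreserving f _

theorem reflect_reflect (f : CircL2) :
    reflect (reflect f) = f := by
  refine Lp.ext ?_
  filter_upwards [coeFn_reflect (reflect f),
    (Measure.measurePreserving_neg haarAddCircle).quasiMeasurePreserving.ae
      (coeFn_reflect f)] with θ h1 h2
  rw [h1, h2, neg_neg]

/-- The sign of `sin (2πθ)`, with value `1` at its zeros so as to be unimodular. -/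
def circSign (θ : UnitAddCircle) : ℂ := if 0 ≤ circSin θ then 1 else -1

theorem measurable_circSign : Measurable circSign :=
  .ite (measurableSet_le measurable_const circSin.measurable) measurable_const measurable_const

theorem norm_circSign (θ : UnitAddCircle) : ‖circSign θ‖ = 1 := by
  unfold circSign
  split_ifs <;> simp

theorem circSign_mul_self (θ : UnitAddCircle) : circSign θ * circSign θ = 1 := by
  unfold circSign
  split_ifs <;> simp

theorem circSign_neg {θ : UnitAddCircle} (hθ : circSin θ ≠ 0) : circSign (-θ) = -circSign θ := by
  simp only [circSign, circSin_neg, neg_nonneg]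
  rcases hθ.lt_or_gt with h | h
  · rw [if_pos h.le, if_neg h.not_ge, neg_neg]
  · rw [if_neg h.not_ge, if_pos h.le]

/-- Multiplication by the sign of `sin (2πθ)`; it exchanges even and odd functions. -/
def signMul : CircL2 →ₗᵢ[ℂ] CircL2 :=
  unimodularMul haarAddCircle measurable_circSign norm_circSign

theorem signMul_signMul (f : CircL2) :
    signMul (signMul f) = f := by
  refine Lp.ext ?_
  filter_upwards [coeFn_unimodularMul measurable_circSign norm_circSign (signMul f),
    coeFn_unimodularMul measurable_circSign norm_circSign f] with θ h1 h2
  refine h1.trans ?_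
  rw [signMul, h2, ← mul_assoc, circSign_mul_self, one_mul]

theorem reflect_signMul (f : CircL2) :
    reflect (signMul f) = -signMul (reflect f) := by
  refine Lp.ext ?_
  filter_upwards [coeFn_reflect (signMul f), coeFn_reflect f, ae_circSin_ne_zero,
    (Measure.measurePreserving_neg haarAddCircle).quasiMeasurePreserving.ae
      (coeFn_unimodularMul measurable_circSign norm_circSign f),
    coeFn_unimodularMul measurable_circSign norm_circSign (reflect f),
    Lp.coeFn_neg (signMul (reflect f))] with θ h1 h2 hθ h3 h4 h5
  rw [h1, h5, Pi.neg_apply, signMul, h3, h4, h2, circSign_neg hθ, neg_mul]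

theorem inner_eq_zero_of_reflect_eq {f g : CircL2}
    (hf : reflect f = f) (hg : reflect g = -g) : inner ℂ f g = 0 := by
  have h := reflect.inner_map_map f g
  rw [hf, hg, inner_neg_right] at h
  exact self_eq_neg.1 h.symm

variable {l : C(UnitAddCircle, ℝ)}

theorem reflect_pullback (hl : ∀ θ, l (-θ) = l θ) (f : Lp ℂ 2 (haarAddCircle.map l)) :
    reflect (pullback haarAddCircle l.measurable f) = pullback haarAddCircle l.measurable f := by
  refine Lp.ext ?_
  filter_upwards [coeFn_reflect (pullback haarAddCircle l.measurable f),
    (Measure.measurePreserving_neg haarAddCircle).quasiMeasurePreserving.ae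
      (coeFn_pullback l.measurable f), coeFn_pullback l.measurable f] with θ h1 h2 h3
  rw [h1, h2, h3, hl]

theorem exists_pullback_eq {G : ℝ → ℝ} (hG : Measurable G) (hGl : ∀ θ, G (l θ) = circCos θ)
    {f : CircL2} (hf : reflect f = f) :
    ∃ F, pullback haarAddCircle l.measurable F = f := by
  set F : ℝ → ℂ := fun x => f (circArccos (G x))
  have hF : Measurable F :=
    (Lp.stronglyMeasurable f).measurable.comp (measurable_circArccos.comp hG)
  have hFl : F ∘ l =ᵐ[haarAddCircle] f := by
    filter_upwards [coeFn_reflect f] with θ hθ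
    rw [hf] at hθ
    simp only [F, Function.comp_apply, hGl]
    rcases circArccos_circCos θ with h | h <;> rw [h]
    exact hθ.symm
  have hFL : MemLp F 2 (haarAddCircle.map l) := by
    rw [memLp_map_measure_iff hF.aestronglyMeasurable l.measurable.aemeasurable,
      memLp_congr_ae hFl]
    exact Lp.memLp f
  refine ⟨hFL.toLp F, Lp.ext ?_⟩
  filter_upwards [coeFn_pullback l.measurable (hFL.toLp F), hFl,
    ae_of_ae_map l.measurable.aemeasurable hFL.coeFn_toLp] with θ h1 h2 h3
  rw [h1, h3, ← h2, Function.comp_apply]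

/-- The even functions are the functions of `l`, and the odd ones are those times `circSign`. -/
def circleCyclicDecomposition (hl : ∀ θ, l (-θ) = l θ) {G : ℝ → ℝ} (hG : Measurable G)
    (hGl : ∀ θ, G (l θ) = circCos θ) : CyclicDecomposition haarAddCircle l Bool where
  embed
    | false => pullback haarAddCircle l.measurable
    | true => signMul.comp (pullback haarAddCircle l.measurable)
  orthogonal := by
    have hodd : ∀ f g : Lp ℂ 2 (haarAddCircle.map l),
        inner ℂ (pullback haarAddCircle l.measurable f)
          (signMul (pullback haarAddCircle l.measurable g)) = 0 := fun f g =>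
      inner_eq_zero_of_reflect_eq (reflect_pullback hl f)
        (by rw [reflect_signMul, reflect_pullback hl])
    rintro (_ | _) (_ | _) hne f g
    exacts [absurd rfl hne, hodd f g, inner_eq_zero_symm.1 (hodd g f), absurd rfl hne]
  intertwine
    | false, _, _, hfg => mulLp_pullback l hfg
    | true, _, _, hfg =>
      (mulLp_unimodularMul _ _ _ _).trans (congrArg signMul (mulLp_pullback l hfg))
  complete u := by
    obtain ⟨F, hF⟩ := exists_pullback_eq hG hGl (f := (2⁻¹ : ℂ) • (u + reflect u)) <| by
      rw [map_smul, map_add, reflect_reflect, add_comm]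
    obtain ⟨K, hK⟩ := exists_pullback_eq hG hGl
        (f := signMul ((2⁻¹ : ℂ) • (u - reflect u))) <| by
      rw [reflect_signMul, map_smul, map_sub, reflect_reflect, ← map_neg, ← smul_neg, neg_sub]
    refine ⟨fun c => bif c then K else F, ?_⟩
    rw [Fintype.sum_bool]
    change u = signMul (pullback haarAddCircle l.measurable K) +
      pullback haarAddCircle l.measurable F
    rw [hK, hF, signMul_signMul]
    module

end EvenOdd

/-! ### Cyclic Jacobi matrices and their energy levels -/

section CyclicMatrix

open Matrix

variable {R : Type*} [CommRing R]

theorem det_update_corners {n : ℕ} (hn : n ≠ 0) (M : Matrix (Fin (n + 1)) (Fin (n + 1)) R)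
    (x y : R) :
    ((M.updateRow 0 (M 0 + x • Pi.single (Fin.last n) 1)).updateRow (Fin.last n)
      (M (Fin.last n) + y • Pi.single 0 1)).det =
    M.det + x * M.adjugate (Fin.last n) 0 + y * M.adjugate 0 (Fin.last n) +
      x * y * ((M.updateRow 0 (Pi.single (Fin.last n) 1)).updateRow (Fin.last n)
        (Pi.single 0 1)).det := by
  have hne : (Fin.last n) ≠ 0 := by
    intro h
    exact hn (by simpa using congrArg Fin.val h)
  have h1 : ∀ w, (M.updateRow 0 w).updateRow (Fin.last n) (M (Fin.last n)) = M.updateRow 0 w := by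
    intro w
    have : M (Fin.last n) = (M.updateRow 0 w) (Fin.last n) := by
      rw [updateRow_ne hne]
    rw [this, updateRow_eq_self]
  rw [det_updateRow_add, det_updateRow_smul, h1, det_updateRow_add, det_updateRow_smul,
    updateRow_eq_self, updateRow_comm _ hne.symm, det_updateRow_add, det_updateRow_smul,
    ← updateRow_comm _ hne.symm, updateRow_eq_self, adjugate_apply, adjugate_apply,
    updateRow_comm _ hne.symm]
  ring

theorem adjugate_last_zero {n : ℕ} (M : Matrix (Fin (n + 1)) (Fin (n + 1)) R)
    (h : ∀ i j : Fin (n + 1), (j : ℕ) + 1 < i → M i j = 0) :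
    M.adjugate (Fin.last n) 0 = ∏ i : Fin n, -M i.succ i.castSucc := by
  rw [adjugate_fin_succ_eq_det_submatrix, det_of_isUpperTriangular, Finset.prod_neg]
  · simp
  · intro i j hij
    have hij' : (j : ℕ) < i := hij
    simp only [submatrix_apply, Fin.succAbove_zero, Fin.succAbove_last]
    exact h _ _ (by simpa using hij')

theorem adjugate_zero_last {n : ℕ} (M : Matrix (Fin (n + 1)) (Fin (n + 1)) R)
    (h : ∀ i j : Fin (n + 1), (i : ℕ) + 1 < j → M i j = 0) :
    M.adjugate 0 (Fin.last n) = ∏ i : Fin n, -M i.castSucc i.succ := by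
  rw [adjugate_fin_succ_eq_det_submatrix, det_of_isLowerTriangular, Finset.prod_neg]
  · simp
  · intro i j hij
    have hij' : (i : ℕ) < j := hij
    simp only [submatrix_apply, Fin.succAbove_zero, Fin.succAbove_last]
    exact h _ _ (by simpa using hij')

variable {𝕜 : Type*} [Field 𝕜] {m : ℕ}

/-- The cyclic successor in `Fin m`. -/
def cycNext (i : Fin m) : Fin m :=
  if h : (i : ℕ) + 1 < m then ⟨i + 1, h⟩ else ⟨0, i.pos⟩

/-- The cyclic predecessor in `Fin m`. -/
def cycPrev (i : Fin m) : Fin m :=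
  ⟨if (i : ℕ) = 0 then m - 1 else i - 1, by split_ifs <;> omega⟩

theorem cycNext_val (i : Fin m) :
    ((cycNext i : Fin m) : ℕ) = if (i : ℕ) + 1 = m then 0 else (i : ℕ) + 1 := by
  unfold cycNext
  have := i.2
  split_ifs with h1 h2 h2
  · omega
  · rfl
  · rfl
  · omega

theorem cycPrev_val (i : Fin m) :
    ((cycPrev i : Fin m) : ℕ) = if (i : ℕ) = 0 then m - 1 else (i : ℕ) - 1 := rfl

/-- The matrix of `a_{n-1} y_{n-1} + a_n y_{n+1} + u_n y_n` on sequences with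
`y_{n+m} = τ y_n`. -/
def cycMatrix (m : ℕ) (a u : ℤ → 𝕜) (τ : 𝕜) :
    Matrix (Fin m) (Fin m) 𝕜 := fun i j =>
  (if i = j then u ((i : ℕ) + 1) else 0) +
    (if j = cycNext i then a ((i : ℕ) + 1) * (if (i : ℕ) + 1 = m then τ else 1) else 0) +
    (if j = cycPrev i then a (i : ℕ) * (if (i : ℕ) = 0 then τ⁻¹ else 1) else 0)

/-- The entries of `cycMatrix` inside the band `|i - j| ≤ 1`, subtracted from those of the scalar
matrix `z`: all that is left after the two corner entries, which carry `τ`, are removed. -/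
def openMatrix (n : ℕ) (a u : ℤ → 𝕜) (z : 𝕜) : Matrix (Fin (n + 1)) (Fin (n + 1)) 𝕜 := fun i j =>
  (if i = j then z - u ((i : ℕ) + 1) else 0) -
    (if (j : ℕ) = i + 1 then a ((i : ℕ) + 1) else 0) -
    (if (i : ℕ) = j + 1 then a (i : ℕ) else 0)

theorem floquetMatrix_eq_cycMatrix (hm : 2 ≤ m) (a u : ℤ → ℝ) (τ : ℝ) :
    floquetMatrix m a u τ = cycMatrix m a u τ := by
  ext i j
  have hi := i.2
  have hj := j.2
  simp only [floquetMatrix, cycMatrix, Fin.ext_iff, cycNext_val, cycPrev_val]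
  rcases Nat.eq_zero_or_pos (i : ℕ) with h0 | h0
  · have hne : ¬ ((i : ℕ) = j + 1) := by omega
    simp only [h0, show ((j : ℕ) + 1 = m) ↔ ((j : ℕ) = m - 1) by omega,
      show ¬ (0 + 1 = m) by omega, true_and, false_and, if_true, if_false, mul_one, h0 ▸ hne]
    split_ifs <;> simp [mul_comm]
  have hprev : ((i : ℕ) = j + 1) ↔ (j : ℕ) = i - 1 := by omega
  rcases Nat.lt_or_ge ((i : ℕ) + 1) m with h1 | h1
  · simp only [h0.ne', h1.ne, hprev, false_and, if_false, mul_one, add_zero]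
  · have hlast : (i : ℕ) + 1 = m := by omega
    have hlast' : ((i : ℤ) + 1) = m := by omega
    simp only [h0.ne', hlast, hprev, hlast', show ¬ ((j : ℕ) = m) by omega, false_and, true_and,
      if_false, if_true, mul_one, add_zero]
    rw [add_right_comm, mul_comm τ]

/-- The product of the off-diagonal coefficients over a period. -/
def cycProd (m : ℕ) (a : ℤ → 𝕜) : 𝕜 := ∏ i : Fin m, a (i : ℕ)

theorem cycProd_succ (n : ℕ) (a : ℤ → 𝕜) :
    cycProd (n + 1) a = a 0 * ∏ i : Fin n, a ((i : ℕ) + 1) := by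
  rw [cycProd, Fin.prod_univ_succ]
  simp

theorem openMatrix_adjugate_last_zero (n : ℕ) (a u : ℤ → 𝕜) (z : 𝕜) :
    (openMatrix n a u z).adjugate (Fin.last n) 0 = ∏ i : Fin n, a ((i : ℕ) + 1) := by
  rw [adjugate_last_zero]
  · refine Finset.prod_congr rfl fun i _ => ?_
    have : ¬ ((i : ℕ) = i + 1 + 1) := by omega
    simp [openMatrix, Fin.ext_iff, this]
  · intro i j hij
    simp [openMatrix, Fin.ext_iff, show ¬ (i : ℕ) = j by omega, show ¬ (j : ℕ) = i + 1 by omega,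
      show ¬ (i : ℕ) = j + 1 by omega]

theorem openMatrix_adjugate_zero_last (n : ℕ) (a u : ℤ → 𝕜) (z : 𝕜) :
    (openMatrix n a u z).adjugate 0 (Fin.last n) = ∏ i : Fin n, a ((i : ℕ) + 1) := by
  rw [adjugate_zero_last]
  · refine Finset.prod_congr rfl fun i _ => ?_
    have : ¬ ((i : ℕ) = i + 1 + 1) := by omega
    simp [openMatrix, Fin.ext_iff, this]
  · intro i j hij
    simp [openMatrix, Fin.ext_iff, show ¬ (i : ℕ) = j by omega, show ¬ (j : ℕ) = i + 1 by omega,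
      show ¬ (i : ℕ) = j + 1 by omega]

theorem scalar_sub_cycMatrix_eq_updateRow {n : ℕ} (hn : 2 ≤ n) (a u : ℤ → 𝕜)
    (ha : a (n + 1) = a 0) (z τ : 𝕜) :
    scalar (Fin (n + 1)) z - cycMatrix (n + 1) a u τ =
      ((openMatrix n a u z).updateRow 0
        (openMatrix n a u z 0 + (-(a 0 * τ⁻¹)) • Pi.single (Fin.last n) 1)).updateRow (Fin.last n)
        (openMatrix n a u z (Fin.last n) + (-(a 0 * τ)) • Pi.single 0 1) := by
  ext i j
  have hi := i.2
  have hj := j.2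
  rw [Matrix.sub_apply, scalar_apply, diagonal_apply, updateRow_apply, updateRow_apply]
  simp only [cycMatrix, openMatrix, Fin.ext_iff, cycNext_val, cycPrev_val, Fin.val_last,
    Fin.val_zero, Pi.add_apply, Pi.smul_apply, Pi.single_apply, smul_eq_mul]
  rcases Nat.eq_zero_or_pos (i : ℕ) with h0 | h0
  · simp only [h0, show ¬ (0 + 1 = n + 1) by omega, show ¬ (0 = n) by omega,
      show ¬ (0 = (j : ℕ) + 1) by omega, if_true, if_false, mul_one, Nat.cast_zero,
      Nat.add_sub_cancel]
    split_ifs <;> first | (exfalso; omega) | ring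
  have hprev : (i : ℕ) = j + 1 ↔ (j : ℕ) = i - 1 := by omega
  rcases Nat.lt_or_ge (i : ℕ) n with h1 | h1
  · simp only [h0.ne', show ¬ ((i : ℕ) + 1 = n + 1) by omega, h1.ne, hprev, if_false, mul_one]
    split_ifs <;> ring
  · obtain hin : (i : ℕ) = n := by omega
    simp only [hin, ha, show ¬ (n = 0) by omega, show ¬ ((j : ℕ) = n + 1) by omega,
      show (n = j + 1) ↔ (j : ℕ) = n - 1 by omega, if_false, if_true, mul_one]
    split_ifs <;> first | (exfalso; omega) | ring

/- Only the corners depend on `τ`; the term with both corners has weight `τ * τ⁻¹ = 1`. -/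
theorem det_sub_cycMatrix (hm : 3 ≤ m) (a u : ℤ → 𝕜) (ha : a m = a 0) (z τ : 𝕜) (hτ : τ ≠ 0) :
    (scalar (Fin m) z - cycMatrix m a u τ).det =
      (scalar (Fin m) z - cycMatrix m a u 1).det + cycProd m a * (2 - τ - τ⁻¹) := by
  obtain ⟨n, rfl⟩ : ∃ n, m = n + 1 := ⟨m - 1, by omega⟩
  have ha' : a (n + 1) = a 0 := by exact_mod_cast ha
  rw [scalar_sub_cycMatrix_eq_updateRow (by omega) a u ha',
    scalar_sub_cycMatrix_eq_updateRow (by omega) a u ha', det_update_corners (by omega),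
    det_update_corners (by omega), openMatrix_adjugate_last_zero, openMatrix_adjugate_zero_last,
    cycProd_succ]
  field_simp
  ring

theorem cycMatrix_mulVec (a u : ℤ → 𝕜) (τ : 𝕜) (f : Fin m → 𝕜) (i : Fin m) :
    (cycMatrix m a u τ *ᵥ f) i = u ((i : ℕ) + 1) * f i +
      a ((i : ℕ) + 1) * (if (i : ℕ) + 1 = m then τ else 1) * f (cycNext i) +
      a (i : ℕ) * (if (i : ℕ) = 0 then τ⁻¹ else 1) * f (cycPrev i) := by
  simp only [mulVec, dotProduct, cycMatrix, add_mul, Finset.sum_add_distrib, ite_mul,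
    zero_mul, Finset.sum_ite_eq, Finset.sum_ite_eq', Finset.mem_univ, if_true]

theorem scalar_sub_mulVec {ι R : Type*} [Fintype ι] [DecidableEq ι] [CommRing R]
    (A : Matrix ι ι R) (z : R) (f : ι → R) : (scalar ι z - A) *ᵥ f = z • f - A *ᵥ f := by
  rw [sub_mulVec]
  congr 1
  ext i
  simp [scalar_apply, mulVec_diagonal]

end CyclicMatrix

section Gershgorin

open Matrix

variable {𝕜 : Type*} [NormedField 𝕜] {m : ℕ}

theorem exists_ne_zero_forall_norm_le {ι E : Type*} [Finite ι] [NormedAddCommGroup E] {f : ι → E}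
    (hf : f ≠ 0) : ∃ k, f k ≠ 0 ∧ ∀ j, ‖f j‖ ≤ ‖f k‖ := by
  obtain ⟨j, hj⟩ := Function.ne_iff.1 hf
  have : Nonempty ι := ⟨j⟩
  obtain ⟨k, hk⟩ := Finite.exists_max fun j => ‖f j‖
  exact ⟨k, norm_pos_iff.1 ((norm_pos_iff.2 hj).trans_le (hk j)), hk⟩

theorem norm_sub_le_of_row (a u : ℤ → 𝕜) (τ : 𝕜) (hτ : ‖τ‖ = 1) {r : ℝ}
    (ha : ∀ n, ‖a n‖ + ‖a (n + 1)‖ ≤ r) (z : 𝕜) (f : Fin m → 𝕜) (k : Fin m)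
    (hk : ∀ j, ‖f j‖ ≤ ‖f k‖) (hfk : f k ≠ 0) (h : (cycMatrix m a u τ *ᵥ f) k = z * f k) :
    ‖z - u ((k : ℕ) + 1)‖ ≤ r := by
  rw [cycMatrix_mulVec] at h
  have hrow : (z - u ((k : ℕ) + 1)) * f k =
      a ((k : ℕ) + 1) * (if (k : ℕ) + 1 = m then τ else 1) * f (cycNext k) +
      a (k : ℕ) * (if (k : ℕ) = 0 then τ⁻¹ else 1) * f (cycPrev k) := by
    linear_combination -h
  have hnext : ‖(if (k : ℕ) + 1 = m then τ else 1)‖ = 1 := by split_ifs <;> simp [hτ]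
  have hprev : ‖(if (k : ℕ) = 0 then τ⁻¹ else 1)‖ = 1 := by split_ifs <;> simp [hτ]
  refine le_of_mul_le_mul_right ?_ (norm_pos_iff.2 hfk)
  calc ‖z - u ((k : ℕ) + 1)‖ * ‖f k‖
      ≤ ‖a ((k : ℕ) + 1)‖ * ‖f (cycNext k)‖ + ‖a (k : ℕ)‖ * ‖f (cycPrev k)‖ := by
        rw [← norm_mul, hrow]
        refine (norm_add_le _ _).trans_eq ?_
        rw [norm_mul, norm_mul, norm_mul, norm_mul, hnext, hprev, mul_one, mul_one]
    _ ≤ ‖a ((k : ℕ) + 1)‖ * ‖f k‖ + ‖a (k : ℕ)‖ * ‖f k‖ := by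
        gcongr <;> exact hk _
    _ = (‖a (k : ℕ)‖ + ‖a ((k : ℕ) + 1)‖) * ‖f k‖ := by ring
    _ ≤ r * ‖f k‖ := by gcongr; exact ha _

theorem det_ne_zero_of_far (a u : ℤ → 𝕜) (τ : 𝕜) (hτ : ‖τ‖ = 1) {r : ℝ}
    (ha : ∀ n, ‖a n‖ + ‖a (n + 1)‖ ≤ r) (z : 𝕜) (hz : ∀ k : Fin m, r < ‖z - u ((k : ℕ) + 1)‖) :
    (scalar (Fin m) z - cycMatrix m a u τ).det ≠ 0 := by
  intro hdet
  obtain ⟨f, hf, hfz⟩ := exists_mulVec_eq_zero_iff.2 hdet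
  rw [scalar_sub_mulVec, sub_eq_zero] at hfz
  obtain ⟨k, hfk, hk⟩ := exists_ne_zero_forall_norm_le hf
  exact (hz k).not_ge (norm_sub_le_of_row a u τ hτ ha z f k hk hfk (by rw [← hfz]; rfl))

end Gershgorin

theorem exists_mem_Ioo_eq_zero_of_mul_neg {f : ℝ → ℝ} {x y : ℝ} (hxy : x ≤ y)
    (hf : ContinuousOn f (Icc x y)) (h : f x * f y < 0) : ∃ z ∈ Ioo x y, f z = 0 := by
  rcases mul_neg_iff.1 h with h | h
  · exact intermediate_value_Ioo' hxy hf ⟨h.2, h.1⟩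
  · exact intermediate_value_Ioo hxy hf h

section Levels

open Matrix

/-- A periodic Jacobi operator whose potential is strongly separated compared with its hopping
coefficients, which are normalised by `a_n + a_{n+1} ≤ 3`. By Gershgorin's theorem the spectrum
stays within `3` of the values of the potential, and `20` leaves ample room between these
windows. -/
structure SepJacobi (m : ℕ) (a u : ℤ → ℝ) : Prop where
  hm : 3 ≤ m
  a_per : Function.Periodic a (m : ℤ)
  u_per : Function.Periodic u (m : ℤ)
  a_nonneg : ∀ n, 0 ≤ a n
  a_add_le : ∀ n, a n + a (n + 1) ≤ 3
  sep : ∀ i j : Fin m, i ≠ j → 20 ≤ |u ((i : ℕ) + 1) - u ((j : ℕ) + 1)|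

/-- The characteristic polynomial at quasi-momentum `θ`, as a function of `x = cos θ`. -/
def levelPoly (m : ℕ) (a u : ℤ → ℝ) (x : ℝ) : Polynomial ℝ :=
  (cycMatrix m a u 1).charpoly + Polynomial.C (2 * cycProd m a * (1 - x))

/-- The energy level near `u_{i+1}` at quasi-momentum `θ`, as a function of `x = cos θ`: the only
root of `levelPoly` within distance `4`, if there is one (an arbitrary real number otherwise). -/
def level (m : ℕ) (a u : ℤ → ℝ) (i : Fin m) (x : ℝ) : ℝ :=
  Classical.epsilon fun z => |z - u ((i : ℕ) + 1)| < 4 ∧ (levelPoly m a u x).eval z = 0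

namespace SepJacobi

variable {m : ℕ} {a u : ℤ → ℝ} (h : SepJacobi m a u)
include h

theorem norm_add_le (n : ℤ) : ‖a n‖ + ‖a (n + 1)‖ ≤ 3 := by
  rw [Real.norm_of_nonneg (h.a_nonneg n), Real.norm_of_nonneg (h.a_nonneg _)]
  exact h.a_add_le n

theorem a_m : a m = a 0 := by
  have := h.a_per 0
  rwa [zero_add] at this

theorem cycProd_nonneg : 0 ≤ cycProd m a := Finset.prod_nonneg fun _ _ => h.a_nonneg _

theorem charpoly_cycMatrix (τ : ℝ) (hτ : τ ≠ 0) :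
    (cycMatrix m a u τ).charpoly = levelPoly m a u ((τ + τ⁻¹) / 2) := by
  refine Polynomial.funext fun z => ?_
  rw [levelPoly, Polynomial.eval_add, Polynomial.eval_C, eval_charpoly,
    eval_charpoly, det_sub_cycMatrix h.hm a u h.a_m z τ hτ]
  ring

theorem det_complex (z : ℝ) (τ : ℂ) (hτ : ‖τ‖ = 1) :
    (scalar (Fin m) (z : ℂ) -
      cycMatrix m (fun n => (a n : ℂ)) (fun n => (u n : ℂ)) τ).det =
      (((levelPoly m a u τ.re).eval z : ℝ) : ℂ) := by
  have hτ0 : τ ≠ 0 := by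
    rintro rfl
    simp at hτ
  rw [det_sub_cycMatrix h.hm _ _ (by simp [h.a_m]) _ τ hτ0, levelPoly, Polynomial.eval_add,
    Polynomial.eval_C, eval_charpoly]
  have hmap : (scalar (Fin m) (z : ℂ) -
      cycMatrix m (fun n => (a n : ℂ)) (fun n => (u n : ℂ)) 1) =
      (scalar (Fin m) z - cycMatrix m a u 1).map Complex.ofRealHom := by
    ext i j
    simp only [Matrix.sub_apply, map_apply, scalar_apply, diagonal_apply,
      cycMatrix, inv_one, ite_self, mul_one]
    simp only [map_sub, map_add, apply_ite Complex.ofRealHom, map_zero, Complex.ofRealHom_eq_coe]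
  have hprod : cycProd m (fun n => (a n : ℂ)) = ((cycProd m a : ℝ) : ℂ) := by
    simp [cycProd]
  have hinv : τ⁻¹ = (starRingEnd ℂ) τ := by
    rw [Complex.inv_def, Complex.normSq_eq_norm_sq, hτ]; simp
  have hadd : τ + τ⁻¹ = ((2 * τ.re : ℝ) : ℂ) := by
    rw [hinv, Complex.add_conj]
  rw [hmap, ← RingHom.mapMatrix_apply, ← RingHom.map_det, hprod, sub_sub, hadd]
  simp
  ring

theorem levelPoly_monic (x : ℝ) : (levelPoly m a u x).Monic := by
  refine (charpoly_monic _).add_of_left ?_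
  refine Polynomial.degree_C_le.trans_lt ?_
  rw [charpoly_degree_eq_dim, Fintype.card_fin]
  have := h.hm
  exact_mod_cast (by omega : 0 < m)

omit h in
theorem levelPoly_natDegree (x : ℝ) : (levelPoly m a u x).natDegree = m := by
  rw [levelPoly, Polynomial.natDegree_add_C, charpoly_natDegree_eq_dim, Fintype.card_fin]

theorem charpoly_eval_ne_zero_of_far {s : ℝ} (hs : s ∈ Icc (0 : ℝ) 1) (τ : ℝ) (hτ : ‖τ‖ = 1)
    (z : ℝ) (hz : ∀ k : Fin m, 3 < |z - u ((k : ℕ) + 1)|) :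
    (cycMatrix m (fun n => s * a n) u τ).charpoly.eval z ≠ 0 := by
  rw [eval_charpoly]
  refine det_ne_zero_of_far _ u τ hτ (fun n => ?_) z hz
  calc ‖s * a n‖ + ‖s * a (n + 1)‖ = |s| * (‖a n‖ + ‖a (n + 1)‖) := by
        rw [norm_mul, norm_mul, ← mul_add, Real.norm_eq_abs s]
    _ ≤ 1 * 3 := by
        gcongr
        · exact abs_le.2 ⟨by linarith [hs.1], hs.2⟩
        · exact h.norm_add_le n
    _ = 3 := one_mul 3

/- Switch the off-diagonal coefficients off continuously: outside the Gershgorin windows the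
characteristic polynomial never vanishes on the way, so it keeps its sign. -/
theorem charpoly_sign (τ : ℝ) (hτ : ‖τ‖ = 1) (z : ℝ)
    (hz : ∀ k : Fin m, 3 < |z - u ((k : ℕ) + 1)|) :
    0 < (cycMatrix m a u τ).charpoly.eval z * ∏ k : Fin m, (z - u ((k : ℕ) + 1)) := by
  set f : ℝ → ℝ := fun s => (cycMatrix m (fun n => s * a n) u τ).charpoly.eval z with hf
  have hne : ∀ s ∈ Icc (0 : ℝ) 1, f s ≠ 0 := fun s hs =>
    h.charpoly_eval_ne_zero_of_far hs τ hτ z hz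
  have hcont : Continuous f := by
    simp only [hf, eval_charpoly]
    refine Continuous.matrix_det (continuous_matrix fun i j => ?_)
    simp only [Matrix.sub_apply, cycMatrix]
    refine continuous_const.sub ((continuous_const.add ?_).add ?_) <;>
    · split_ifs <;> fun_prop
  have h0 : f 0 = ∏ k : Fin m, (z - u ((k : ℕ) + 1)) := by
    have : scalar (Fin m) z - cycMatrix m (fun n => (0 : ℝ) * a n) u τ =
        diagonal fun k : Fin m => z - u ((k : ℕ) + 1) := by
      ext i j
      rw [Matrix.sub_apply, scalar_apply, diagonal_apply, diagonal_apply]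
      simp only [cycMatrix, zero_mul, ite_self, add_zero]
      split_ifs <;> simp
    simp only [hf, eval_charpoly, this, det_diagonal]
  have h1 : f 1 = (cycMatrix m a u τ).charpoly.eval z := by simp only [hf, one_mul]
  rw [← h0, ← h1]
  by_contra hcon
  have hneg : f 0 * f 1 < 0 := lt_of_le_of_ne (by linarith)
    (mul_ne_zero (hne 0 (by simp)) (hne 1 (by simp)))
  obtain ⟨s, hs, hs0⟩ :=
    exists_mem_Ioo_eq_zero_of_mul_neg zero_le_one hcont.continuousOn hneg
  exact hne s (Ioo_subset_Icc_self hs) hs0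

/- `levelPoly` is affine in `x`, and at `x = ±1` it is a characteristic polynomial. -/
theorem levelPoly_sign (x : ℝ) (hx : x ∈ Icc (-1 : ℝ) 1) (z : ℝ)
    (hz : ∀ k : Fin m, 3 < |z - u ((k : ℕ) + 1)|) :
    0 < (levelPoly m a u x).eval z * ∏ k : Fin m, (z - u ((k : ℕ) + 1)) := by
  have hpos := h.charpoly_sign 1 (by simp) z hz
  have hneg := h.charpoly_sign (-1) (by simp) z hz
  rw [h.charpoly_cycMatrix (-1) (by norm_num)] at hneg
  simp only [levelPoly, Polynomial.eval_add, Polynomial.eval_C] at hneg ⊢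
  norm_num at hneg
  obtain ⟨hx1, hx2⟩ := hx
  rcases hx1.eq_or_lt with rfl | hx1
  · convert hneg using 2; ring
  · nlinarith

theorem far_add_of_abs_eq_four {s : ℝ} (hs : |s| = 4) (i k : Fin m) :
    3 < |u ((i : ℕ) + 1) + s - u ((k : ℕ) + 1)| := by
  by_cases hik : i = k
  · rw [hik, add_sub_cancel_left, hs]
    norm_num
  · have := abs_sub_abs_le_abs_sub (u ((i : ℕ) + 1) - u ((k : ℕ) + 1)) (-s)
    rw [abs_neg, hs, sub_neg_eq_add, sub_add_eq_add_sub] at this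
    linarith [h.sep i k hik]

theorem prod_window_ends_neg (i : Fin m) :
    (∏ k : Fin m, (u ((i : ℕ) + 1) + -4 - u ((k : ℕ) + 1))) *
      (∏ k : Fin m, (u ((i : ℕ) + 1) + 4 - u ((k : ℕ) + 1))) < 0 := by
  rw [← Finset.prod_mul_distrib, ← Finset.mul_prod_erase _ _ (Finset.mem_univ i)]
  refine mul_neg_of_neg_of_pos ?_ (Finset.prod_pos fun k hk => ?_)
  · ring_nf
    norm_num
  · have hsq : (20 : ℝ) ^ 2 ≤ (u ((i : ℕ) + 1) - u ((k : ℕ) + 1)) ^ 2 := by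
      rw [← sq_abs (u ((i : ℕ) + 1) - u ((k : ℕ) + 1))]
      gcongr
      exact h.sep i k (Finset.ne_of_mem_erase hk).symm
    nlinarith

theorem exists_level (x : ℝ) (hx : x ∈ Icc (-1 : ℝ) 1) (i : Fin m) :
    ∃ z, |z - u ((i : ℕ) + 1)| < 4 ∧ (levelPoly m a u x).eval z = 0 := by
  have hleft := h.levelPoly_sign x hx _ (h.far_add_of_abs_eq_four (s := -4) (by norm_num) i)
  have hright := h.levelPoly_sign x hx _ (h.far_add_of_abs_eq_four (s := 4) (by norm_num) i)
  have hneg : (levelPoly m a u x).eval (u ((i : ℕ) + 1) + -4) *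
      (levelPoly m a u x).eval (u ((i : ℕ) + 1) + 4) < 0 := by
    refine neg_of_mul_pos_left ?_ (h.prod_window_ends_neg i).le
    rw [mul_mul_mul_comm]
    exact mul_pos hleft hright
  obtain ⟨z, hz, hz0⟩ := exists_mem_Ioo_eq_zero_of_mul_neg (by linarith)
    (levelPoly m a u x).continuous.continuousOn hneg
  exact ⟨z, abs_lt.2 ⟨by linarith [hz.1], by linarith [hz.2]⟩, hz0⟩

theorem level_spec (x : ℝ) (hx : x ∈ Icc (-1 : ℝ) 1) (i : Fin m) :
    |level m a u i x - u ((i : ℕ) + 1)| < 4 ∧ (levelPoly m a u x).eval (level m a u i x) = 0 :=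
  Classical.epsilon_spec (p := fun z => |z - u ((i : ℕ) + 1)| < 4 ∧
    (levelPoly m a u x).eval z = 0) (h.exists_level x hx i)

theorem level_sub_far {x x' : ℝ} (hx : x ∈ Icc (-1 : ℝ) 1) (hx' : x' ∈ Icc (-1 : ℝ) 1)
    {i j : Fin m} (hij : i ≠ j) : 12 ≤ |level m a u i x - level m a u j x'| := by
  have hi := (h.level_spec x hx i).1
  have hj := (h.level_spec x' hx' j).1
  have hsep := h.sep i j hij
  rw [abs_lt] at hi hj
  rcases le_abs'.1 hsep with hlt | hgt
  · exact le_abs'.2 (Or.inl (by linarith))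
  · exact le_abs'.2 (Or.inr (by linarith))

theorem level_sub_sign {x x' : ℝ} (hx : x ∈ Icc (-1 : ℝ) 1) (hx' : x' ∈ Icc (-1 : ℝ) 1)
    {i j : Fin m} (hij : i ≠ j) :
    0 < (level m a u i x - level m a u j x') * (u ((i : ℕ) + 1) - u ((j : ℕ) + 1)) := by
  have hi := (h.level_spec x hx i).1
  have hj := (h.level_spec x' hx' j).1
  have hsep := h.sep i j hij
  rw [abs_lt] at hi hj
  rcases le_abs'.1 hsep with hlt | hgt
  · exact mul_pos_of_neg_of_neg (by linarith) (by linarith)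
  · exact mul_pos (by linarith) (by linarith)

theorem level_injective {x : ℝ} (hx : x ∈ Icc (-1 : ℝ) 1) :
    Function.Injective fun i => level m a u i x := by
  intro i j hij
  by_contra hne
  have := h.level_sub_far hx hx hne
  rw [show level m a u i x = level m a u j x from hij, sub_self, abs_zero] at this
  linarith

theorem levelPoly_eq_prod {x : ℝ} (hx : x ∈ Icc (-1 : ℝ) 1) :
    levelPoly m a u x = ∏ j, (Polynomial.X - Polynomial.C (level m a u j x)) := by
  refine Polynomial.eq_of_monic_of_dvd_of_natDegree_le
    (Polynomial.monic_prod_of_monic _ _ fun j _ => Polynomial.monic_X_sub_C _)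
    (h.levelPoly_monic x) ?_ ?_
  · refine Finset.prod_dvd_of_coprime ?_ fun j _ => ?_
    · exact (Polynomial.pairwise_coprime_X_sub_C (h.level_injective hx)).set_pairwise _
    · rw [Polynomial.dvd_iff_isRoot]
      exact (h.level_spec x hx j).2
  · rw [levelPoly_natDegree, Polynomial.natDegree_prod_of_monic _ _
      fun j _ => Polynomial.monic_X_sub_C _]
    simp

theorem roots_levelPoly {x : ℝ} (hx : x ∈ Icc (-1 : ℝ) 1) :
    (levelPoly m a u x).roots = Finset.univ.val.map fun j => level m a u j x := by
  rw [h.levelPoly_eq_prod hx, Finset.prod_eq_multiset_prod]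
  have := Polynomial.roots_multiset_prod_X_sub_C
    ((Finset.univ : Finset (Fin m)).val.map fun j => level m a u j x)
  rwa [Multiset.map_map] at this

theorem level_sub_mul_prod {x x' : ℝ} (hx : x ∈ Icc (-1 : ℝ) 1) (hx' : x' ∈ Icc (-1 : ℝ) 1)
    (i : Fin m) :
    (level m a u i x' - level m a u i x) *
      ∏ j ∈ Finset.univ.erase i, (level m a u i x' - level m a u j x) =
      2 * cycProd m a * (x' - x) := by
  rw [Finset.mul_prod_erase Finset.univ (fun j => level m a u i x' - level m a u j x)
    (Finset.mem_univ i)]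
  have hprod : (levelPoly m a u x).eval (level m a u i x') =
      ∏ j, (level m a u i x' - level m a u j x) := by
    rw [h.levelPoly_eq_prod hx, Polynomial.eval_prod]
    simp
  have hroot := (h.level_spec x' hx' i).2
  rw [← hprod]
  simp only [levelPoly, Polynomial.eval_add, Polynomial.eval_C] at hroot ⊢
  linarith

theorem abs_level_sub_le {x x' : ℝ} (hx : x ∈ Icc (-1 : ℝ) 1) (hx' : x' ∈ Icc (-1 : ℝ) 1)
    (i : Fin m) :
    |level m a u i x' - level m a u i x| ≤ 2 * cycProd m a * |x' - x| := by
  have hmul := congrArg abs (h.level_sub_mul_prod hx hx' i)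
  rw [abs_mul, abs_mul, abs_of_nonneg (mul_nonneg zero_le_two h.cycProd_nonneg),
    Finset.abs_prod] at hmul
  rw [← hmul]
  refine le_mul_of_one_le_right (abs_nonneg _) ?_
  rw [← Finset.prod_const_one (s := Finset.univ.erase i)]
  refine Finset.prod_le_prod (fun _ _ => zero_le_one) fun j hj => ?_
  linarith [h.level_sub_far hx' hx (Finset.ne_of_mem_erase hj).symm]

theorem level_sub_sign_prod {x x' : ℝ} (hx : x ∈ Icc (-1 : ℝ) 1) (hx' : x' ∈ Icc (-1 : ℝ) 1)
    (i : Fin m) :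
    0 < (∏ j ∈ Finset.univ.erase i, (level m a u i x' - level m a u j x)) *
      ∏ j ∈ Finset.univ.erase i, (u ((i : ℕ) + 1) - u ((j : ℕ) + 1)) := by
  rw [← Finset.prod_mul_distrib]
  exact Finset.prod_pos fun j hj => h.level_sub_sign hx' hx (Finset.ne_of_mem_erase hj).symm

theorem level_sub_mul_prod_nonneg {x x' : ℝ} (hx : x ∈ Icc (-1 : ℝ) 1)
    (hx' : x' ∈ Icc (-1 : ℝ) 1) (hxx' : x ≤ x') (i : Fin m) :
    0 ≤ (level m a u i x' - level m a u i x) *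
      ∏ j ∈ Finset.univ.erase i, (u ((i : ℕ) + 1) - u ((j : ℕ) + 1)) := by
  have hsign := h.level_sub_sign_prod hx hx' i
  have hdiff : 0 ≤ 2 * cycProd m a * (x' - x) :=
    mul_nonneg (mul_nonneg zero_le_two h.cycProd_nonneg) (sub_nonneg.2 hxx')
  rw [← h.level_sub_mul_prod hx hx' i] at hdiff
  refine nonneg_of_mul_nonneg_left ?_ (pow_two_pos_of_ne_zero (left_ne_zero_of_mul hsign.ne'))
  exact (mul_nonneg hdiff hsign.le).trans_eq (by ring)

theorem level_mem_uIcc {x : ℝ} (hx : x ∈ Icc (-1 : ℝ) 1) (i : Fin m) :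
    level m a u i x ∈ uIcc (level m a u i (-1)) (level m a u i 1) := by
  have hleft := h.level_sub_mul_prod_nonneg (by simp) hx hx.1 i
  have hright := h.level_sub_mul_prod_nonneg hx (by simp) hx.2 i
  rcases lt_or_gt_of_ne (right_ne_zero_of_mul (h.level_sub_sign_prod hx hx i).ne') with hR | hR
  · exact mem_uIcc.2 (Or.inr ⟨by nlinarith, by nlinarith⟩)
  · exact mem_uIcc.2 (Or.inl ⟨by nlinarith, by nlinarith⟩)

/-- The band function of the energy level near `u_{i+1}`, on the circle of quasi-momenta. -/
def levelC (i : Fin m) : C(UnitAddCircle, ℝ) :=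
  ⟨fun θ => level m a u i (circCos θ), by
    refine continuous_iff_continuousAt.2 fun θ₀ => ?_
    rw [ContinuousAt, tendsto_iff_dist_tendsto_zero]
    refine squeeze_zero (g := fun θ => 2 * cycProd m a * |circCos θ - circCos θ₀|)
      (fun _ => dist_nonneg)
      (fun θ => h.abs_level_sub_le (circCos_mem θ₀) (circCos_mem θ) i) ?_
    have hc : Continuous fun θ => 2 * cycProd m a * |circCos θ - circCos θ₀| := by fun_prop
    simpa using hc.tendsto θ₀⟩

@[simp] theorem levelC_apply (i : Fin m) (θ : UnitAddCircle) :
    h.levelC i θ = level m a u i (circCos θ) := rfl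

theorem range_levelC (i : Fin m) :
    range (h.levelC i) = uIcc (level m a u i (-1)) (level m a u i 1) := by
  refine Subset.antisymm ?_ ?_
  · rintro _ ⟨θ, rfl⟩
    exact h.level_mem_uIcc (circCos_mem θ) i
  · have hconn : IsPreconnected (range (h.levelC i)) :=
      isPreconnected_range (h.levelC i).continuous
    have hone : level m a u i 1 ∈ range (h.levelC i) :=
      ⟨circArccos 1, by rw [levelC_apply, circCos_circArccos (by simp)]⟩
    have hneg_one : level m a u i (-1) ∈ range (h.levelC i) :=
      ⟨circArccos (-1), by rw [levelC_apply, circCos_circArccos (by simp)]⟩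
    exact hconn.ordConnected.uIcc_subset hneg_one hone

theorem circCos_eq_of_level (hP : cycProd m a ≠ 0) (i : Fin m) (θ : UnitAddCircle) :
    1 + (cycMatrix m a u 1).charpoly.eval (h.levelC i θ) / (2 * cycProd m a) = circCos θ := by
  have hroot := (h.level_spec (circCos θ) (circCos_mem θ) i).2
  simp only [levelPoly, Polynomial.eval_add, Polynomial.eval_C] at hroot
  rw [levelC_apply, eq_neg_of_add_eq_zero_left hroot]
  field_simp
  ring

end SepJacobi

end Levels

/-! ### The Floquet–Bloch transform -/

section BlochVectors

open Matrix AddCircle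

theorem norm_fourier_apply (n : ℤ) (θ : UnitAddCircle) : ‖(fourier n θ : ℂ)‖ = 1 := by
  rw [fourier_apply]
  exact Circle.norm_coe _

theorem fourier_ne_zero (n : ℤ) (θ : UnitAddCircle) : (fourier n θ : ℂ) ≠ 0 :=
  norm_ne_zero_iff.1 (by rw [norm_fourier_apply]; exact one_ne_zero)

variable {m : ℕ} {a u : ℤ → ℝ}

theorem cycNext_eq_iff (i j : Fin m) : j = cycNext i ↔ i = cycPrev j := by
  have hi := i.2
  have hj := j.2
  rw [Fin.ext_iff, Fin.ext_iff, cycNext_val, cycPrev_val]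
  split_ifs <;> omega

theorem conj_cycNext_entry (ha : a m = a 0) {τ : ℂ} (hτ : ‖τ‖ = 1) (i j : Fin m) :
    (starRingEnd ℂ) (if j = cycNext i then
        (a ((i : ℕ) + 1) : ℂ) * (if (i : ℕ) + 1 = m then τ else 1) else 0) =
      if i = cycPrev j then (a (j : ℕ) : ℂ) * (if (j : ℕ) = 0 then τ⁻¹ else 1) else 0 := by
  by_cases hij : j = cycNext i
  · have hj : (j : ℕ) = _ := (congrArg Fin.val hij).trans (cycNext_val i)
    rw [if_pos hij, if_pos ((cycNext_eq_iff i j).1 hij), map_mul, Complex.conj_ofReal]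
    by_cases hi : (i : ℕ) + 1 = m
    · rw [if_pos hi] at hj
      rw [if_pos hi, if_pos hj, Complex.inv_eq_conj hτ, hj, ← Nat.cast_add_one, hi, ha,
        Nat.cast_zero]
    · rw [if_neg hi] at hj
      rw [if_neg hi, if_neg (by omega), hj, map_one, Nat.cast_add_one]
  · rw [if_neg hij, if_neg (mt (cycNext_eq_iff i j).2 hij), map_zero]

theorem isHermitian_cycMatrix (ha : a m = a 0) (u : ℤ → ℝ) {τ : ℂ} (hτ : ‖τ‖ = 1) :
    (cycMatrix m (fun n => (a n : ℂ)) (fun n => (u n : ℂ)) τ).IsHermitian := by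
  ext i j
  rw [conjTranspose_apply, RCLike.star_def]
  simp only [cycMatrix]
  rw [map_add, map_add, conj_cycNext_entry ha hτ, ← conj_cycNext_entry ha hτ i j,
    Complex.conj_conj, add_right_comm]
  congr 2
  by_cases hij : i = j
  · simp [hij]
  · simp [hij, Ne.symm hij]

theorem star_dotProduct_eq_zero_of_mulVec_eq_smul {ι : Type*} [Fintype ι] {A : Matrix ι ι ℂ}
    (hA : A.IsHermitian) {x y : ℝ} (hxy : x ≠ y) {v w : ι → ℂ} (hv : A *ᵥ v = (x : ℂ) • v)
    (hw : A *ᵥ w = (y : ℂ) • w) : star v ⬝ᵥ w = 0 := by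
  have hleft : star v ⬝ᵥ (A *ᵥ w) = (x : ℂ) * (star v ⬝ᵥ w) := by
    have hv' := congrArg star hv
    rw [star_mulVec, hA.eq, star_smul] at hv'
    rw [dotProduct_mulVec, hv', smul_dotProduct, smul_eq_mul, RCLike.star_def, Complex.conj_ofReal]
  have hright : star v ⬝ᵥ (A *ᵥ w) = (y : ℂ) * (star v ⬝ᵥ w) := by
    rw [hw, dotProduct_smul, smul_eq_mul]
  have hmul : ((x : ℂ) - y) * (star v ⬝ᵥ w) = 0 := by rw [sub_mul, ← hleft, ← hright, sub_self]
  exact (mul_eq_zero.1 hmul).resolve_left (sub_ne_zero.2 (Complex.ofReal_injective.ne hxy))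

/-- The Floquet matrix at quasi-momentum `θ`. -/
def fiber (m : ℕ) (a u : ℤ → ℝ) (θ : UnitAddCircle) : Matrix (Fin m) (Fin m) ℂ :=
  cycMatrix m (fun n => (a n : ℂ)) (fun n => (u n : ℂ)) (fourier 1 θ)

theorem continuous_fiber : Continuous (fiber m a u) := by
  have : Continuous fun θ : UnitAddCircle => (fourier 1 θ : ℂ)⁻¹ :=
    (fourier 1).continuous.inv₀ (fourier_ne_zero 1)
  refine continuous_matrix fun i j => ?_
  simp only [fiber, cycMatrix]
  refine (continuous_const.add ?_).add ?_ <;>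
  · split_ifs <;> fun_prop

namespace SepJacobi

variable (h : SepJacobi m a u)
include h

/-- The eigenvector of the Floquet matrix for the `i`-th level, as the `i`-th column of an adjugate
matrix; this choice is continuous in the quasi-momentum. -/
def blochCol (i : Fin m) (θ : UnitAddCircle) (k : Fin m) : ℂ :=
  (scalar (Fin m) ((h.levelC i θ : ℝ) : ℂ) - fiber m a u θ).adjugate k i

theorem continuous_blochCol (i k : Fin m) : Continuous fun θ => h.blochCol i θ k := by
  have hcont : Continuous fun θ =>
      scalar (Fin m) ((h.levelC i θ : ℝ) : ℂ) - fiber m a u θ := by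
    refine Continuous.sub (continuous_matrix fun i' j' => ?_) continuous_fiber
    simp only [scalar_apply, diagonal_apply]
    split_ifs <;> fun_prop
  exact hcont.matrix_adjugate.matrix_elem k i

theorem fiber_mulVec_blochCol (i : Fin m) (θ : UnitAddCircle) :
    fiber m a u θ *ᵥ h.blochCol i θ = ((h.levelC i θ : ℝ) : ℂ) • h.blochCol i θ := by
  set Q := scalar (Fin m) ((h.levelC i θ : ℝ) : ℂ) - fiber m a u θ with hQ
  have hdet : Q.det = 0 := by
    rw [hQ, fiber, h.det_complex _ _ (norm_fourier_apply 1 θ), Complex.ofReal_eq_zero]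
    exact (h.level_spec (circCos θ) (circCos_mem θ) i).2
  have hmul : Q *ᵥ h.blochCol i θ = 0 := by
    have hadj := Q.mul_adjugate
    rw [hdet, zero_smul] at hadj
    exact funext fun k => congrFun (congrFun hadj k) i
  rw [hQ, scalar_sub_mulVec, sub_eq_zero] at hmul
  exact hmul.symm

/- A kernel vector of the matrix with the row `i` replaced by `e_i` vanishes at `i`; at the site
where it is largest, Gershgorin puts the level near another value of the potential. -/
theorem blochCol_ne_zero (i : Fin m) (θ : UnitAddCircle) : h.blochCol i θ i ≠ 0 := by
  unfold blochCol
  rw [adjugate_apply]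
  intro hdet
  obtain ⟨f, hf, hfz⟩ := exists_mulVec_eq_zero_iff.2 hdet
  obtain ⟨k, hfk, hk⟩ := exists_ne_zero_forall_norm_le hf
  have hki : k ≠ i := by
    rintro rfl
    have := congrFun hfz k
    rw [mulVec, updateRow_self, single_one_dotProduct] at this
    exact hfk this
  have hrow : (fiber m a u θ *ᵥ f) k = ((h.levelC i θ : ℝ) : ℂ) * f k := by
    have hzero : ((scalar (Fin m) ((h.levelC i θ : ℝ) : ℂ) - fiber m a u θ) *ᵥ f) k = 0 := by
      have := congrFun hfz k
      rwa [mulVec, updateRow_ne hki] at this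
    rw [scalar_sub_mulVec, Pi.sub_apply, sub_eq_zero] at hzero
    exact hzero.symm
  have hle : |level m a u i (circCos θ) - u ((k : ℕ) + 1)| ≤ 3 := by
    have := norm_sub_le_of_row (fun n => (a n : ℂ)) (fun n => (u n : ℂ)) (fourier 1 θ)
      (norm_fourier_apply 1 θ) (fun n => by simpa only [Complex.norm_real] using h.norm_add_le n)
      _ f k hk hfk hrow
    rwa [← Complex.ofReal_sub, Complex.norm_real, Real.norm_eq_abs, levelC_apply] at this
  have hnear := (h.level_spec (circCos θ) (circCos_mem θ) i).1
  have htri := abs_sub_le (u ((i : ℕ) + 1)) (level m a u i (circCos θ)) (u ((k : ℕ) + 1))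
  rw [abs_sub_comm (u _) (level _ _ _ _ _)] at htri
  linarith [h.sep i k hki.symm]

/-- The squared length of the eigenvector `blochCol`. -/
def blochNormSq (i : Fin m) (θ : UnitAddCircle) : ℝ := ∑ k, ‖h.blochCol i θ k‖ ^ 2

theorem blochNormSq_pos (i : Fin m) (θ : UnitAddCircle) : 0 < h.blochNormSq i θ :=
  Finset.sum_pos' (fun _ _ => by positivity)
    ⟨i, Finset.mem_univ i, by have := norm_pos_iff.2 (h.blochCol_ne_zero i θ); positivity⟩

/-- The component at `k` of the normalized eigenvector of the Floquet matrix for the `i`-th level,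
as a continuous function of the quasi-momentum. -/
def blochVec (i k : Fin m) : C(UnitAddCircle, ℂ) :=
  ⟨fun θ => ((Real.sqrt (h.blochNormSq i θ))⁻¹ : ℝ) * h.blochCol i θ k, by
    have hsq : Continuous fun θ => h.blochNormSq i θ := by
      unfold blochNormSq
      exact continuous_finsetSum _ fun k _ => (h.continuous_blochCol i k).norm.pow 2
    have hinv : Continuous fun θ => (Real.sqrt (h.blochNormSq i θ))⁻¹ :=
      (Real.continuous_sqrt.comp hsq).inv₀
        fun θ => (Real.sqrt_pos.2 (h.blochNormSq_pos i θ)).ne'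
    exact (Complex.continuous_ofReal.comp hinv).mul (h.continuous_blochCol i k)⟩

theorem blochVec_apply (i k : Fin m) (θ : UnitAddCircle) :
    h.blochVec i k θ = ((Real.sqrt (h.blochNormSq i θ))⁻¹ : ℝ) * h.blochCol i θ k := rfl

theorem fiber_mulVec_blochVec (i : Fin m) (θ : UnitAddCircle) :
    fiber m a u θ *ᵥ (fun k => h.blochVec i k θ) =
      ((h.levelC i θ : ℝ) : ℂ) • fun k => h.blochVec i k θ := by
  have hsmul : (fun k => h.blochVec i k θ) =
      (((Real.sqrt (h.blochNormSq i θ))⁻¹ : ℝ) : ℂ) • h.blochCol i θ := rfl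
  rw [hsmul, mulVec_smul, h.fiber_mulVec_blochCol, smul_comm]

theorem sum_norm_sq_blochVec (i : Fin m) (θ : UnitAddCircle) :
    ∑ k, ‖h.blochVec i k θ‖ ^ 2 = 1 := by
  have hnorm : ∀ k, ‖h.blochVec i k θ‖ ^ 2 =
      (h.blochNormSq i θ)⁻¹ * ‖h.blochCol i θ k‖ ^ 2 := fun k => by
    rw [blochVec_apply, norm_mul, mul_pow, Complex.norm_real, Real.norm_eq_abs, sq_abs, inv_pow,
      Real.sq_sqrt (h.blochNormSq_pos i θ).le]
  simp_rw [hnorm, ← Finset.mul_sum]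
  exact inv_mul_cancel₀ (h.blochNormSq_pos i θ).ne'

theorem sum_star_blochVec_mul (i j : Fin m) :
    ∑ k, star (h.blochVec i k) * h.blochVec j k = if i = j then 1 else 0 := by
  ext θ
  rw [ContinuousMap.sum_apply]
  split_ifs with hij
  · subst hij
    simp only [ContinuousMap.mul_apply, ContinuousMap.star_apply, RCLike.star_def,
      Complex.conj_mul', ContinuousMap.one_apply]
    exact_mod_cast h.sum_norm_sq_blochVec i θ
  · exact star_dotProduct_eq_zero_of_mulVec_eq_smul
      (isHermitian_cycMatrix h.a_m u (norm_fourier_apply 1 θ))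
      (fun hlevel => hij (h.level_injective (circCos_mem θ) hlevel))
      (h.fiber_mulVec_blochVec i θ) (h.fiber_mulVec_blochVec j θ)

end SepJacobi

end BlochVectors

section Gluing

variable {κ ι ι' : Type}

theorem memℓp_two_iff {f : ι → ℂ} :
    Memℓp (E := fun _ => ℂ) f 2 ↔ Summable fun i => ‖f i‖ ^ 2 := by
  simpa only [ENNReal.toReal_ofNat, Real.rpow_ofNat] using
    memℓp_gen_iff (E := fun _ => ℂ) (p := 2) (f := f) (by norm_num)

variable [Fintype κ]

/-- The element of `ℓ²(ι')` put together from its restrictions to the pieces of a partition of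
`ι'` into finitely many copies of `ι`. -/
def glue (e : κ × ι ≃ ι') : (κ → Ell2 ι) →ₗ[ℂ] Ell2 ι' where
  toFun X := ⟨fun n => X (e.symm n).1 (e.symm n).2, memℓp_two_iff.2 <| by
    rw [← e.summable_iff]
    simp only [Function.comp_def, Equiv.symm_apply_apply]
    exact (summable_prod_of_nonneg fun _ => by positivity).2
      ⟨fun k => memℓp_two_iff.1 (lp.memℓp (X k)), Summable.of_finite⟩⟩
  map_add' _ _ := rfl
  map_smul' _ _ := rfl

theorem glue_apply (e : κ × ι ≃ ι') (X : κ → Ell2 ι) (n : ι') :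
    glue e X n = X (e.symm n).1 (e.symm n).2 := rfl

theorem inner_glue (e : κ × ι ≃ ι') (X Y : κ → Ell2 ι) :
    inner ℂ (glue e X) (glue e Y) = ∑ k, inner ℂ (X k) (Y k) := by
  have hsum := e.hasSum_iff.2 (lp.hasSum_inner (𝕜 := ℂ) (glue e X) (glue e Y))
  simp only [Function.comp_def, glue_apply, Equiv.symm_apply_apply] at hsum
  rw [← hsum.tsum_eq, hsum.summable.tsum_prod, tsum_fintype]
  exact Finset.sum_congr rfl fun k _ => (lp.inner_eq_tsum (X k) (Y k)).symm

theorem glue_surjective (e : κ × ι ≃ ι') : Function.Surjective (glue e) := fun y =>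
  ⟨fun k => ⟨fun i => y (e (k, i)), memℓp_two_iff.2 <|
      (memℓp_two_iff.1 (lp.memℓp y)).comp_injective
        (e.injective.comp (Prod.mk_right_injective k))⟩, by
    ext n
    exact congrArg y (e.apply_symm_apply n)⟩

variable {I H H' : Type*} [NormedAddCommGroup H] [InnerProductSpace ℂ H] [NormedAddCommGroup H']
  [InnerProductSpace ℂ H']

/-- An array of operators `H → H'` is unitary if it is the block matrix, with block rows indexed
by `κ` and block columns by `I`, of a unitary operator from `H^I` onto `H'^κ`. -/
structure IsUnitaryArray [DecidableEq I] [Fintype I] (W : I → κ → H →ₗ[ℂ] H') : Prop where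
  sum_inner : ∀ i j f g, ∑ k, inner ℂ (W i k f) (W j k g) = if i = j then inner ℂ f g else 0
  surjective : ∀ X : κ → H', ∃ f : I → H, ∀ k, X k = ∑ i, W i k (f i)

variable [DecidableEq I] [Fintype I]

theorem sum_mul_star_eq_ite {A : Type*} [CommRing A] [StarRing A] [DecidableEq κ]
    (hcard : Fintype.card I = Fintype.card κ) {w : I → κ → A}
    (hw : ∀ i j, ∑ k, star (w i k) * w j k = if i = j then 1 else 0) (k l : κ) :
    ∑ i, w i k * star (w i l) = if k = l then 1 else 0 := by
  let B : Matrix κ I A := Matrix.of fun k i => w i k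
  have hrow : B.conjTranspose * B = 1 := by
    ext i j
    rw [Matrix.mul_apply, Matrix.one_apply, ← hw i j]
    rfl
  have hcol := (Matrix.mul_eq_one_comm_of_card_eq _ _ _ hcard).1 hrow
  have hentry := congrFun (congrFun hcol k) l
  rwa [Matrix.mul_apply, Matrix.one_apply] at hentry

theorem isUnitaryArray_of_unitary_matrix {A : Type*} [CommRing A] [StarRing A] [Algebra ℂ A]
    (ρ : A →ₐ[ℂ] H →L[ℂ] H) (hρ : ∀ w f g, inner ℂ (ρ w f) g = inner ℂ f (ρ (star w) g))
    (hcard : Fintype.card I = Fintype.card κ) {w : I → κ → A}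
    (hw : ∀ i j, ∑ k, star (w i k) * w j k = if i = j then 1 else 0)
    (U : I → H ≃ₗᵢ[ℂ] H) (R : H ≃ₗᵢ[ℂ] H') :
    IsUnitaryArray fun i k =>
      R.toLinearEquiv.toLinearMap ∘ₗ (ρ (w i k)).toLinearMap ∘ₗ
        (U i).toLinearEquiv.toLinearMap where
  sum_inner i j f g := by
    have hterm : ∀ k, inner ℂ (R (ρ (w i k) (U i f))) (R (ρ (w j k) (U j g))) =
        inner ℂ (U i f) (ρ (star (w i k) * w j k) (U j g)) := fun k => by
      rw [LinearIsometryEquiv.inner_map_map, hρ, map_mul, mul_apply_eq_comp]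
    refine (Finset.sum_congr rfl fun k _ => hterm k).trans ?_
    rw [← inner_sum, ← sum_apply, ← map_sum, hw]
    split_ifs with hij
    · rw [hij, map_one, one_apply_eq_self, LinearIsometryEquiv.inner_map_map]
    · rw [map_zero, zero_apply, inner_zero_right]
  surjective X := by
    classical
    have hcol := sum_mul_star_eq_ite hcard hw
    refine ⟨fun i => (U i).symm (∑ l, ρ (star (w i l)) (R.symm (X l))), fun k => ?_⟩
    have hterm : ∀ i, R (ρ (w i k) (U i ((U i).symm (∑ l, ρ (star (w i l)) (R.symm (X l)))))) =
        ∑ l, R (ρ (w i k * star (w i l)) (R.symm (X l))) := fun i => by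
      simp only [LinearIsometryEquiv.apply_symm_apply, map_sum, map_mul,
        mul_apply_eq_comp]
    refine Eq.trans ?_ (Finset.sum_congr rfl fun i _ => (hterm i).symm)
    rw [Finset.sum_comm]
    simp only [← map_sum, ← sum_apply, hcol]
    rw [Finset.sum_eq_single_of_mem k (Finset.mem_univ k) fun l _ hl => by simp [hl.symm]]
    simp

namespace IsUnitaryArray

variable {W : I → κ → H →ₗ[ℂ] Ell2 ι} (hW : IsUnitaryArray W) (e : κ × ι ≃ ι')

/-- The restriction of a unitary array to its `i`-th block column, followed by gluing. -/
def embed (i : I) : H →ₗᵢ[ℂ] Ell2 ι' :=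
  ((glue e).comp (LinearMap.pi (W i))).isometryOfInner fun f g =>
    (inner_glue e _ _).trans ((hW.sum_inner i i f g).trans (if_pos rfl))

theorem embed_apply (i : I) (f : H) (k : κ) (x : ι) :
    hW.embed e i f (e (k, x)) = W i k f x := by
  change W i (e.symm (e (k, x))).1 f (e.symm (e (k, x))).2 = _
  rw [Equiv.symm_apply_apply]

theorem orthogonalFamily_embed : OrthogonalFamily ℂ (fun _ => H) (hW.embed e) :=
  fun i j hij f g =>
    (inner_glue e _ _).trans ((hW.sum_inner i j f g).trans (if_neg hij))

theorem exists_eq_sum_embed (y : Ell2 ι') : ∃ f : I → H, y = ∑ i, hW.embed e i (f i) := by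
  obtain ⟨X, rfl⟩ := glue_surjective e y
  obtain ⟨f, hf⟩ := hW.surjective X
  refine ⟨f, ?_⟩
  have hX : X = ∑ i, LinearMap.pi (W i) (f i) := by
    funext k
    simp only [Finset.sum_apply, LinearMap.pi_apply, hf]
  rw [hX, map_sum]
  rfl

end IsUnitaryArray

end Gluing

section BlochTransform

open AddCircle

theorem inner_mulLp_left {X : Type*} [TopologicalSpace X] [CompactSpace X] [MeasurableSpace X]
    [BorelSpace X] [SecondCountableTopologyEither X ℂ] {μ : Measure X} [IsFiniteMeasure μ]
    (w : C(X, ℂ)) (f g : Lp ℂ 2 μ) :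
    inner ℂ (mulLp μ w f) g = inner ℂ f (mulLp μ (star w) g) := by
  rw [← inner_conj_symm, inner_mulLp, inner_mulLp, ← integral_conj]
  simp only [map_mul, inner_conj_symm, ContinuousMap.star_apply, RCLike.star_def]

/-- The functional `w ↦ ∫ w f`, as a zeroth Fourier coefficient. -/
def fourierCoeffZeroMul (f : CircL2) : C(UnitAddCircle, ℂ) →ₗ[ℂ] ℂ where
  toFun w := fourierBasis.repr (mulLp haarAddCircle w f) 0
  map_add' w w' := by
    rw [map_add, add_apply, map_add, lp.coeFn_add, Pi.add_apply]
  map_smul' c w := by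
    rw [map_smul, smul_apply, map_smul, lp.coeFn_smul, Pi.smul_apply, RingHom.id_apply]

theorem fourierCoeffZeroMul_mul (f : CircL2) (w w' : C(UnitAddCircle, ℂ)) :
    fourierCoeffZeroMul f (w * w') = fourierCoeffZeroMul (mulLp haarAddCircle w' f) w :=
  congrArg (fun g => fourierBasis.repr g 0) (by rw [map_mul, mul_apply_eq_comp])

theorem fourierCoeffZeroMul_fourier_mul (f : CircL2) (q : ℤ) (w : C(UnitAddCircle, ℂ)) :
    fourierCoeffZeroMul f (fourier q * w) = fourierBasis.repr (mulLp haarAddCircle w f) (-q) := by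
  refine (fourierBasis_repr _ _).trans (Eq.trans ?_ (fourierBasis_repr _ _).symm)
  refine integral_congr_ae ?_
  filter_upwards [coeFn_mulLp (fourier q * w) f, coeFn_mulLp w f] with θ hleft hright
  rw [hleft, hright]
  simp [mul_assoc]

variable (m : ℕ) [NeZero m]

/-- The sites of `ℤ` by their residue and their period: `(k, q)` stands for `q m + k + 1`, in
accordance with the indexing of the Floquet matrix. -/
def siteEquiv : Fin m × ℤ ≃ ℤ :=
  ((Equiv.prodComm _ _).trans (Int.divModEquiv m).symm).trans (Equiv.addRight 1)

theorem siteEquiv_apply (k : Fin m) (q : ℤ) : siteEquiv m (k, q) = q * m + (k : ℕ) + 1 := rfl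

theorem siteEquiv_add_one (k : Fin m) (q : ℤ) :
    siteEquiv m (k, q) + 1 = siteEquiv m (cycNext k, if (k : ℕ) + 1 = m then q + 1 else q) := by
  rw [siteEquiv_apply, siteEquiv_apply, cycNext_val]
  split_ifs with h
  · have : (m : ℤ) = (k : ℕ) + 1 := by omega
    rw [this, Nat.cast_zero]
    ring
  · rw [Nat.cast_add_one, add_assoc (q * (m : ℤ))]

theorem siteEquiv_sub_one (k : Fin m) (q : ℤ) :
    siteEquiv m (k, q) - 1 = siteEquiv m (cycPrev k, if (k : ℕ) = 0 then q - 1 else q) := by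
  have hk := k.2
  rw [siteEquiv_apply, siteEquiv_apply, cycPrev_val]
  split_ifs with h
  · rw [h, Nat.cast_sub (by omega), Nat.cast_zero, Nat.cast_one]
    ring
  · rw [Nat.cast_sub (by omega), Nat.cast_one]
    ring

variable {m} {a u : ℤ → ℝ}

namespace SepJacobi

variable (h : SepJacobi m a u)

include h in
omit [NeZero m] in
theorem isUnitaryArray_bloch : IsUnitaryArray fun i k =>
    (fourierBasis (T := (1 : ℝ))).repr.toLinearEquiv.toLinearMap ∘ₗ
      (mulLp haarAddCircle (h.blochVec i k)).toLinearMap ∘ₗ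
        (LinearIsometryEquiv.refl ℂ CircL2).toLinearEquiv.toLinearMap :=
  isUnitaryArray_of_unitary_matrix (mulLp haarAddCircle) inner_mulLp_left rfl
    h.sum_star_blochVec_mul (fun _ => .refl ℂ CircL2) fourierBasis.repr

/-- The Bloch embedding of the `i`-th band: on the residue class of `k`, the sequence of Fourier
coefficients of `f` times the `k`-th component of the `i`-th Bloch vector. -/
def blochEmbed (i : Fin m) : CircL2 →ₗᵢ[ℂ] Ell2 ℤ :=
  h.isUnitaryArray_bloch.embed (((Equiv.refl _).prodCongr (Equiv.neg ℤ)).trans (siteEquiv m)) i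

/-- The value at the site `n` of the Bloch wave of the `i`-th band, as a function of the
quasi-momentum. -/
def blochWave (i : Fin m) (n : ℤ) : C(UnitAddCircle, ℂ) :=
  fourier ((siteEquiv m).symm n).2 * h.blochVec i ((siteEquiv m).symm n).1

theorem blochWave_site (i k : Fin m) (q : ℤ) :
    h.blochWave i (siteEquiv m (k, q)) = fourier q * h.blochVec i k := by
  rw [blochWave, Equiv.symm_apply_apply]

theorem blochEmbed_apply (i : Fin m) (f : CircL2) (n : ℤ) :
    h.blochEmbed i f n = fourierCoeffZeroMul f (h.blochWave i n) := by
  obtain ⟨⟨k, q⟩, rfl⟩ :=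
    (((Equiv.refl _).prodCongr (Equiv.neg ℤ)).trans (siteEquiv m)).surjective n
  have hwave := h.blochWave_site i k (-q)
  refine (h.isUnitaryArray_bloch.embed_apply _ i f k q).trans ?_
  refine Eq.trans ?_ (congrArg (fourierCoeffZeroMul f) hwave).symm
  rw [fourierCoeffZeroMul_fourier_mul, neg_neg]
  rfl

theorem blochWave_eq (i : Fin m) (n : ℤ) :
    (a (n - 1) : ℂ) • h.blochWave i (n - 1) + (a n : ℂ) • h.blochWave i (n + 1) +
      (u n : ℂ) • h.blochWave i n = h.blochWave i n * complexify (h.levelC i) := by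
  obtain ⟨⟨k, q⟩, rfl⟩ := (siteEquiv m).surjective n
  ext θ
  have hnext : (fourier (if (k : ℕ) + 1 = m then q + 1 else q) θ : ℂ) =
      fourier q θ * (if (k : ℕ) + 1 = m then fourier 1 θ else 1) := by
    split_ifs
    · exact fourier_add
    · rw [mul_one]
  have hprev : (fourier (if (k : ℕ) = 0 then q - 1 else q) θ : ℂ) =
      fourier q θ * (if (k : ℕ) = 0 then (fourier 1 θ)⁻¹ else 1) := by
    split_ifs
    · rw [eq_mul_inv_iff_mul_eq₀ (fourier_ne_zero 1 θ), ← fourier_add, sub_add_cancel]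
    · rw [mul_one]
  have hsite : siteEquiv m (k, q) = ((k : ℕ) + 1 : ℤ) + q * m := by rw [siteEquiv_apply]; ring
  have hsite' : siteEquiv m (k, q) - 1 = ((k : ℕ) : ℤ) + q * m := by rw [siteEquiv_apply]; ring
  have ha : a (siteEquiv m (k, q)) = a ((k : ℕ) + 1) := hsite ▸ h.a_per.int_mul q _
  have ha' : a (siteEquiv m (k, q) - 1) = a (k : ℕ) := hsite' ▸ h.a_per.int_mul q _
  have hu : u (siteEquiv m (k, q)) = u ((k : ℕ) + 1) := hsite ▸ h.u_per.int_mul q _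
  have heigen := congrFun (h.fiber_mulVec_blochVec i θ) k
  rw [fiber, cycMatrix_mulVec, Pi.smul_apply, smul_eq_mul] at heigen
  rw [ha, ha', hu, siteEquiv_add_one, siteEquiv_sub_one, blochWave_site, blochWave_site,
    blochWave_site]
  simp only [ContinuousMap.add_apply, ContinuousMap.smul_apply, ContinuousMap.mul_apply,
    smul_eq_mul, complexify_apply, hnext, hprev]
  linear_combination (fourier q θ : ℂ) * heigen

/-- The Floquet–Bloch diagonalization of a periodic Jacobi operator. -/
def diagModel (T : Ell2 ℤ →L[ℂ] Ell2 ℤ)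
    (hT : ∀ y n, T y n = (a (n - 1) : ℂ) * y (n - 1) + (a n : ℂ) * y (n + 1) +
      (u n : ℂ) * y n) : DiagModel T (haarAddCircle : Measure UnitAddCircle) (Fin m) where
  symbol := h.levelC
  embed := h.blochEmbed
  orthogonal := h.isUnitaryArray_bloch.orthogonalFamily_embed _
  intertwine i f := by
    ext n
    rw [hT, blochEmbed_apply, blochEmbed_apply, blochEmbed_apply, blochEmbed_apply,
      ← fourierCoeffZeroMul_mul, ← h.blochWave_eq i n]
    simp only [map_add, map_smul, smul_eq_mul]
  complete := h.isUnitaryArray_bloch.exists_eq_sum_embed _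

end SepJacobi

end BlochTransform

/-! ### The angular Fourier transform of the nanotube -/

/-- Multiplication by a phase factor at each site. -/
def modulate {ι : Type} (w : ι → Circle) : Ell2 ι ≃ₗᵢ[ℂ] Ell2 ι where
  toFun := weighted (fun i => w i) (Equiv.refl ι) ⟨1, fun i => (Circle.norm_coe _).le⟩
  invFun := weighted (fun i => (w i)⁻¹) (Equiv.refl ι)
    ⟨1, fun i => by rw [norm_inv, Circle.norm_coe, inv_one]⟩
  map_add' := map_add _
  map_smul' := map_smul _
  left_inv y := by
    ext i
    rw [weighted_apply, weighted_apply]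
    exact inv_mul_cancel_left₀ (Circle.coe_ne_zero _) _
  right_inv y := by
    ext i
    rw [weighted_apply, weighted_apply]
    exact mul_inv_cancel_left₀ (Circle.coe_ne_zero _) _
  norm_map' y := by
    have hnorm : ∀ i, ‖weighted (fun i => (w i : ℂ)) (Equiv.refl ι)
        ⟨1, fun i => (Circle.norm_coe _).le⟩ y i‖ = ‖y i‖ := fun i => by
      rw [weighted_apply, norm_mul, Circle.norm_coe, one_mul, Equiv.refl_apply]
    refine (lp.norm_eq_tsum_rpow (by simp) _).trans ?_
    rw [lp.norm_eq_tsum_rpow (by simp) y]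
    exact congrArg (· ^ _) (tsum_congr fun i => congrArg (· ^ _) (hnorm i))

theorem modulate_apply {ι : Type} (w : ι → Circle) (y : Ell2 ι) (i : ι) :
    modulate w y i = w i * y i := rfl

section AngularTransform

variable (N : ℕ)

section Character

variable [NeZero N]

/-- The character `l ↦ exp (-2πikl/N)` of `ℤ/N`. -/
def tubeChar (k : ℕ) (l : ZMod N) : ℂ := ZMod.stdAddChar (-(k : ZMod N) * l)

theorem tubeChar_add (k : ℕ) (l l' : ZMod N) :
    tubeChar N k (l + l') = tubeChar N k l * tubeChar N k l' := by
  rw [tubeChar, mul_add, AddChar.map_add_eq_mul]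
  rfl

theorem sum_stdAddChar_mul (x : ZMod N) :
    ∑ l : ZMod N, (ZMod.stdAddChar (l * x) : ℂ) = if x = 0 then (N : ℂ) else 0 := by
  rw [AddChar.sum_mulShift x (ZMod.isPrimitive_stdAddChar N), ZMod.card, Nat.cast_ite,
    Nat.cast_zero]

omit [NeZero N] in
theorem natCast_zmod_injOn_Icc : InjOn (fun k : ℕ => (k : ZMod N)) (Finset.Icc 1 N) := by
  intro k hk k' hk' hmod
  rw [Finset.coe_Icc, Set.mem_Icc] at hk hk'
  refine ((ZMod.natCast_eq_natCast_iff k k' N).1 hmod).eq_of_abs_lt (abs_sub_lt_iff.2 ?_)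
  omega

theorem sum_star_tubeChar_mul (k k' : Finset.Icc 1 N) :
    ∑ l, star (tubeChar N k l) * tubeChar N k' l = if k = k' then (N : ℂ) else 0 := by
  have hterm : ∀ l, star (tubeChar N k l) * tubeChar N k' l =
      ZMod.stdAddChar (l * (((k : ℕ) : ZMod N) - ((k' : ℕ) : ZMod N))) := fun l => by
    rw [tubeChar, tubeChar, RCLike.star_def, ← AddChar.map_neg_eq_conj, ← AddChar.map_add_eq_mul]
    congr 1
    ring
  simp_rw [hterm, sum_stdAddChar_mul, sub_eq_zero]
  exact if_congr ⟨fun hkk' => Subtype.ext (natCast_zmod_injOn_Icc N k.2 k'.2 hkk'),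
    fun hkk' => by rw [hkk']⟩ rfl rfl

/-- The unitary matrix of the Fourier transform of `ℤ/N`. -/
def tubeCoeff (k : ℕ) (l : ZMod N) : ℂ := ((√N)⁻¹ : ℝ) * tubeChar N k l

theorem sum_star_tubeCoeff_mul (k k' : Finset.Icc 1 N) :
    ∑ l, star (tubeCoeff N k l) * tubeCoeff N k' l = if k = k' then 1 else 0 := by
  have hN : (((√N)⁻¹ : ℝ) : ℂ) * (((√N)⁻¹ : ℝ) : ℂ) = (N : ℂ)⁻¹ := by
    rw [← Complex.ofReal_mul, ← mul_inv, Real.mul_self_sqrt (Nat.cast_nonneg _),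
      Complex.ofReal_inv, Complex.ofReal_natCast]
  have hterm : ∀ l, star (tubeCoeff N k l) * tubeCoeff N k' l =
      (N : ℂ)⁻¹ * (star (tubeChar N k l) * tubeChar N k' l) := fun l => by
    simp only [tubeCoeff, star_mul', RCLike.star_def, Complex.conj_ofReal, ← hN]
    ring
  simp_rw [hterm, ← Finset.mul_sum, sum_star_tubeChar_mul, mul_ite, mul_zero,
    inv_mul_cancel₀ (Nat.cast_ne_zero.2 (NeZero.ne N) : (N : ℂ) ≠ 0)]

end Character

variable (b : ℝ)

/-- The phase gained by the `k`-th channel over one period of the tube. The sign makes the hopping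
amplitude `2 c_k` of the `k`-th angular Fourier mode nonnegative. -/
def tubePhase (k : ℕ) : Circle :=
  (if 0 ≤ cCoef N b k then 1 else -1) * Circle.exp (Real.pi * k / N)

theorem tubePhase_sq (k : ℕ) : tubePhase N b k ^ 2 = Circle.exp (2 * Real.pi * k / N) := by
  have hsign : (if 0 ≤ cCoef N b k then 1 else -1 : Circle) ^ 2 = 1 := by
    split_ifs
    · rw [one_pow]
    · rw [neg_one_sq]
  rw [tubePhase, mul_pow, hsign, one_mul, ← Circle.exp_natCast_mul]
  congr 1
  push_cast
  ring

theorem two_mul_abs_cCoef (k : ℕ) : ((2 * |cCoef N b k| : ℝ) : ℂ) =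
    Complex.exp (-(Complex.I * b)) * (tubePhase N b k : ℂ)⁻¹ +
      Complex.exp (Complex.I * b) * tubePhase N b k := by
  have hcos : ((2 * cCoef N b k : ℝ) : ℂ) =
      Complex.exp (-(Complex.I * b)) * (Circle.exp (Real.pi * k / N) : ℂ)⁻¹ +
        Complex.exp (Complex.I * b) * Circle.exp (Real.pi * k / N) := by
    rw [Circle.coe_exp, ← Complex.exp_neg, ← Complex.exp_add, ← Complex.exp_add, cCoef,
      Complex.ofReal_mul, Complex.ofReal_cos, Complex.ofReal_ofNat, Complex.two_cos, add_comm]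
    congr 2 <;>
    · push_cast
      ring
  rw [tubePhase]
  split_ifs with hsign
  · rw [abs_of_nonneg hsign, one_mul, hcos]
  · rw [abs_of_neg (not_le.1 hsign), mul_neg, Complex.ofReal_neg, hcos, neg_one_mul,
      Circle.coe_neg, inv_neg]
    ring

variable [NeZero N]

theorem tubeChar_neg_one (k : ℕ) : tubeChar N k (-1) = (tubePhase N b k : ℂ) ^ 2 := by
  have hchar := ZMod.stdAddChar_coe (N := N) (k : ℤ)
  rw [Int.cast_natCast] at hchar
  rw [tubeChar, neg_mul_neg, mul_one, hchar, ← Circle.coe_pow, tubePhase_sq, Circle.coe_exp]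
  congr 1
  push_cast
  ring

/-- The vertices of the tube by their angular position and their site on the line. -/
def tubeEquiv : ZMod N × ℤ ≃ Vertex N where
  toFun x := (((siteEquiv 2).symm x.2).2, ((siteEquiv 2).symm x.2).1, x.1)
  invFun ω := (ω.2.2, siteEquiv 2 (ω.2.1, ω.1))
  left_inv x := by simp
  right_inv ω := by simp

omit [NeZero N] in
theorem tubeEquiv_siteEquiv (l : ZMod N) (j : Fin 2) (n : ℤ) :
    tubeEquiv N (l, siteEquiv 2 (j, n)) = (n, j, l) := by
  rw [tubeEquiv, Equiv.coe_fn_mk, Equiv.symm_apply_apply]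

theorem isUnitaryArray_tube : IsUnitaryArray fun (k : Finset.Icc 1 N) (l : ZMod N) =>
    (LinearIsometryEquiv.refl ℂ (Ell2 ℤ)).toLinearEquiv.toLinearMap ∘ₗ
      (Algebra.ofId ℂ (Ell2 ℤ →L[ℂ] Ell2 ℤ) (tubeCoeff N k l)).toLinearMap ∘ₗ
        (modulate fun i => tubePhase N b k ^ ((siteEquiv 2).symm i).2).toLinearEquiv.toLinearMap :=
  isUnitaryArray_of_unitary_matrix (Algebra.ofId ℂ _)
    (fun w f g => by
      simp only [Algebra.ofId_apply, Algebra.algebraMap_eq_smul_one, smul_apply, one_apply_eq_self,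
        inner_smul_left, inner_smul_right, RCLike.star_def])
    (by simp [ZMod.card]) (sum_star_tubeCoeff_mul N) _ (.refl ℂ _)

/-- The embedding of the `k`-th channel into `ℓ²` of the tube. -/
def tubeEmbed (k : Finset.Icc 1 N) : Ell2 ℤ →ₗᵢ[ℂ] Ell2 (Vertex N) :=
  (isUnitaryArray_tube N b).embed (tubeEquiv N) k

/-- The amplitude of the embedding of the `k`-th channel. -/
def tubeWeight (k : ℕ) (n : ℤ) (l : ZMod N) : ℂ := tubeCoeff N k l * tubePhase N b k ^ n

theorem tubeEmbed_apply (k : Finset.Icc 1 N) (y : Ell2 ℤ) (n : ℤ) (j : Fin 2) (l : ZMod N) :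
    tubeEmbed N b k y (n, j, l) = tubeWeight N b k n l * y (n * 2 + (j : ℕ) + 1) := by
  have hembed := (isUnitaryArray_tube N b).embed_apply (tubeEquiv N) k y l (siteEquiv 2 (j, n))
  rw [tubeEquiv_siteEquiv] at hembed
  refine hembed.trans ?_
  change (algebraMap ℂ (Ell2 ℤ →L[ℂ] Ell2 ℤ) (tubeCoeff N k l)
    (modulate (fun i => tubePhase N b k ^ ((siteEquiv 2).symm i).2) y)) (siteEquiv 2 (j, n)) = _
  rw [Algebra.algebraMap_eq_smul_one, smul_apply, one_apply_eq_self, lp.coeFn_smul, Pi.smul_apply,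
    modulate_apply, Equiv.symm_apply_apply, Circle.coe_zpow, smul_eq_mul, tubeWeight, mul_assoc,
    siteEquiv_apply]
  rfl

theorem tubeWeight_add (k : ℕ) (n d : ℤ) (l : ZMod N) :
    tubeWeight N b k (n + d) l = tubePhase N b k ^ d * tubeWeight N b k n l := by
  rw [tubeWeight, tubeWeight, zpow_add₀ (Circle.coe_ne_zero _)]
  ring

theorem tubeWeight_sub_one (k : ℕ) (n : ℤ) (l : ZMod N) :
    tubeWeight N b k n (l - 1) = tubePhase N b k ^ 2 * tubeWeight N b k n l := by
  rw [tubeWeight, tubeWeight, tubeCoeff, tubeCoeff, sub_eq_add_neg, tubeChar_add,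
    tubeChar_neg_one N b]
  ring

theorem tubeWeight_hop_left (k : ℕ) (n : ℤ) (l : ZMod N) :
    Complex.exp (-(Complex.I * b)) * tubeWeight N b k (n - 1) l +
        Complex.exp (Complex.I * b) * tubeWeight N b k (n - 1) (l - 1) =
      ((2 * |cCoef N b k| : ℝ) : ℂ) * tubeWeight N b k n l := by
  have hκ := (tubePhase N b k).coe_ne_zero
  rw [tubeWeight_sub_one, sub_eq_add_neg, tubeWeight_add, zpow_neg_one, two_mul_abs_cCoef]
  field_simp

theorem tubeWeight_hop_right (k : ℕ) (n : ℤ) (l : ZMod N) :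
    Complex.exp (-(Complex.I * b)) * tubeWeight N b k (n + 1) (l + 1) +
        Complex.exp (Complex.I * b) * tubeWeight N b k (n + 1) l =
      ((2 * |cCoef N b k| : ℝ) : ℂ) * tubeWeight N b k n l := by
  have hκ := (tubePhase N b k).coe_ne_zero
  have hl := tubeWeight_sub_one N b k n (l + 1)
  rw [add_sub_cancel_right] at hl
  rw [tubeWeight_add, tubeWeight_add, zpow_one, hl, two_mul_abs_cCoef]
  field_simp

theorem aCoef_two_mul (N : ℕ) (b : ℝ) (k : ℕ) (n : ℤ) : aCoef N b k (n * 2) = 2 * |cCoef N b k| :=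
  if_pos (even_two.mul_left n)

theorem aCoef_two_mul_add_one (N : ℕ) (b : ℝ) (k : ℕ) (n : ℤ) : aCoef N b k (n * 2 + 1) = 1 :=
  if_neg (Int.not_even_iff_odd.2 ((even_two.mul_left n).add_one))

variable (v : EllInfty) (t : ℝ)

theorem hamiltonian_tubeEmbed_zero (k : Finset.Icc 1 N) (y : Ell2 ℤ) (n : ℤ) (l : ZMod N) :
    hamiltonian N b v t (tubeEmbed N b k y) (n, 0, l) =
      tubeEmbed N b k (jacobi N b v t k y) (n, 0, l) := by
  have hprev : (n - 1) * 2 + ((1 : Fin 2) : ℕ) + 1 = n * 2 := by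
    rw [Fin.val_one]
    lia
  have hsite : n * 2 + ((0 : Fin 2) : ℕ) + 1 = n * 2 + 1 := by simp
  have hnext : n * 2 + ((1 : Fin 2) : ℕ) + 1 = n * 2 + 1 + 1 := by simp
  rw [hamiltonian_apply_zero, mul_comm 2 n]
  simp only [tubeEmbed_apply, jacobi_apply, hprev, hsite, hnext, add_sub_cancel_right,
    aCoef_two_mul, aCoef_two_mul_add_one, Complex.ofReal_one]
  linear_combination y (n * 2) * tubeWeight_hop_left N b k n l

theorem hamiltonian_tubeEmbed_one (k : Finset.Icc 1 N) (y : Ell2 ℤ) (n : ℤ) (l : ZMod N) :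
    hamiltonian N b v t (tubeEmbed N b k y) (n, 1, l) =
      tubeEmbed N b k (jacobi N b v t k y) (n, 1, l) := by
  have hprev : n * 2 + ((0 : Fin 2) : ℕ) + 1 = n * 2 + 1 := by simp
  have hsite : n * 2 + ((1 : Fin 2) : ℕ) + 1 = (n + 1) * 2 := by
    rw [Fin.val_one]
    lia
  have hnext : (n + 1) * 2 + ((0 : Fin 2) : ℕ) + 1 = (n + 1) * 2 + 1 := by simp
  have hprev' : (n + 1) * 2 - 1 = n * 2 + 1 := by lia
  have hsite' : 2 * n + 2 = (n + 1) * 2 := by lia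
  rw [hamiltonian_apply_one, hsite']
  simp only [tubeEmbed_apply, jacobi_apply, hprev, hsite, hnext, hprev', aCoef_two_mul,
    aCoef_two_mul_add_one, Complex.ofReal_one]
  linear_combination y ((n + 1) * 2 + 1) * tubeWeight_hop_right N b k n l

theorem hamiltonian_tubeEmbed (k : Finset.Icc 1 N) (y : Ell2 ℤ) :
    hamiltonian N b v t (tubeEmbed N b k y) = tubeEmbed N b k (jacobi N b v t k y) := by
  ext ⟨n, j, l⟩
  fin_cases j
  · exact hamiltonian_tubeEmbed_zero N b v t k y n l
  · exact hamiltonian_tubeEmbed_one N b v t k y n l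

/-- The diagonalization of the nanotube Hamiltonian, channel by channel. -/
def tubeModel {X : Type*} [TopologicalSpace X] [CompactSpace X] [MeasurableSpace X]
    [BorelSpace X] [SecondCountableTopologyEither X ℂ] {μ : Measure X} [IsFiniteMeasure μ]
    {I : Type*} [Fintype I] (D : ∀ k : Finset.Icc 1 N, DiagModel (jacobi N b v t k) μ I) :
    DiagModel (hamiltonian N b v t) μ (Finset.Icc 1 N × I) where
  symbol x := (D x.1).symbol x.2
  embed x := (tubeEmbed N b x.1).comp ((D x.1).embed x.2)
  intertwine x f := by
    change hamiltonian N b v t (tubeEmbed N b x.1 ((D x.1).embed x.2 f)) =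
      tubeEmbed N b x.1 ((D x.1).embed x.2 (mulLp μ (complexify ((D x.1).symbol x.2)) f))
    rw [hamiltonian_tubeEmbed, (D x.1).intertwine]
  orthogonal := by
    rintro ⟨k, i⟩ ⟨k', i'⟩ hne f g
    by_cases hk : k = k'
    · subst hk
      refine ((tubeEmbed N b k).inner_map_map _ _).trans ?_
      exact (D k).orthogonal (fun hi : i = i' => hne (by rw [hi])) f g
    · exact (isUnitaryArray_tube N b).orthogonalFamily_embed _ hk _ _
  complete w := by
    obtain ⟨y, rfl⟩ := (isUnitaryArray_tube N b).exists_eq_sum_embed (tubeEquiv N) w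
    choose f hf using fun k => (D k).complete (y k)
    refine ⟨fun x => f x.1 x.2, ?_⟩
    rw [Fintype.sum_prod_type]
    refine Finset.sum_congr rfl fun k _ => ?_
    rw [hf k, map_sum]
    rfl

end AngularTransform

/-! ### Second-order perturbation of isolated eigenvalues -/

section EigenvalueShift

open Matrix

variable {n : Type*} [Fintype n] [DecidableEq n] {M : Matrix n n ℝ} {R z Γ : ℝ} {g : n → ℝ}

theorem sub_diag_mul_eq_sum_erase (hg : M *ᵥ g = z • g) (j : n) :
    (z - M j j) * g j = ∑ l ∈ Finset.univ.erase j, M j l * g l := by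
  have hrow : ∑ l, M j l * g l = z * g j := congrFun hg j
  rw [← Finset.add_sum_erase _ _ (Finset.mem_univ j)] at hrow
  linear_combination -hrow

theorem abs_sum_mul_le_of_subset_erase (hrow : ∀ j, ∑ l ∈ Finset.univ.erase j, |M j l| ≤ R)
    {j : n} {s : Finset n} (hs : s ⊆ Finset.univ.erase j) {c : ℝ} (hc : 0 ≤ c)
    (hg : ∀ l ∈ s, |g l| ≤ c) : |∑ l ∈ s, M j l * g l| ≤ R * c :=
  calc |∑ l ∈ s, M j l * g l| ≤ ∑ l ∈ s, |M j l * g l| := Finset.abs_sum_le_sum_abs _ _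
    _ ≤ ∑ l ∈ s, |M j l| * c := Finset.sum_le_sum fun l hl => by
      rw [abs_mul]
      exact mul_le_mul_of_nonneg_left (hg l hl) (abs_nonneg _)
    _ = (∑ l ∈ s, |M j l|) * c := (Finset.sum_mul _ _ _).symm
    _ ≤ R * c := mul_le_mul_of_nonneg_right ((Finset.sum_le_sum_of_subset_of_nonneg hs
      fun _ _ _ => abs_nonneg _).trans (hrow j)) hc

theorem exists_dominant_eigenvector (hrow : ∀ j, ∑ l ∈ Finset.univ.erase j, |M j l| ≤ R) {i : n}
    (hgap : ∀ j ≠ i, 2 * R < |M i i - M j j|) (hz : |z - M i i| ≤ R)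
    (hdet : (scalar n z - M).det = 0) :
    ∃ g : n → ℝ, M *ᵥ g = z • g ∧ g i = 1 ∧ ∀ j, |g j| ≤ 1 := by
  obtain ⟨f, hf, hker⟩ := exists_mulVec_eq_zero_iff.2 hdet
  rw [scalar_sub_mulVec, sub_eq_zero] at hker
  obtain ⟨k, hk, hmax⟩ := exists_ne_zero_forall_norm_le hf
  have hzk : |z - M k k| ≤ R := by
    have hle := abs_sum_mul_le_of_subset_erase hrow (Finset.Subset.refl (Finset.univ.erase k))
      (abs_nonneg (f k)) fun l _ => hmax l
    rw [← sub_diag_mul_eq_sum_erase hker.symm, abs_mul] at hle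
    exact le_of_mul_le_mul_right hle (abs_pos.2 hk)
  have hki : k = i := by
    by_contra hne
    have htri := abs_sub_le (M i i) z (M k k)
    rw [abs_sub_comm (M i i) z] at htri
    linarith [hgap k hne]
  subst hki
  refine ⟨(f k)⁻¹ • f, ?_, inv_mul_cancel₀ hk, fun j => ?_⟩
  · rw [mulVec_smul, ← hker, smul_comm]
  · rw [Pi.smul_apply, smul_eq_mul, abs_mul, abs_inv, inv_mul_le_one₀ (abs_pos.2 hk)]
    exact hmax j

section Dominant

variable (hrow : ∀ j, ∑ l ∈ Finset.univ.erase j, |M j l| ≤ R) {i : n} (hΓ : 0 < Γ)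
  (hRΓ : 4 * R ≤ Γ) (hgap : ∀ j ≠ i, Γ ≤ |M i i - M j j|) (hz : |z - M i i| ≤ R)
  (hg : M *ᵥ g = z • g) (hgi : g i = 1)
include hrow hΓ hRΓ hgap hz hg

theorem abs_eigenvector_apply_le (hg1 : ∀ j, |g j| ≤ 1) {j : n} (hj : j ≠ i) :
    |g j| ≤ 2 * R / Γ := by
  have hprod : |z - M j j| * |g j| ≤ R := by
    rw [← abs_mul, sub_diag_mul_eq_sum_erase hg]
    simpa only [mul_one] using
      abs_sum_mul_le_of_subset_erase hrow Finset.Subset.rfl zero_le_one fun l _ => hg1 l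
  have hfar : Γ / 2 ≤ |z - M j j| := by
    have htri := abs_sub_le (M i i) z (M j j)
    rw [abs_sub_comm (M i i) z] at htri
    linarith [hgap j hj]
  rw [le_div_iff₀ hΓ]
  nlinarith [abs_nonneg (g j)]

include hgi in
theorem abs_eigenvector_apply_sub_le (hg1 : ∀ j, |g j| ≤ 1) {j : n} (hj : j ≠ i) :
    |g j - M j i / (M i i - M j j)| ≤ 4 * R ^ 2 / Γ ^ 2 := by
  have hd : M i i - M j j ≠ 0 := abs_pos.1 (hΓ.trans_le (hgap j hj))
  have hrest : |∑ l ∈ (Finset.univ.erase j).erase i, M j l * g l| ≤ R * (2 * R / Γ) := by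
    have hR : 0 ≤ R := (abs_nonneg _).trans hz
    refine abs_sum_mul_le_of_subset_erase hrow (Finset.erase_subset _ _) (by positivity)
      fun l hl => abs_eigenvector_apply_le hrow hΓ hRΓ hgap hz hg hg1 (Finset.ne_of_mem_erase hl)
  have hdrift : |(z - M i i) * g j| ≤ R * (2 * R / Γ) := by
    rw [abs_mul]
    exact mul_le_mul hz (abs_eigenvector_apply_le hrow hΓ hRΓ hgap hz hg hg1 hj) (abs_nonneg _)
      ((abs_nonneg _).trans hz)
  have heq : g j - M j i / (M i i - M j j) =
      (∑ l ∈ (Finset.univ.erase j).erase i, M j l * g l - (z - M i i) * g j) /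
        (M i i - M j j) := by
    have hj' := sub_diag_mul_eq_sum_erase hg j
    rw [← Finset.add_sum_erase _ _ (Finset.mem_erase.2 ⟨hj.symm, Finset.mem_univ i⟩), hgi] at hj'
    field_simp
    linear_combination hj'
  rw [heq, abs_div]
  calc _ ≤ (R * (2 * R / Γ) + R * (2 * R / Γ)) / Γ :=
        div_le_div₀ (by linarith [abs_nonneg ((z - M i i) * g j)])
          ((abs_sub _ _).trans (add_le_add hrest hdrift)) hΓ (hgap j hj)
    _ = 4 * R ^ 2 / Γ ^ 2 := by
      field_simp
      ring

end Dominant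

theorem abs_eigenvalue_sub_second_order_le
    (hrow : ∀ j, ∑ l ∈ Finset.univ.erase j, |M j l| ≤ R) {i : n} (hΓ : 0 < Γ) (hRΓ : 4 * R ≤ Γ)
    (hgap : ∀ j ≠ i, Γ ≤ |M i i - M j j|) (hz : |z - M i i| ≤ R)
    (hdet : (scalar n z - M).det = 0) :
    |z - M i i - ∑ l ∈ Finset.univ.erase i, M i l * (M l i / (M i i - M l l))| ≤
      4 * R ^ 3 / Γ ^ 2 := by
  obtain ⟨g, hg, hgi, hg1⟩ := exists_dominant_eigenvector hrow
    (fun j hj => by linarith [hgap j hj]) hz hdet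
  have hrowi := sub_diag_mul_eq_sum_erase hg i
  rw [hgi, mul_one] at hrowi
  rw [hrowi, ← Finset.sum_sub_distrib]
  simp only [← mul_sub]
  calc _ ≤ R * (4 * R ^ 2 / Γ ^ 2) :=
        abs_sum_mul_le_of_subset_erase hrow Finset.Subset.rfl (by positivity) fun l hl =>
          abs_eigenvector_apply_sub_le hrow hΓ hRΓ hgap hz hg hgi hg1 (Finset.ne_of_mem_erase hl)
    _ = 4 * R ^ 3 / Γ ^ 2 := by ring

end EigenvalueShift

section CyclicEntries

open Matrix

variable {m : ℕ} (a u : ℤ → ℝ) (τ : ℝ)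

theorem cycNext_ne_self (hm : 2 ≤ m) (i : Fin m) : cycNext i ≠ i := by
  have := i.2
  rw [ne_eq, Fin.ext_iff, cycNext_val]
  split_ifs <;> omega

theorem cycPrev_ne_self (hm : 2 ≤ m) (i : Fin m) : cycPrev i ≠ i := by
  have := i.2
  rw [ne_eq, Fin.ext_iff, cycPrev_val]
  split_ifs <;> omega

theorem cycPrev_ne_cycNext (hm : 3 ≤ m) (i : Fin m) : cycPrev i ≠ cycNext i := by
  have := i.2
  rw [ne_eq, Fin.ext_iff, cycPrev_val, cycNext_val]
  split_ifs <;> omega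

theorem apply_cycNext_of_periodic {β : Type*} {f : ℤ → β} (hf : Function.Periodic f (m : ℤ))
    (i : Fin m) : f (cycNext i : ℕ) = f ((i : ℕ) + 1) := by
  rw [cycNext_val]
  split_ifs with hi
  · rw [← Nat.cast_add_one, hi, Nat.cast_zero, ← hf 0, zero_add]
  · rw [Nat.cast_add_one]

theorem apply_cycNext_add_one_of_periodic {β : Type*} {f : ℤ → β}
    (hf : Function.Periodic f (m : ℤ)) (i : Fin m) :
    f ((cycNext i : ℕ) + 1) = f ((i : ℕ) + 1 + 1) :=
  apply_cycNext_of_periodic (f := fun n => f (n + 1)) (hf.add_const 1) i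

theorem apply_cycPrev_add_one_of_periodic {β : Type*} {f : ℤ → β}
    (hf : Function.Periodic f (m : ℤ)) (i : Fin m) : f ((cycPrev i : ℕ) + 1) = f (i : ℕ) := by
  rw [← apply_cycNext_of_periodic hf, ← (cycNext_eq_iff (cycPrev i) i).2 rfl]

theorem cycMatrix_apply_self (hm : 2 ≤ m) (i : Fin m) :
    cycMatrix m a u τ i i = u ((i : ℕ) + 1) := by
  rw [cycMatrix, if_pos rfl, if_neg (cycNext_ne_self hm i).symm,
    if_neg (cycPrev_ne_self hm i).symm, add_zero, add_zero]

theorem cycMatrix_apply_cycPrev (hm : 3 ≤ m) (i : Fin m) :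
    cycMatrix m a u τ i (cycPrev i) = a (i : ℕ) * (if (i : ℕ) = 0 then τ⁻¹ else 1) := by
  rw [cycMatrix, if_neg (cycPrev_ne_self (by omega) i).symm, if_neg (cycPrev_ne_cycNext hm i),
    if_pos rfl, zero_add, zero_add]

theorem cycMatrix_apply_cycNext (hm : 3 ≤ m) (i : Fin m) :
    cycMatrix m a u τ i (cycNext i) =
      a ((i : ℕ) + 1) * (if (i : ℕ) + 1 = m then τ else 1) := by
  rw [cycMatrix, if_neg (cycNext_ne_self (by omega) i).symm, if_pos rfl,
    if_neg (cycPrev_ne_cycNext hm i).symm, zero_add, add_zero]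

theorem sum_erase_cycMatrix_mul (hm : 3 ≤ m) (i : Fin m) (g : Fin m → ℝ) :
    ∑ l ∈ Finset.univ.erase i, cycMatrix m a u τ i l * g l =
      a ((i : ℕ) + 1) * (if (i : ℕ) + 1 = m then τ else 1) * g (cycNext i) +
        a (i : ℕ) * (if (i : ℕ) = 0 then τ⁻¹ else 1) * g (cycPrev i) := by
  have hrow := cycMatrix_mulVec a u τ g i
  rw [mulVec, dotProduct, ← Finset.add_sum_erase _ _ (Finset.mem_univ i),
    cycMatrix_apply_self a u τ (by omega)] at hrow
  linear_combination hrow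

end CyclicEntries

namespace SepJacobi

variable {m : ℕ} {a u : ℤ → ℝ} (h : SepJacobi m a u)
include h

theorem sum_erase_abs_cycMatrix_le {τ : ℝ} (hτ : ‖τ‖ = 1) (i : Fin m) :
    ∑ l ∈ Finset.univ.erase i, |cycMatrix m a u τ i l| ≤ 4 := by
  have hsign : ∀ x : ℝ, |(SignType.sign x : ℝ)| ≤ 1 := fun x => by
    rcases lt_trichotomy x 0 with hx | rfl | hx <;> simp [*]
  have hhop : ∀ {α s x : ℝ}, 0 ≤ α → |s| = 1 → |x| ≤ 1 → α * s * x ≤ α := fun hα hs hx =>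
    (le_abs_self _).trans (by
      rw [abs_mul, abs_mul, hs, mul_one, abs_of_nonneg hα]
      exact mul_le_of_le_one_right hα hx)
  simp only [← self_mul_sign]
  rw [sum_erase_cycMatrix_mul a u τ h.hm i fun l => (SignType.sign (cycMatrix m a u τ i l) : ℝ)]
  have hnext := hhop (h.a_nonneg ((i : ℕ) + 1)) (s := if (i : ℕ) + 1 = m then τ else 1)
    (by split_ifs; exacts [hτ, abs_one])
    (hsign (cycMatrix m a u τ i (cycNext i)))
  have hprev := hhop (h.a_nonneg (i : ℕ)) (s := if (i : ℕ) = 0 then τ⁻¹ else 1)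
    (by split_ifs; exacts [by rw [abs_inv, ← Real.norm_eq_abs, hτ, inv_one], abs_one])
    (hsign (cycMatrix m a u τ i (cycPrev i)))
  linarith [h.a_add_le (i : ℕ)]

theorem sum_erase_cycMatrix_shift {τ : ℝ} (hτ : τ ≠ 0) (i : Fin m) :
    ∑ l ∈ Finset.univ.erase i, cycMatrix m a u τ i l * (cycMatrix m a u τ l i /
        (cycMatrix m a u τ i i - cycMatrix m a u τ l l)) =
      a (i : ℕ) ^ 2 / (u ((i : ℕ) + 1) - u (i : ℕ)) +
        a ((i : ℕ) + 1) ^ 2 / (u ((i : ℕ) + 1) - u ((i : ℕ) + 1 + 1)) := by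
  have hback_next : cycMatrix m a u τ (cycNext i) i =
      a ((i : ℕ) + 1) * (if (i : ℕ) + 1 = m then τ⁻¹ else 1) := by
    have hentry := cycMatrix_apply_cycPrev a u τ h.hm (cycNext i)
    rw [← (cycNext_eq_iff i _).1 rfl, apply_cycNext_of_periodic h.a_per] at hentry
    rw [hentry, cycNext_val]
    by_cases hi : (i : ℕ) + 1 = m <;> simp [hi]
  have hback_prev : cycMatrix m a u τ (cycPrev i) i =
      a (i : ℕ) * (if (i : ℕ) = 0 then τ else 1) := by
    have hentry := cycMatrix_apply_cycNext a u τ h.hm (cycPrev i)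
    rw [← (cycNext_eq_iff _ i).2 rfl, apply_cycPrev_add_one_of_periodic h.a_per] at hentry
    have hi : (cycPrev i : ℕ) + 1 = m ↔ (i : ℕ) = 0 := by
      have := i.2
      rw [cycPrev_val]
      split_ifs <;> omega
    rw [hentry, if_congr hi rfl rfl]
  have hm : 2 ≤ m := le_trans (by norm_num) h.hm
  rw [sum_erase_cycMatrix_mul a u τ h.hm i fun l => cycMatrix m a u τ l i /
    (cycMatrix m a u τ i i - cycMatrix m a u τ l l)]
  simp only [hback_next, hback_prev, cycMatrix_apply_self a u τ hm,
    apply_cycNext_add_one_of_periodic h.u_per, apply_cycPrev_add_one_of_periodic h.u_per]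
  split_ifs <;> field_simp <;> ring

theorem abs_level_sub_shift_le (i : Fin m) {τ : ℝ} (hτ : τ = 1 ∨ τ = -1) {Γ : ℝ} (hΓ : 16 ≤ Γ)
    (hgap : ∀ j ≠ i, Γ ≤ |u ((i : ℕ) + 1) - u ((j : ℕ) + 1)|) :
    |level m a u i τ - u ((i : ℕ) + 1) -
      (a (i : ℕ) ^ 2 / (u ((i : ℕ) + 1) - u (i : ℕ)) +
        a ((i : ℕ) + 1) ^ 2 / (u ((i : ℕ) + 1) - u ((i : ℕ) + 1 + 1)))| ≤ 256 / Γ ^ 2 := by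
  have hτ0 : τ ≠ 0 := by rcases hτ with rfl | rfl <;> norm_num
  have hnorm : ‖τ‖ = 1 := by rcases hτ with rfl | rfl <;> norm_num
  have hm : 2 ≤ m := le_trans (by norm_num) h.hm
  obtain ⟨hclose, hroot⟩ := h.level_spec τ (by rcases hτ with rfl | rfl <;> simp) i
  have hchar : (cycMatrix m a u τ).charpoly = levelPoly m a u τ := by
    rw [h.charpoly_cycMatrix τ hτ0]
    congr 1
    rcases hτ with rfl | rfl <;> norm_num
  rw [← hchar, Matrix.eval_charpoly] at hroot
  rw [← h.sum_erase_cycMatrix_shift hτ0, ← cycMatrix_apply_self a u τ hm i]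
  refine (abs_eigenvalue_sub_second_order_le (Γ := Γ) (h.sum_erase_abs_cycMatrix_le hnorm)
    (by linarith) (by linarith) (fun j hj => ?_) ?_ hroot).trans_eq (by norm_num)
  · rw [cycMatrix_apply_self a u τ hm, cycMatrix_apply_self a u τ hm]
    exact hgap j hj
  · rw [cycMatrix_apply_self a u τ hm]
    exact hclose.le

end SepJacobi

/-! ### Bands at strong coupling -/

section SortedEdges

variable {ι : Type*}

theorem getD_flatMap_pair (lo hi : ι → ℝ) (l : List ι) (k : ℕ) (hk : k < l.length) :
    (l.flatMap fun i => [lo i, hi i]).getD (2 * k) 0 = lo l[k] ∧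
      (l.flatMap fun i => [lo i, hi i]).getD (2 * k + 1) 0 = hi l[k] := by
  induction l generalizing k with
  | nil => simp at hk
  | cons x l ih =>
    cases k with
    | zero => simp
    | succ k =>
      have ih := ih k (by simpa using hk)
      simpa [show 2 * (k + 1) = 2 * k + 1 + 1 by ring] using ih

theorem coe_flatMap_min_max (f g : ι → ℝ) (l : List ι) :
    ((l.flatMap fun i => [min (f i) (g i), max (f i) (g i)] : List ℝ) : Multiset ℝ) =
      (l : Multiset ι).map f + (l : Multiset ι).map g := by
  induction l with
  | nil => simp
  | cons x l ih =>
    have hpair : (([min (f x) (g x), max (f x) (g x)] : List ℝ) : Multiset ℝ) = {f x} + {g x} := by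
      rcases le_total (f x) (g x) with h | h
      · rw [min_eq_left h, max_eq_right h]; rfl
      · rw [min_eq_right h, max_eq_left h, add_comm]; rfl
    rw [List.flatMap_cons, ← Multiset.coe_add, ih, ← Multiset.cons_coe x l,
      Multiset.map_cons, Multiset.map_cons, hpair, ← Multiset.singleton_add,
      ← Multiset.singleton_add]
    abel

theorem sort_eq_flatMap_min_max (f g : ι → ℝ) (l : List ι)
    (hl : l.Pairwise fun i j => max (f i) (g i) ≤ min (f j) (g j)) :
    ((l : Multiset ι).map f + (l : Multiset ι).map g).sort (· ≤ ·) =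
      l.flatMap fun i => [min (f i) (g i), max (f i) (g i)] := by
  have hsorted :
      (l.flatMap fun i => [min (f i) (g i), max (f i) (g i)]).Pairwise (· ≤ ·) := by
    rw [List.pairwise_flatMap]
    refine ⟨fun i _ => by simp, hl.imp fun {i j} hij => ?_⟩
    have hi : min (f i) (g i) ≤ max (f i) (g i) := min_le_max
    have hj : min (f j) (g j) ≤ max (f j) (g j) := min_le_max
    simp only [List.mem_cons, List.not_mem_nil, or_false]
    rintro x (rfl | rfl) y (rfl | rfl) <;> linarith
  rw [← coe_flatMap_min_max, Multiset.coe_sort]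
  exact List.mergeSort_eq_self _ hsorted

end SortedEdges

theorem exists_pos_forall_le_abs_sub {ι : Type*} [Finite ι] {f : ι → ℝ}
    (hf : Function.Injective f) : ∃ g > 0, ∀ i j, i ≠ j → g ≤ |f i - f j| := by
  have hev : ∀ᶠ g in nhdsWithin (0 : ℝ) (Ioi 0), ∀ i j, i ≠ j → g ≤ |f i - f j| := by
    simp only [eventually_all]
    intro i j hij
    exact nhdsWithin_le_nhds (eventually_le_nhds (abs_pos.2 (sub_ne_zero.2 (hf.ne hij))))
  obtain ⟨g, hg, hg0⟩ := (hev.and self_mem_nhdsWithin).exists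
  exact ⟨g, hg0, hg⟩

theorem aCoef_nonneg (N : ℕ) (b : ℝ) (k : ℕ) (n : ℤ) : 0 ≤ aCoef N b k n := by
  unfold aCoef; split_ifs <;> positivity

theorem aCoef_add_le (N : ℕ) (b : ℝ) (k : ℕ) (n : ℤ) :
    aCoef N b k n + aCoef N b k (n + 1) ≤ 3 := by
  have : |cCoef N b k| ≤ 1 := Real.abs_cos_le_one _
  by_cases h : Even n
  · rw [aCoef, aCoef, if_pos h, if_neg (by rwa [Int.even_add_one, not_not])]; linarith
  · rw [aCoef, aCoef, if_neg h, if_pos (Int.even_add_one.2 h)]; linarith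

theorem aCoef_periodic (N p : ℕ) (b : ℝ) (k : ℕ) :
    Function.Periodic (aCoef N b k) ((2 * p : ℕ) : ℤ) := fun n => by
  simp only [aCoef, Int.even_add, Int.even_coe_nat, even_two_mul, iff_true]

theorem cycProd_aCoef (N p : ℕ) (b : ℝ) (k : ℕ) :
    cycProd (2 * p) (aCoef N b k) = |2 * cCoef N b k| ^ p := by
  rw [cycProd, Fin.prod_univ_eq_prod_range (fun i => aCoef N b k (i : ℤ)) (2 * p)]
  induction p with
  | zero => simp
  | succ p ih =>
    rw [mul_add, mul_one, Finset.prod_range_succ, Finset.prod_range_succ, ih, mul_comm 2 p]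
    push_cast
    rw [aCoef_two_mul, aCoef_two_mul_add_one, mul_one, pow_succ, abs_mul, abs_two]

theorem aCoef_congr {N : ℕ} {b : ℝ} {k k' : ℕ} (h : |cCoef N b k'| = |cCoef N b k|) :
    aCoef N b k' = aCoef N b k := by
  funext n
  simp only [aCoef, h]

/- `|c_k| = |c_k'|` means that `cos (2 (b + π k / N))` and `cos (2 (b + π k' / N))` agree. -/
theorem abs_cCoef_injOn {N : ℕ} {b : ℝ} (hb : ∀ m : ℤ, b ≠ Real.pi / (2 * N) * m) :
    Set.InjOn (fun k => |cCoef N b k|) (Finset.Icc 1 N) := by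
  intro k hk k' hk' h
  have hpi := Real.pi_pos
  rw [Finset.coe_Icc, Set.mem_Icc] at hk hk'
  have hN : (0 : ℝ) < N := by exact_mod_cast hk.1.trans hk.2
  have hcos : Real.cos (2 * (b + Real.pi * k / N)) = Real.cos (2 * (b + Real.pi * k' / N)) := by
    have hsq : cCoef N b k ^ 2 = cCoef N b k' ^ 2 := (sq_eq_sq_iff_abs_eq_abs _ _).2 h
    rw [Real.cos_two_mul, Real.cos_two_mul]
    exact congrArg (2 * · - 1) hsq
  obtain ⟨j, hj | hj⟩ := Real.cos_eq_cos_iff.1 hcos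
  · have hjR : (k' : ℝ) = j * N + k := by
      field_simp at hj
      nlinarith
    have hjZ : (k' : ℤ) = j * N + k := by exact_mod_cast hjR
    have hj0 : j = 0 := by
      by_contra hj0
      rcases lt_or_gt_of_ne hj0 with hneg | hpos
      · have : j * (N : ℤ) ≤ -1 * N := by gcongr; omega
        omega
      · have : 1 * (N : ℤ) ≤ j * N := by gcongr; omega
        omega
    rw [hj0] at hjZ
    omega
  · refine absurd ?_ (hb (j * N - k - k'))
    push_cast
    field_simp
    field_simp at hj
    nlinarith

/-- The potential `t v` of the channels at coupling `t`. -/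
def scaled (v : ℤ → ℝ) (t : ℝ) (n : ℤ) : ℝ := t * v n

namespace SepJacobi

variable {m : ℕ} {a u : ℤ → ℝ} (h : SepJacobi m a u)
include h

theorem roots_floquetMatrix {τ : ℝ} (hτ : τ = 1 ∨ τ = -1) :
    (floquetMatrix m a u τ).charpoly.roots =
      Finset.univ.val.map fun i => level m a u i τ := by
  have hmem : τ ∈ Icc (-1 : ℝ) 1 := by rcases hτ with rfl | rfl <;> simp
  have hτ0 : τ ≠ 0 := by rcases hτ with rfl | rfl <;> norm_num
  have hhalf : (τ + τ⁻¹) / 2 = τ := by rcases hτ with rfl | rfl <;> norm_num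
  rw [floquetMatrix_eq_cycMatrix (by linarith [h.hm]), h.charpoly_cycMatrix τ hτ0, hhalf,
    h.roots_levelPoly hmem]

theorem level_le_level {i j : Fin m} (hij : u ((i : ℕ) + 1) < u ((j : ℕ) + 1)) {x x' : ℝ}
    (hx : x ∈ Icc (-1 : ℝ) 1) (hx' : x' ∈ Icc (-1 : ℝ) 1) :
    level m a u i x ≤ level m a u j x' := by
  have hne : j ≠ i := by rintro rfl; exact hij.false
  have := h.level_sub_sign hx' hx hne
  exact (sub_pos.1 (pos_of_mul_pos_left this (sub_pos.2 hij).le)).le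

end SepJacobi

theorem coe_ofFn_perm {m : ℕ} (α : Equiv.Perm (Fin m)) :
    (List.ofFn α : Multiset (Fin m)) = Finset.univ.val := by
  rw [List.ofFn_eq_map]
  exact congrArg Finset.val (Finset.map_univ_equiv α)

/-- The energy level of the channel `k` near `t v_{n+1}`, as a function of the cosine of the
quasi-momentum. -/
abbrev channelLevel (N p : ℕ) (b : ℝ) (v : ℤ → ℝ) (t : ℝ) (k : ℕ) (n : Fin (2 * p)) (x : ℝ) : ℝ :=
  level (2 * p) (aCoef N b k) (scaled v t) n x

/-- A coupling `t` so strong that the gaps of the potential `t v`, where `g` is a lower bound for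
the gaps of `v`, separate the levels of every channel. -/
structure StrongCoupling (p : ℕ) (v : ℤ → ℝ) (g t : ℝ) : Prop where
  two_le : 2 ≤ p
  periodic : Function.Periodic v ((2 * p : ℕ) : ℤ)
  gap : ∀ i j : Fin (2 * p), i ≠ j → g ≤ |v ((i : ℕ) + 1) - v ((j : ℕ) + 1)|
  pos : 0 < t
  le_mul : 20 ≤ t * g

theorem exists_eventually_strongCoupling {p : ℕ} {v : ℤ → ℝ} (hp : 2 ≤ p)
    (hper : Function.Periodic v ((2 * p : ℕ) : ℤ))
    (hdist : Function.Injective fun i : Fin (2 * p) => v (((i : ℕ) : ℤ) + 1)) :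
    ∃ g, ∀ᶠ t in atTop, StrongCoupling p v g t := by
  obtain ⟨g, hg0, hg⟩ := exists_pos_forall_le_abs_sub hdist
  refine ⟨g, ?_⟩
  filter_upwards [eventually_gt_atTop 0, eventually_ge_atTop (20 / g)] with t ht htg
  exact ⟨hp, hper, hg, ht, (div_le_iff₀ hg0).1 htg⟩

namespace StrongCoupling

variable {N p : ℕ} {b : ℝ} {v : ℤ → ℝ} {g t : ℝ} {k : ℕ} {α : Equiv.Perm (Fin (2 * p))}
variable (h : StrongCoupling p v g t)
include h

theorem gap_pos : 0 < g :=
  pos_of_mul_pos_right (by linarith [h.le_mul]) h.pos.le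

theorem mul_gap_le {i j : Fin (2 * p)} (hij : i ≠ j) :
    t * g ≤ |scaled v t ((i : ℕ) + 1) - scaled v t ((j : ℕ) + 1)| := by
  rw [scaled, scaled, ← mul_sub, abs_mul, abs_of_pos h.pos]
  exact mul_le_mul_of_nonneg_left (h.gap i j hij) h.pos.le

theorem sepJacobi (N : ℕ) (b : ℝ) (k : ℕ) : SepJacobi (2 * p) (aCoef N b k) (scaled v t) where
  hm := by have := h.two_le; omega
  a_per := aCoef_periodic N p b k
  u_per n := by rw [scaled, h.periodic n]; rfl
  a_nonneg := aCoef_nonneg N b k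
  a_add_le := aCoef_add_le N b k
  sep _ _ hij := h.le_mul.trans (h.mul_gap_le hij)

section Edges

variable (hα : StrictMono fun i : Fin (2 * p) => v (((α i : ℕ) : ℤ) + 1))
include hα

theorem bandEdges_eq_flatMap :
    bandEdges N p b v t k = (List.ofFn α).flatMap fun i =>
      [min (channelLevel N p b v t k i 1) (channelLevel N p b v t k i (-1)),
        max (channelLevel N p b v t k i 1) (channelLevel N p b v t k i (-1))] := by
  have hJ := h.sepJacobi N b k
  rw [← sort_eq_flatMap_min_max, coe_ofFn_perm, ← hJ.roots_floquetMatrix (Or.inl rfl),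
    ← hJ.roots_floquetMatrix (Or.inr rfl)]
  · rfl
  · rw [List.pairwise_ofFn]
    intro i j hij
    have hu : scaled v t ((α i : ℕ) + 1) < scaled v t ((α j : ℕ) + 1) :=
      mul_lt_mul_of_pos_left (hα hij) h.pos
    exact max_le (le_min (hJ.level_le_level hu (by simp) (by simp))
        (hJ.level_le_level hu (by simp) (by simp)))
      (le_min (hJ.level_le_level hu (by simp) (by simp))
        (hJ.level_le_level hu (by simp) (by simp)))

theorem bandLeft_bandRight_eq (n : Fin (2 * p)) :
    bandLeft N p b v t k (α.symm n) =
      min (channelLevel N p b v t k n 1) (channelLevel N p b v t k n (-1)) ∧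
    bandRight N p b v t k (α.symm n) =
      max (channelLevel N p b v t k n 1) (channelLevel N p b v t k n (-1)) := by
  have hlen : ((α.symm n : Fin (2 * p)) : ℕ) < (List.ofFn α).length := by simp
  have hget : (List.ofFn α)[((α.symm n : Fin (2 * p)) : ℕ)] = n := by simp
  have hd := getD_flatMap_pair
    (fun i => min (channelLevel N p b v t k i 1) (channelLevel N p b v t k i (-1)))
    (fun i => max (channelLevel N p b v t k i 1) (channelLevel N p b v t k i (-1))) _ _ hlen
  rwa [hget, ← h.bandEdges_eq_flatMap hα] at hd

theorem bandRight_sub_bandLeft (n : Fin (2 * p)) :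
    bandRight N p b v t k (α.symm n) - bandLeft N p b v t k (α.symm n) =
      |channelLevel N p b v t k n 1 - channelLevel N p b v t k n (-1)| := by
  obtain ⟨hleft, hright⟩ := h.bandLeft_bandRight_eq hα n
  rw [hleft, hright, max_sub_min_eq_abs, abs_sub_comm]

theorem bandLeft_mem_band (n : Fin (2 * p)) :
    bandLeft N p b v t k (α.symm n) ∈ band N p b v t k (α.symm n) :=
  left_mem_Icc.2 <| sub_nonneg.1 <| by rw [h.bandRight_sub_bandLeft hα]; positivity

theorem band_eq_uIcc (n : Fin (2 * p)) :
    band N p b v t k (α.symm n) =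
      uIcc (channelLevel N p b v t k n (-1)) (channelLevel N p b v t k n 1) := by
  obtain ⟨hleft, hright⟩ := h.bandLeft_bandRight_eq hα n
  rw [band, hleft, hright, uIcc_comm, uIcc]

theorem range_levelC (n : Fin (2 * p)) :
    range ((h.sepJacobi N b k).levelC n) = band N p b v t k (α.symm n) := by
  rw [SepJacobi.range_levelC, h.band_eq_uIcc hα]

end Edges

theorem abs_channelLevel_sub_le (n : Fin (2 * p)) {τ : ℝ} (hτ : τ = 1 ∨ τ = -1) :
    |channelLevel N p b v t k n τ -
      (t * v (((n : ℕ) : ℤ) + 1) - shiftC N b v k (((n : ℕ) : ℤ) + 1) / t)| ≤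
      256 / g ^ 2 / t ^ 2 := by
  have hlevel := (h.sepJacobi N b k).abs_level_sub_shift_le n hτ (by linarith [h.le_mul])
    fun _ hj => h.mul_gap_le hj.symm
  have hquot : ∀ x y z : ℝ, z / (t * x - t * y) = -(z / (y - x)) / t := fun x y z => by
    rw [← mul_sub, ← neg_sub y x, mul_neg, div_neg, neg_div, div_div, mul_comm t]
  rw [div_div, ← mul_pow, mul_comm g t]
  refine le_trans (le_of_eq ?_) hlevel
  simp only [scaled, shiftC, hquot, add_sub_cancel_right]
  congr 1
  ring

end StrongCoupling

theorem isBigO_prod_sub_one {ι X 𝕜 E : Type*} [NormedField 𝕜] [SeminormedAddCommGroup E]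
    {l : Filter X} {r : X → E} (hr : r =O[l] fun _ => (1 : 𝕜)) (s : Finset ι) {f : ι → X → 𝕜}
    (hf : ∀ i ∈ s, (fun x => f i x - 1) =O[l] r) :
    (fun x => ∏ i ∈ s, f i x - 1) =O[l] r := by
  classical
  induction s using Finset.induction_on with
  | empty => simpa only [Finset.prod_empty, sub_self] using isBigO_zero _ _
  | insert i s hi ih =>
    have hhead := hf i (Finset.mem_insert_self _ _)
    have htail := ih fun j hj => hf j (Finset.mem_insert_of_mem hj)
    have hbdd : f i =O[l] fun _ => (1 : 𝕜) := by
      simpa using (hhead.trans hr).add (isBigO_refl (fun _ => (1 : 𝕜)) l)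
    have hmul : (fun x => f i x * (∏ j ∈ s, f j x - 1)) =O[l] r := by
      simpa using (hbdd.norm_right.mul htail.norm_right).norm_right
    refine (hmul.add hhead).congr_left fun x => ?_
    rw [Finset.prod_insert hi]
    ring

theorem eventually_div_lt (K : ℝ) {ε : ℝ} (hε : 0 < ε) : ∀ᶠ t : ℝ in atTop, K / t < ε :=
  (tendsto_const_nhds.div_atTop tendsto_id).eventually (gt_mem_nhds hε)

section BandWidth

variable {N p : ℕ} {b : ℝ} {v : ℤ → ℝ} {g t : ℝ} {k : ℕ}

namespace StrongCoupling

variable (h : StrongCoupling p v g t)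
include h

theorem abs_gap_div_sub_one_le {n j : Fin (2 * p)} (hnj : n ≠ j) :
    |t * |v ((n : ℕ) + 1) - v ((j : ℕ) + 1)| /
      |channelLevel N p b v t k n 1 - channelLevel N p b v t k j (-1)| - 1| ≤ 14 / g * (1 / t) := by
  have hn := abs_lt.1 ((h.sepJacobi N b k).level_spec 1 (by simp) n).1
  have hj := abs_lt.1 ((h.sepJacobi N b k).level_spec (-1) (by simp) j).1
  have hgap := h.mul_gap_le hnj
  have htg := h.le_mul
  have hscale : t * |v ((n : ℕ) + 1) - v ((j : ℕ) + 1)| =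
      |scaled v t ((n : ℕ) + 1) - scaled v t ((j : ℕ) + 1)| := by
    rw [scaled, scaled, ← mul_sub, abs_mul, abs_of_pos h.pos]
  rw [hscale]
  set D := channelLevel N p b v t k n 1 - channelLevel N p b v t k j (-1)
  set d := scaled v t ((n : ℕ) + 1) - scaled v t ((j : ℕ) + 1)
  have hdD : |d - D| ≤ 8 := by
    rw [abs_le]
    constructor <;> linarith
  have hDlow : t * g - 8 ≤ |D| := by linarith [abs_sub_abs_le_abs_sub d D]
  have hDpos : 0 < |D| := by linarith
  have hdiff : |(|d| - |D|)| ≤ 8 := (abs_abs_sub_abs_le_abs_sub d D).trans hdD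
  rw [div_sub_one hDpos.ne', abs_div, abs_abs, div_mul_div_comm, mul_one,
    div_le_div_iff₀ hDpos (mul_pos h.gap_pos h.pos)]
  calc |(|d| - |D|)| * (g * t) ≤ 8 * (g * t) :=
        mul_le_mul_of_nonneg_right hdiff (mul_pos h.gap_pos h.pos).le
    _ ≤ 14 * |D| := by linarith

theorem abs_channelLevel_sub_mul_widthE (hc : cCoef N b k ≠ 0) (n : Fin (2 * p)) :
    |channelLevel N p b v t k n 1 - channelLevel N p b v t k n (-1)| *
        (widthE N p b v k n * t ^ (2 * p - 1)) =
      ∏ j ∈ Finset.univ.erase n, t * |v ((n : ℕ) + 1) - v ((j : ℕ) + 1)| /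
        |channelLevel N p b v t k n 1 - channelLevel N p b v t k j (-1)| := by
  have hJ := h.sepJacobi N b k
  have hprod := congrArg abs (hJ.level_sub_mul_prod (x := -1) (x' := 1) (by simp) (by simp) n)
  rw [abs_mul, Finset.abs_prod, cycProd_aCoef, abs_of_nonneg
    (a := 2 * |2 * cCoef N b k| ^ p * (1 - -1)) (by norm_num)] at hprod
  have : 0 < |2 * cCoef N b k| ^ p := by positivity
  have hcard : (Finset.univ.erase n).card = 2 * p - 1 := by
    rw [Finset.card_erase_of_mem (Finset.mem_univ _), Finset.card_univ, Fintype.card_fin]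
  have hQ : 0 < ∏ j ∈ Finset.univ.erase n,
      |channelLevel N p b v t k n 1 - channelLevel N p b v t k j (-1)| :=
    Finset.prod_pos fun j hj => lt_of_lt_of_le (by norm_num)
      (hJ.level_sub_far (by simp) (by simp) (Finset.ne_of_mem_erase hj).symm)
  rw [Finset.prod_div_distrib, Finset.prod_mul_distrib, Finset.prod_const, hcard, widthE,
    eq_div_iff hQ.ne', mul_right_comm, hprod]
  field_simp
  ring

end StrongCoupling

theorem isBigO_channelLevel_sub_mul_widthE (hev : ∀ᶠ t in atTop, StrongCoupling p v g t)
    (hc : cCoef N b k ≠ 0) (n : Fin (2 * p)) :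
    (fun t => |channelLevel N p b v t k n 1 - channelLevel N p b v t k n (-1)| *
        (widthE N p b v k n * t ^ (2 * p - 1)) - 1) =O[atTop] fun t => 1 / t := by
  have hbdd : (fun t : ℝ => 1 / t) =O[atTop] fun _ => (1 : ℝ) := by
    simpa only [one_div] using tendsto_inv_atTop_zero.isBigO_one ℝ
  have hprod : (fun t => ∏ j ∈ Finset.univ.erase n, t * |v ((n : ℕ) + 1) - v ((j : ℕ) + 1)| /
      |channelLevel N p b v t k n 1 - channelLevel N p b v t k j (-1)| - 1)
      =O[atTop] fun t => 1 / t := by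
    refine isBigO_prod_sub_one hbdd _ fun j hj => IsBigO.of_bound (14 / g) ?_
    filter_upwards [hev] with t h
    rw [Real.norm_eq_abs, Real.norm_of_nonneg (one_div_pos.2 h.pos).le]
    exact h.abs_gap_div_sub_one_le (Finset.ne_of_mem_erase hj).symm
  refine hprod.congr' ?_ EventuallyEq.rfl
  filter_upwards [hev] with t h
  rw [h.abs_channelLevel_sub_mul_widthE hc]

end BandWidth

section ShiftCoefficient

variable {N p : ℕ} {b : ℝ} {v : ℤ → ℝ} {k : ℕ}

theorem aCoef_sq_add_sq_le (N : ℕ) (b : ℝ) (k : ℕ) (n : ℤ) :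
    aCoef N b k n ^ 2 + aCoef N b k (n + 1) ^ 2 ≤ 5 := by
  have hsq : (2 * |cCoef N b k|) ^ 2 ≤ 4 := by
    rw [mul_pow, sq_abs, cCoef]
    linarith [Real.cos_sq_le_one (b + Real.pi * k / N)]
  by_cases he : Even n
  · rw [aCoef, aCoef, if_pos he, if_neg (by rwa [Int.even_add_one, not_not])]
    linarith
  · rw [aCoef, aCoef, if_neg he, if_pos (Int.even_add_one.2 he)]
    linarith

theorem shiftC_ne (hp : 2 ≤ p) (hper : Function.Periodic v ((2 * p : ℕ) : ℤ))
    (hdist : Function.Injective fun i : Fin (2 * p) => v (((i : ℕ) : ℤ) + 1))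
    {k' : ℕ} (h : |cCoef N b k| ≠ |cCoef N b k'|) (n : Fin (2 * p)) :
    shiftC N b v k (((n : ℕ) : ℤ) + 1) ≠ shiftC N b v k' (((n : ℕ) : ℤ) + 1) := by
  have hprev : v (n : ℕ) - v ((n : ℕ) + 1) ≠ 0 := by
    rw [← apply_cycPrev_add_one_of_periodic hper]
    exact sub_ne_zero.2 (hdist.ne (cycPrev_ne_self (by omega) n))
  have hnext : v ((n : ℕ) + 1 + 1) - v ((n : ℕ) + 1) ≠ 0 := by
    rw [← apply_cycNext_add_one_of_periodic hper]
    exact sub_ne_zero.2 (hdist.ne (cycNext_ne_self (by omega) n))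
  have hsq : (2 * |cCoef N b k|) ^ 2 ≠ (2 * |cCoef N b k'|) ^ 2 := by
    rw [ne_eq, sq_eq_sq₀ (by positivity) (by positivity)]
    exact (mul_right_injective₀ two_ne_zero).ne h
  rw [shiftC, shiftC, add_sub_cancel_right]
  by_cases he : Even ((n : ℕ) : ℤ)
  · have ho : ¬ Even (((n : ℕ) : ℤ) + 1) := by rwa [Int.even_add_one, not_not]
    simp only [aCoef, if_pos he, if_neg ho]
    exact fun e => hsq ((div_left_inj' hprev).1 (add_right_cancel e))
  · simp only [aCoef, if_neg he, if_pos (Int.even_add_one.2 he)]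
    exact fun e => hsq ((div_left_inj' hnext).1 (add_left_cancel e))

theorem abs_shiftC_lt (hper : Function.Periodic v ((2 * p : ℕ) : ℤ)) {δ : ℝ}
    (hδ : ∀ n : Fin (2 * p), 5 / |v (((n : ℕ) : ℤ) + 1) - v (((n : ℕ) : ℤ) + 2)| < δ)
    (n : Fin (2 * p)) : |shiftC N b v k (((n : ℕ) : ℤ) + 1)| < δ := by
  have htwo : ∀ i : ℤ, v (i + 2) = v (i + 1 + 1) := fun i => by rw [add_assoc, one_add_one_eq_two]
  have hprev : 5 * |v (n : ℕ) - v ((n : ℕ) + 1)|⁻¹ < δ := by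
    have hcyc := apply_cycPrev_add_one_of_periodic (hper.add_const 1) n
    have := hδ (cycPrev n)
    rwa [htwo, hcyc, apply_cycPrev_add_one_of_periodic hper, div_eq_mul_inv] at this
  have hnext : 5 * |v ((n : ℕ) + 1 + 1) - v ((n : ℕ) + 1)|⁻¹ < δ := by
    have := hδ n
    rwa [abs_sub_comm, htwo, div_eq_mul_inv] at this
  rw [shiftC, add_sub_cancel_right]
  set x := v (n : ℕ) - v ((n : ℕ) + 1)
  set y := v ((n : ℕ) + 1 + 1) - v ((n : ℕ) + 1)
  have hmax : 5 * max |x|⁻¹ |y|⁻¹ < δ := by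
    rw [mul_max_of_nonneg _ _ (by norm_num)]
    exact max_lt hprev hnext
  calc |aCoef N b k (n : ℕ) ^ 2 / x + aCoef N b k ((n : ℕ) + 1) ^ 2 / y|
      ≤ |aCoef N b k (n : ℕ) ^ 2 / x| + |aCoef N b k ((n : ℕ) + 1) ^ 2 / y| := abs_add_le _ _
    _ = aCoef N b k (n : ℕ) ^ 2 * |x|⁻¹ + aCoef N b k ((n : ℕ) + 1) ^ 2 * |y|⁻¹ := by
        rw [abs_div, abs_div, abs_sq, abs_sq, div_eq_mul_inv, div_eq_mul_inv]
    _ ≤ aCoef N b k (n : ℕ) ^ 2 * max |x|⁻¹ |y|⁻¹ +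
          aCoef N b k ((n : ℕ) + 1) ^ 2 * max |x|⁻¹ |y|⁻¹ := by
        gcongr
        · exact le_max_left _ _
        · exact le_max_right _ _
    _ ≤ 5 * max |x|⁻¹ |y|⁻¹ := by
        rw [← add_mul]
        gcongr
        exact aCoef_sq_add_sq_le N b k n
    _ < δ := hmax

end ShiftCoefficient

theorem card_filter_univ_coe {ι : Type*} (s : Finset ι) (q : ι → Prop) [DecidablePred q] :
    (Finset.univ.filter fun x : s => q x).card = Set.ncard {i | i ∈ s ∧ q i} := by
  rw [← Finset.coe_filter, Set.ncard_coe_finset, Finset.univ_eq_attach, Finset.filter_attach q,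
    Finset.card_map, Finset.card_attach]

theorem abs_sub_lt_div_of_abs_sub_sub_le {x w A K δ t : ℝ} (ht : 0 < t)
    (hx : |x - (w - A / t)| ≤ K / t ^ 2) (hK : K / t < δ - |A|) : |x - w| < δ / t := by
  calc |x - w| = |x - (w - A / t) - A / t| := by ring_nf
    _ ≤ |x - (w - A / t)| + |A / t| := abs_sub _ _
    _ ≤ K / t ^ 2 + |A / t| := by gcongr
    _ = (K / t + |A|) / t := by rw [abs_div, abs_of_pos ht]; field_simp
    _ < δ / t := by gcongr; linarith

namespace StrongCoupling

variable {N p : ℕ} {b : ℝ} {g t : ℝ} {k : ℕ} {α : Equiv.Perm (Fin (2 * p))}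

section Position

variable {v : ℤ → ℝ} (h : StrongCoupling p v g t)
variable (hα : StrictMono fun i : Fin (2 * p) => v (((α i : ℕ) : ℤ) + 1))
include h hα

theorem levelC_mem_band (n : Fin (2 * p)) (θ : UnitAddCircle) :
    (h.sepJacobi N b k).levelC n θ ∈ band N p b v t k (α.symm n) :=
  h.range_levelC hα n ▸ mem_range_self θ

theorem abs_sub_lt_of_mem_band {n : Fin (2 * p)} {x : ℝ}
    (hx : x ∈ band N p b v t k (α.symm n)) : |x - t * v ((n : ℕ) + 1)| < 4 := by
  rw [← h.range_levelC hα] at hx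
  obtain ⟨θ, rfl⟩ := hx
  exact ((h.sepJacobi N b k).level_spec _ (circCos_mem θ) n).1

theorem abs_sub_le_of_mem_band {n : Fin (2 * p)} {x : ℝ}
    (hx : x ∈ band N p b v t k (α.symm n)) :
    |x - (t * v (((n : ℕ) : ℤ) + 1) - shiftC N b v k (((n : ℕ) : ℤ) + 1) / t)| ≤
      256 / g ^ 2 / t ^ 2 := by
  have hpos := h.abs_channelLevel_sub_le (N := N) (b := b) (k := k) n (Or.inl rfl)
  have hneg := h.abs_channelLevel_sub_le (N := N) (b := b) (k := k) n (Or.inr rfl)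
  rw [h.band_eq_uIcc hα] at hx
  rw [← Real.dist_eq, ← Metric.mem_closedBall, Real.closedBall_eq_Icc] at hpos hneg ⊢
  exact ordConnected_Icc.uIcc_subset hneg hpos hx

theorem band_subset_Ioo (n : Fin (2 * p)) {δ : ℝ}
    (hC : 256 / g ^ 2 / t < δ - |shiftC N b v k (((n : ℕ) : ℤ) + 1)|) :
    band N p b v t k (α.symm n) ⊆
      Ioo (v (((n : ℕ) : ℤ) + 1) * t - δ / t) (v (((n : ℕ) : ℤ) + 1) * t + δ / t) := by
  intro x hx
  rw [← Real.ball_eq_Ioo, Metric.mem_ball, Real.dist_eq, mul_comm]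
  exact abs_sub_lt_div_of_abs_sub_sub_le h.pos (h.abs_sub_le_of_mem_band hα hx) hC

theorem disjoint_band (n : Fin (2 * p)) {k' : ℕ}
    (hC : 512 / g ^ 2 / t <
      |shiftC N b v k (((n : ℕ) : ℤ) + 1) - shiftC N b v k' (((n : ℕ) : ℤ) + 1)|) :
    Disjoint (band N p b v t k (α.symm n)) (band N p b v t k' (α.symm n)) := by
  rw [Set.disjoint_left]
  intro x hx hx'
  have hk := h.abs_sub_le_of_mem_band hα hx
  have hk' := h.abs_sub_le_of_mem_band hα hx'
  have ht := h.pos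
  set A := shiftC N b v k (((n : ℕ) : ℤ) + 1)
  set A' := shiftC N b v k' (((n : ℕ) : ℤ) + 1)
  set w := t * v (((n : ℕ) : ℤ) + 1)
  refine hC.not_ge ?_
  calc |A - A'| = |(x - (w - A / t)) - (x - (w - A' / t))| * t := by
        rw [← abs_of_pos ht, ← abs_mul, abs_of_pos ht]
        congr 1
        field_simp
        ring
    _ ≤ (256 / g ^ 2 / t ^ 2 + 256 / g ^ 2 / t ^ 2) * t := by
        gcongr
        exact (abs_sub _ _).trans (add_le_add hk hk')
    _ = 512 / g ^ 2 / t := by field_simp; norm_num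

theorem mul_add_twenty_le {i j : Fin (2 * p)} (hij : i < j) :
    t * v ((α i : ℕ) + 1) + 20 ≤ t * v ((α j : ℕ) + 1) := by
  have hgap := h.mul_gap_le (α.injective.ne hij.ne)
  have hlt : scaled v t ((α i : ℕ) + 1) < scaled v t ((α j : ℕ) + 1) :=
    mul_lt_mul_of_pos_left (hα hij) h.pos
  rw [abs_of_neg (sub_neg.2 hlt), scaled, scaled] at hgap
  linarith [h.le_mul]

theorem mem_clusterInterval_of_abs_sub_lt {n : Fin (2 * p)} {x : ℝ}
    (hx : |x - t * v ((n : ℕ) + 1)| < 4) : x ∈ clusterInterval p v α t (α.symm n) := by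
  obtain ⟨j, rfl⟩ := α.surjective n
  rw [α.symm_apply_apply]
  rw [abs_lt] at hx
  refine ⟨fun i hi => ?_, fun i hi => ?_⟩
  · linarith [h.mul_add_twenty_le hα (Fin.lt_def.2 (by omega) : i < j)]
  · linarith [h.mul_add_twenty_le hα (Fin.lt_def.2 (by omega) : j < i)]

theorem eq_of_mem_clusterInterval {n n' : Fin (2 * p)} {x : ℝ}
    (hx : |x - t * v ((n' : ℕ) + 1)| < 4) (hmem : x ∈ clusterInterval p v α t (α.symm n)) :
    n = n' := by
  obtain ⟨m, rfl⟩ := α.surjective n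
  obtain ⟨j, rfl⟩ := α.surjective n'
  rw [α.symm_apply_apply] at hmem
  have hmono : Monotone fun i => t * v ((α i : ℕ) + 1) :=
    hα.monotone.const_mul h.pos.le
  rw [abs_lt] at hx
  by_contra hne
  rcases lt_or_gt_of_ne (α.injective.ne_iff.1 hne) with hmj | hjm
  · have hlt : (m : ℕ) + 1 < 2 * p := by omega
    have hle := hmono (show (⟨m + 1, hlt⟩ : Fin (2 * p)) ≤ j from Fin.le_def.2 hmj)
    have hgap := h.mul_add_twenty_le hα (show m < ⟨m + 1, hlt⟩ from Fin.lt_def.2 (by simp))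
    have := hmem.2 ⟨m + 1, hlt⟩ rfl
    linarith
  · have hlt : (m : ℕ) - 1 < 2 * p := by omega
    have hsucc : (m : ℕ) - 1 + 1 = m := by omega
    have hle := hmono (show j ≤ (⟨m - 1, hlt⟩ : Fin (2 * p)) from
      Fin.le_def.2 (show (j : ℕ) ≤ m - 1 by omega))
    have hgap := h.mul_add_twenty_le hα (show ⟨m - 1, hlt⟩ < m from
      Fin.lt_def.2 (show (m : ℕ) - 1 < m by omega))
    have := hmem.1 ⟨m - 1, hlt⟩ hsucc
    linarith

end Position

section Spectrum

open AddCircle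

variable {v : EllInfty} (h : StrongCoupling p v g t) [NeZero (2 * p)]

/-- The diagonalization of the channel `k`. -/
def channelModel (N : ℕ) (b : ℝ) (k : ℕ) :
    DiagModel (jacobi N b v t k) (haarAddCircle : Measure UnitAddCircle) (Fin (2 * p)) :=
  (h.sepJacobi N b k).diagModel _ (jacobi_apply N b v t k)

/-- The diagonalization of the nanotube Hamiltonian by the channels. -/
def nanotubeModel (N : ℕ) [NeZero N] (b : ℝ) : DiagModel (hamiltonian N b v t)
    (haarAddCircle : Measure UnitAddCircle) (Finset.Icc 1 N × Fin (2 * p)) :=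
  tubeModel N b v t fun k => h.channelModel N b k

theorem nanotubeModel_symbol [NeZero N] (x : Finset.Icc 1 N × Fin (2 * p)) :
    (h.nanotubeModel N b).symbol x = (h.sepJacobi N b x.1).levelC x.2 := rfl

variable [NeZero N] (hα : StrictMono fun i : Fin (2 * p) => v (((α i : ℕ) : ℤ) + 1))
include h hα

theorem range_nanotubeModel_symbol (k : Finset.Icc 1 N) (n : Fin (2 * p)) :
    range ((h.nanotubeModel N b).symbol (k, n)) = band N p b v t k (α.symm n) := by
  rw [nanotubeModel_symbol, h.range_levelC hα]

theorem realSpectrum_inter_clusterInterval (n : Fin (2 * p)) :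
    realSpectrum (hamiltonian N b v t) ∩ clusterInterval p v α t (α.symm n) =
      ⋃ k ∈ Finset.Icc 1 N, band N p b v t k (α.symm n) := by
  rw [(h.nanotubeModel N b).realSpectrum_eq]
  ext x
  simp only [mem_inter_iff, mem_iUnion, exists_prop]
  constructor
  · rintro ⟨⟨⟨k, n'⟩, hx⟩, hmem⟩
    rw [h.range_nanotubeModel_symbol hα] at hx
    obtain rfl := h.eq_of_mem_clusterInterval hα (h.abs_sub_lt_of_mem_band hα hx) hmem
    exact ⟨k, k.2, hx⟩
  · rintro ⟨k, hk, hx⟩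
    refine ⟨⟨(⟨k, hk⟩, n), ?_⟩,
      h.mem_clusterInterval_of_abs_sub_lt hα (h.abs_sub_lt_of_mem_band hα hx)⟩
    rwa [h.range_nanotubeModel_symbol hα]

theorem hasSpectralMultiplicity_band {k : ℕ} (n : Fin (2 * p)) (hc : cCoef N b k ≠ 0)
    (hdisj : ∀ k' ∈ Finset.Icc 1 N, |cCoef N b k| ≠ |cCoef N b k'| →
      Disjoint (band N p b v t k (α.symm n)) (band N p b v t k' (α.symm n))) :
    HasSpectralMultiplicity (hamiltonian N b v t) (band N p b v t k (α.symm n))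
      (2 * Set.ncard {k' : ℕ | k' ∈ Finset.Icc 1 N ∧ |cCoef N b k'| = |cCoef N b k|}) := by
  have hP : cycProd (2 * p) (aCoef N b k) ≠ 0 := by
    rw [cycProd_aCoef]
    exact pow_ne_zero _ (abs_ne_zero.2 (mul_ne_zero two_ne_zero hc))
  have hsep := h.sepJacobi N b k
  set J : Finset (Finset.Icc 1 N) := {k' | |cCoef N b k'| = |cCoef N b k|} with hJ
  have hcard : Set.ncard {k' : ℕ | k' ∈ Finset.Icc 1 N ∧ |cCoef N b k'| = |cCoef N b k|} =
      (J ×ˢ {n}).card := by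
    rw [Finset.card_product, Finset.card_singleton, mul_one, hJ,
      card_filter_univ_coe (Finset.Icc 1 N) fun j => |cCoef N b j| = |cCoef N b k|]
  rw [hcard]
  refine (h.nanotubeModel N b).hasSpectralMultiplicity
    (circleCyclicDecomposition (l := hsep.levelC n) (G := fun x =>
      1 + (cycMatrix (2 * p) (aCoef N b k) (scaled v t) 1).charpoly.eval x /
        (2 * cycProd (2 * p) (aCoef N b k))) ?_ ?_ (hsep.circCos_eq_of_level hP n))
    measurableSet_Icc ?_ (h.levelC_mem_band hα n) ?_
  · intro θ
    rw [SepJacobi.levelC_apply, SepJacobi.levelC_apply, circCos_neg]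
  · exact measurable_const.add ((Polynomial.continuous _).measurable.div_const _)
  · rintro ⟨k', i⟩ hx
    obtain ⟨hk', hi⟩ := Finset.mem_product.1 hx
    obtain rfl := Finset.mem_singleton.1 hi
    ext θ
    rw [nanotubeModel_symbol, SepJacobi.levelC_apply, SepJacobi.levelC_apply,
      aCoef_congr (Finset.mem_filter.1 hk').2]
  · rintro ⟨k', i⟩ hx θ hmem
    obtain rfl := h.eq_of_mem_clusterInterval hα
      (h.abs_sub_lt_of_mem_band hα (h.levelC_mem_band hα i θ))
      (h.mem_clusterInterval_of_abs_sub_lt hα (h.abs_sub_lt_of_mem_band hα hmem))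
    refine Set.disjoint_left.1 (hdisj k' k'.2 fun hkk' => hx ?_) hmem
      (h.levelC_mem_band hα n θ)
    exact Finset.mk_mem_product (Finset.mem_filter.2 ⟨Finset.mem_univ _, hkk'.symm⟩)
      (Finset.mem_singleton_self n)

theorem isFlatBand_band {k : ℕ} (n : Fin (2 * p)) (hk : k ∈ Finset.Icc 1 N)
    (hc : cCoef N b k = 0) :
    IsFlatBand (jacobi N b v t k) (band N p b v t k (α.symm n)) ∧
      IsFlatBand (hamiltonian N b v t) (band N p b v t k (α.symm n)) := by
  have hP : cycProd (2 * p) (aCoef N b k) = 0 := by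
    rw [cycProd_aCoef, hc, mul_zero, abs_zero, zero_pow (by linarith [h.two_le])]
  have hconst : ∀ x ∈ Icc (-1 : ℝ) 1,
      channelLevel N p b v t k n x = channelLevel N p b v t k n 1 := by
    intro x hx
    have hle := (h.sepJacobi N b k).abs_level_sub_le (right_mem_Icc.2 (by norm_num)) hx n
    rw [hP, mul_zero, zero_mul] at hle
    exact sub_eq_zero.1 (abs_nonpos_iff.1 hle)
  have hband : band N p b v t k (α.symm n) = {channelLevel N p b v t k n 1} := by
    rw [h.band_eq_uIcc hα, hconst (-1) (by simp), uIcc_self]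
  have hlevel : ∀ θ, (h.sepJacobi N b k).levelC n θ = channelLevel N p b v t k n 1 := fun θ =>
    hconst _ (circCos_mem θ)
  exact ⟨⟨_, hband, (h.channelModel N b k).not_finiteDimensional_eigenspace
      not_finiteDimensional_circL2 (i := n) hlevel⟩,
    ⟨_, hband, (h.nanotubeModel N b).not_finiteDimensional_eigenspace
      not_finiteDimensional_circL2 (i := (⟨k, hk⟩, n)) hlevel⟩⟩

end Spectrum

end StrongCoupling

section Asymptotic

variable {N p : ℕ} {b : ℝ} {v : ℤ → ℝ} {g : ℝ} {k k' : ℕ} {α : Equiv.Perm (Fin (2 * p))}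
variable (hev : ∀ᶠ t in atTop, StrongCoupling p v g t)
variable (hα : StrictMono fun i : Fin (2 * p) => v (((α i : ℕ) : ℤ) + 1)) {n : Fin (2 * p)}
include hev hα

theorem isBigO_bandLeft_sub :
    (fun t => bandLeft N p b v t k (α.symm n) -
      (t * v (((n : ℕ) : ℤ) + 1) - shiftC N b v k (((n : ℕ) : ℤ) + 1) / t))
      =O[atTop] fun t => 1 / t ^ 2 := by
  refine IsBigO.of_bound (256 / g ^ 2) (hev.mono fun t h => ?_)
  rw [Real.norm_eq_abs, Real.norm_of_nonneg (by positivity), mul_one_div]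
  exact h.abs_sub_le_of_mem_band hα (h.bandLeft_mem_band hα n)

theorem isBigO_bandRight_sub_bandLeft (hc : cCoef N b k ≠ 0) :
    (fun t => (bandRight N p b v t k (α.symm n) - bandLeft N p b v t k (α.symm n)) *
      (widthE N p b v k n * t ^ (2 * p - 1)) - 1) =O[atTop] fun t => 1 / t := by
  refine (isBigO_channelLevel_sub_mul_widthE hev hc n).congr' ?_ EventuallyEq.rfl
  filter_upwards [hev] with t h
  rw [h.bandRight_sub_bandLeft hα]

theorem eventually_band_subset_Ioo {δ : ℝ} (hδ : |shiftC N b v k (((n : ℕ) : ℤ) + 1)| < δ) :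
    ∀ᶠ t in atTop, band N p b v t k (α.symm n) ⊆
      Ioo (v (((n : ℕ) : ℤ) + 1) * t - δ / t) (v (((n : ℕ) : ℤ) + 1) * t + δ / t) := by
  filter_upwards [hev, eventually_div_lt _ (sub_pos.2 hδ)] with t h ht
  exact h.band_subset_Ioo hα n ht

theorem eventually_disjoint_band
    (hC : shiftC N b v k (((n : ℕ) : ℤ) + 1) ≠ shiftC N b v k' (((n : ℕ) : ℤ) + 1)) :
    ∀ᶠ t in atTop, Disjoint (band N p b v t k (α.symm n)) (band N p b v t k' (α.symm n)) := by
  filter_upwards [hev, eventually_div_lt _ (abs_pos.2 (sub_ne_zero.2 hC))] with t h ht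
  exact h.disjoint_band hα n ht

end Asymptotic

theorem setOf_abs_cCoef_eq_singleton {N : ℕ} {b : ℝ} (hb : ∀ m : ℤ, b ≠ Real.pi / (2 * N) * m)
    {k : ℕ} (hk : k ∈ Finset.Icc 1 N) :
    {k' : ℕ | k' ∈ Finset.Icc 1 N ∧ |cCoef N b k'| = |cCoef N b k|} = {k} :=
  Set.ext fun _ => ⟨fun hk' => abs_cCoef_injOn hb hk'.1 hk hk'.2, by rintro rfl; exact ⟨hk, rfl⟩⟩

end

end Nanotube

theorem theorem4 (N p : ℕ) (hN : 1 ≤ N) (hp : 2 ≤ p) (b : ℝ) (v : Nanotube.EllInfty)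
    (hper : Function.Periodic (v : ℤ → ℝ) ((2 * p : ℕ) : ℤ))
    (hdist : Function.Injective (fun i : Fin (2 * p) => v (((i : ℕ) : ℤ) + 1)))
    (α : Equiv.Perm (Fin (2 * p)))
    (hα : StrictMono (fun i : Fin (2 * p) => v (((α i : ℕ) : ℤ) + 1))) :
    -- position and length of the bands
    (∀ k ∈ Finset.Icc 1 N, Nanotube.cCoef N b k ≠ 0 → ∀ n : Fin (2 * p),
      (fun t : ℝ => Nanotube.bandLeft N p b v t k (α.symm n) -
          (t * v (((n : ℕ) : ℤ) + 1) - Nanotube.shiftC N b v k (((n : ℕ) : ℤ) + 1) / t))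
        =O[Filter.atTop] (fun t : ℝ => 1 / t ^ 2) ∧
      (fun t : ℝ => (Nanotube.bandRight N p b v t k (α.symm n) -
            Nanotube.bandLeft N p b v t k (α.symm n)) *
          (Nanotube.widthE N p b v k n * t ^ (2 * p - 1)) - 1)
        =O[Filter.atTop] (fun t : ℝ => 1 / t)) ∧
    -- the clusters
    (∀ᶠ t : ℝ in Filter.atTop, ∀ n : Fin (2 * p),
      Nanotube.realSpectrum (Nanotube.hamiltonian N b v t) ∩
          Nanotube.clusterInterval p v α t (α.symm n) =
        ⋃ k ∈ Finset.Icc 1 N, Nanotube.band N p b v t k (α.symm n)) ∧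
    (∀ δ : ℝ,
      ((∀ k ∈ Finset.Icc 1 N, ∀ n : Fin (2 * p),
          |Nanotube.shiftC N b v k (((n : ℕ) : ℤ) + 1)| < δ) ∨
        (∀ n : Fin (2 * p),
          5 / |v (((n : ℕ) : ℤ) + 1) - v (((n : ℕ) : ℤ) + 2)| < δ)) →
      ∀ᶠ t : ℝ in Filter.atTop, ∀ n : Fin (2 * p),
        (⋃ k ∈ Finset.Icc 1 N, Nanotube.band N p b v t k (α.symm n)) ⊆
          Set.Ioo (v (((n : ℕ) : ℤ) + 1) * t - δ / t) (v (((n : ℕ) : ℤ) + 1) * t + δ / t)) ∧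
    -- disjointness, multiplicity and flat bands
    (∀ᶠ t : ℝ in Filter.atTop, ∀ k ∈ Finset.Icc 1 N, ∀ n : Fin (2 * p),
      (∀ k' ∈ Finset.Icc 1 N,
        ((k ≠ k' ∧ ∀ m : ℤ, b ≠ Real.pi / (2 * N) * m) ∨
          |Nanotube.cCoef N b k| ≠ |Nanotube.cCoef N b k'|) →
        Disjoint (Nanotube.band N p b v t k (α.symm n))
          (Nanotube.band N p b v t k' (α.symm n))) ∧
      (Nanotube.cCoef N b k ≠ 0 →
        Nanotube.HasSpectralMultiplicity (Nanotube.hamiltonian N b v t)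
          (Nanotube.band N p b v t k (α.symm n))
          (2 * Set.ncard {k' : ℕ | k' ∈ Finset.Icc 1 N ∧
            |Nanotube.cCoef N b k'| = |Nanotube.cCoef N b k|})) ∧
      (Nanotube.cCoef N b k ≠ 0 → (∀ m : ℤ, b ≠ Real.pi / (2 * N) * m) →
        Nanotube.HasSpectralMultiplicity (Nanotube.hamiltonian N b v t)
          (Nanotube.band N p b v t k (α.symm n)) 2) ∧
      (Nanotube.cCoef N b k = 0 →
        Nanotube.IsFlatBand (Nanotube.jacobi N b v t k)
            (Nanotube.band N p b v t k (α.symm n)) ∧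
          Nanotube.IsFlatBand (Nanotube.hamiltonian N b v t)
            (Nanotube.band N p b v t k (α.symm n)))) := by
  have : NeZero N := ⟨by omega⟩
  have : NeZero (2 * p) := ⟨by omega⟩
  obtain ⟨g, hev⟩ := Nanotube.exists_eventually_strongCoupling hp hper hdist
  refine ⟨fun k _ hc n => ⟨Nanotube.isBigO_bandLeft_sub hev hα,
    Nanotube.isBigO_bandRight_sub_bandLeft hev hα hc⟩,
    hev.mono fun t h n => h.realSpectrum_inter_clusterInterval hα n, fun δ hδ => ?_, ?_⟩
  · simp only [iUnion₂_subset_iff, eventually_all, eventually_all_finset]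
    exact fun n k hk => Nanotube.eventually_band_subset_Ioo hev hα
      (hδ.elim (fun hC => hC k hk n) fun hv => Nanotube.abs_shiftC_lt hper hv n)
  have hdisj : ∀ᶠ t in atTop, ∀ k ∈ Finset.Icc 1 N, ∀ n : Fin (2 * p), ∀ k' ∈ Finset.Icc 1 N,
      |Nanotube.cCoef N b k| ≠ |Nanotube.cCoef N b k'| →
      Disjoint (Nanotube.band N p b v t k (α.symm n)) (Nanotube.band N p b v t k' (α.symm n)) := by
    simp only [eventually_all, eventually_all_finset]
    exact fun k _ n k' _ hne => Nanotube.eventually_disjoint_band hev hα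
      (Nanotube.shiftC_ne hp hper hdist hne n)
  filter_upwards [hev, hdisj] with t h hd k hk n
  have hmult := fun hc => h.hasSpectralMultiplicity_band hα n hc (hd k hk n)
  refine ⟨fun k' hk' hkk' => hd k hk n k' hk' ?_, hmult, fun hc hb => ?_,
    h.isFlatBand_band hα n hk⟩
  · exact hkk'.elim (fun ⟨hne, hb⟩ => (Nanotube.abs_cCoef_injOn hb).ne hk hk' hne) id
  · simpa only [Nanotube.setOf_abs_cCoef_eq_singleton hb hk, ncard_singleton] using hmult hc
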